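/- Let $M$ be a connected, closed (compact, without boundary), smooth Riemannian manifold of dimension $n$, and let $|p|$ denote the norm induced by the metric on the cotangent spaces $T^*_xM$. Let $H=H(x,p,u)$ be a real-valued function on $T^*M\times\mathbb{R}$ such that: (H1) $H$ is continuous on $T^*M\times\mathbb{R}$; (H2) for every $R>0$ there is $K>0$ such that $H(x,p,u)>R$ whenever $|u|\le R$ and $|p|\ge K$; (H3) for every $(x,u)\in M\times\mathbb{R}$ the function $p\mapsto H(x,p,u)$ is convex on $T_x^*M$; (H4) the functions $u\mapsto H(x,p,u)$ are Lipschitz continuous on $\mathbb{R}$ with a constant independent of $(x,p)\in T^*M$. For a space $X$ let $\mathrm{LSC}(X)$ denote the set of lower semicontinuous functions $X\to\mathbb{R}\cup\{\infty\}$. Given $\varphi\in\mathrm{LSC}(M)$, a *BJ solution* of the Cauchy problem $$u_t+H(x,D_xu,u)=0\ \text{ in } M\times(0,\infty),\qquad u(\cdot,0)=\varphi,$$ is a function $u\in\mathrm{LSC}(M\times[0,\infty))$ such that (i) $\psi_t(x,t)+H(x,D_x\psi(x,t),u(x,t))=0$ whenever $\psi\in C^1(M\times(0,\infty),\mathbb{R})$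 and $u-\psi$ attains its minimum over $M\times(0,\infty)$ at a point $(x,t)\in M\times(0,\infty)$ with $u(x,t)<\infty$ (that is, $u$ is both a subsolution, with "$\le 0$", and a supersolution, with "$\ge 0$"); and (ii) $\varphi(x)=u(x,0)=\liminf_{t\to0+}u(x,t)$ for every $x\in M$. **Theorem.** Under (H1)–(H4), for every $\varphi\in\mathrm{LSC}(M)$ the Cauchy problem has exactly one BJ solution $u$. Moreover, the maps $S_t:\mathrm{LSC}(M)\to\mathrm{LSC}(M)$, $t\ge0$, given by $S_t\varphi=u(\cdot,t)$, form a semigroup: $S_0=\mathrm{id}$ and $S_t\circ S_s=S_{t+s}$ for all $s,t\ge 0$. -/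

import Mathlib

open Set Filter Topology Bundle
open scoped Manifold ContDiff NNReal

noncomputable section

/-- The cotangent space `T*_x M` of an `n`-dimensional manifold `M`. -/
abbrev CotSpace (n : ℕ) {M : Type*} [TopologicalSpace M]
    [ChartedSpace (EuclideanSpace ℝ (Fin n)) M] (x : M) : Type :=
  TangentSpace (𝓡 n) x →L[ℝ] Bundle.Trivial M ℝ x

/-- The cotangent bundle `T*M`, with the vector bundle topology. -/
abbrev CotBundle (n : ℕ) (M : Type*) [TopologicalSpace M]
    [ChartedSpace (EuclideanSpace ℝ (Fin n)) M] : Type _ :=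
  TotalSpace (EuclideanSpace ℝ (Fin n) →L[ℝ] ℝ) (fun x : M => CotSpace n x)

/-- Functions in `LSC(X, ℝ ∪ {∞})`; `ℝ ∪ {∞}` is the set of extended reals other than `-∞`. -/
structure IsLSC {X : Type*} [TopologicalSpace X] (f : X → EReal) : Prop where
  lsc : LowerSemicontinuous f
  ne_bot : ∀ x, f x ≠ ⊥

/-- The set `LSC(X, ℝ ∪ {∞})`. -/
def LSCFun (X : Type*) [TopologicalSpace X] : Type _ := {f : X → EReal // IsLSC f}

section BJ

variable {n : ℕ} {M : Type*} [TopologicalSpace M] [ChartedSpace (EuclideanSpace ℝ (Fin n)) M]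

/-- The differential `D_x ψ (x, t) ∈ T*_x M` of the function `y ↦ ψ (y, t)` at `x`. -/
def spaceDiff (ψ : M × ℝ → ℝ) (x : M) (t : ℝ) : CotSpace n x :=
  mfderiv (𝓡 n) 𝓘(ℝ, ℝ) (fun y => ψ (y, t)) x

/-- The partial derivative `∂ψ/∂t (x, t)`. -/
def timeDeriv (ψ : M × ℝ → ℝ) (x : M) (t : ℝ) : ℝ := deriv (fun s => ψ (x, s)) t

/-- `ψ` is `C¹` on `M × (0, ∞)` and `u - ψ` attains its minimum over `M × (0, ∞)` at `(x, t)`,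
a point of `M × (0, ∞)` at which `u` is finite. -/
structure TouchesBelow (n : ℕ) {M : Type*} [TopologicalSpace M]
    [ChartedSpace (EuclideanSpace ℝ (Fin n)) M]
    (u : M × ℝ≥0 → EReal) (ψ : M × ℝ → ℝ) (x : M) (t : ℝ≥0) : Prop where
  pos : 0 < t
  contMDiffOn : ContMDiffOn ((𝓡 n).prod 𝓘(ℝ, ℝ)) 𝓘(ℝ, ℝ) 1 ψ (univ ×ˢ Ioi (0 : ℝ))
  finite : u (x, t) ≠ ⊤
  isMin : ∀ (y : M) (s : ℝ≥0), 0 < s →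
    u (x, t) - (ψ (x, (t : ℝ)) : EReal) ≤ u (y, s) - (ψ (y, (s : ℝ)) : EReal)

/-- BJ (lower semicontinuous viscosity) subsolutions of `u_t + H(x, D_x u, u) = 0` in
`M × (0, ∞)`. Only the values of `u` at positive times matter. -/
def IsBJSubsol (H : ∀ x : M, CotSpace n x → ℝ → ℝ) (u : M × ℝ≥0 → EReal) : Prop :=
  ∀ (ψ : M × ℝ → ℝ) (x : M) (t : ℝ≥0), TouchesBelow n u ψ x t →
    timeDeriv ψ x t + H x (spaceDiff ψ x t) (u (x, t)).toReal ≤ 0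

/-- BJ (lower semicontinuous viscosity) supersolutions of `u_t + H(x, D_x u, u) = 0` in
`M × (0, ∞)`. -/
def IsBJSupersol (H : ∀ x : M, CotSpace n x → ℝ → ℝ) (u : M × ℝ≥0 → EReal) : Prop :=
  ∀ (ψ : M × ℝ → ℝ) (x : M) (t : ℝ≥0), TouchesBelow n u ψ x t →
    0 ≤ timeDeriv ψ x t + H x (spaceDiff ψ x t) (u (x, t)).toReal

/-- BJ solutions on `M × [0, ∞)` of the Cauchy problem `u_t + H(x, D_x u, u) = 0`,
`u(·, 0) = φ`, where moreover `φ x = liminf_{t → 0+} u (x, t)`. -/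
structure IsBJCauchySol (H : ∀ x : M, CotSpace n x → ℝ → ℝ) (φ : M → EReal)
    (u : M × ℝ≥0 → EReal) : Prop where
  isLSC : IsLSC u
  sub : IsBJSubsol H u
  super : IsBJSupersol H u
  init : ∀ x, u (x, 0) = φ x
  init_liminf : ∀ x, liminf (fun t : ℝ≥0 => u (x, t)) (𝓝[>] 0) = φ x

end BJ

end

/-! The manifold is embedded in a Euclidean space by a smooth map `e` and given the chordal metric,
so that `e` is isometric and `H` acts on ambient covectors through their restriction to the tangent
spaces. Test functions are replaced by first order subjets of real truncations of `u`, which reduces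
the theorem to a compact metric space `X` with tangent spaces `T x ⊆ E`.

Uniqueness follows Barron and Jensen. For a convex Hamiltonian, a Lipschitz function whose superjets
satisfy `a + G ≤ 0` has the same inequality at its subjets (`subJet_le_of_supJet_le`); a Lipschitz
viscosity solution thus satisfies an equation at each subjet, and can be compared in both time
directions. Suppose a subsolution `v` exceeds a supersolution `u` at `(x₀, t₀)`. Take a Lipschitz
`f` below `v(·, t₀)` with `f x₀ > u(x₀, t₀)`, and let `w` solve the problem for `G(x, -w, -r)` with
datum `-f`. For `τ` slightly larger than `t₀`, the superjets of `-w(·, τ - t)` satisfy the original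
equation with equality. Reversing time makes `v` a supersolution for `-G`, so this function stays
below `v` back to time `0`, where the liminf condition puts it below `φ`; running forward it stays
below `u`. At `(x₀, t₀)` it is close to `f x₀`, a contradiction
(`le_of_isJetSubsol_of_isJetSupersol`). The only comparison principle needed is `comparison`,
between a lower semicontinuous supersolution and a Lipschitz subsolution.

For existence, Perron's method treats Lipschitz data (`exists_lipschitz_solution`): a one-sided
bound on the time derivative is built into the class, and coercivity converts it into a common
Lipschitz bound. For general `φ` one takes the supremum over Lipschitz data below `φ`. Comparison
makes this family directed, and a Dini argument passes subjets to the limit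
(`exists_subJet_near_of_iSup`). Coercivity also bounds `G` below for bounded values of the solution,
so solutions grow at most linearly in time (`growth_le_of_subJet`). This gives the liminf condition
at time `0` and at every later time; hence time shifts of solutions are solutions, and uniqueness
gives the semigroup law. -/

open scoped RealInnerProductSpace

/-! ### First order jets on an isometrically embedded metric space -/

namespace HamiltonJacobi

section Jets

variable {X E : Type*} [MetricSpace X] [NormedAddCommGroup E] [InnerProductSpace ℝ E]

/-- `(w, a)` belongs to the first order subjet of `u` at `z`, where increments in `X` are measured
through the map `e : X → E`. -/
def SubJet (e : X → E) (u : X × ℝ → ℝ) (z : X × ℝ) (w : E) (a : ℝ) : Prop :=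
  ∀ ε > 0, ∀ᶠ y in 𝓝 z, u z + ⟪w, e y.1 - e z.1⟫ + a * (y.2 - z.2) - ε * dist y z ≤ u y

/-- `(w, a)` belongs to the first order superjet of `u` at `z`. -/
def SupJet (e : X → E) (u : X × ℝ → ℝ) (z : X × ℝ) (w : E) (a : ℝ) : Prop :=
  SubJet e (fun y => -u y) z (-w) (-a)

variable {e : X → E} {u v : X × ℝ → ℝ} {z : X × ℝ} {w w' : E} {a a' : ℝ}

theorem supJet_neg : SupJet e (fun y => -u y) z w a ↔ SubJet e u z (-w) (-a) := by
  simp [SupJet]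

theorem supJet_iff : SupJet e u z w a ↔ ∀ ε > 0, ∀ᶠ y in 𝓝 z,
    u y ≤ u z + ⟪w, e y.1 - e z.1⟫ + a * (y.2 - z.2) + ε * dist y z := by
  refine forall₂_congr fun ε _ => eventually_congr (Eventually.of_forall fun y => ?_)
  simp only [inner_neg_left]
  constructor <;> intro h <;> linarith

theorem SubJet.congr_of_le (h : SubJet e u z w a) (hle : ∀ᶠ y in 𝓝 z, u y ≤ v y)
    (heq : u z = v z) : SubJet e v z w a := by
  intro ε hε
  filter_upwards [h ε hε, hle] with y h1 h2
  linarith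

theorem SupJet.congr_of_le (h : SupJet e u z w a) (hle : ∀ᶠ y in 𝓝 z, v y ≤ u y)
    (heq : u z = v z) : SupJet e v z w a :=
  SubJet.congr_of_le h (hle.mono fun _ hy => neg_le_neg hy) (by rw [heq])

/-- The differentiability errors of `P` and `β`, each taken with `ε / 2`, add up to the error
allowed in a subjet, because `e` is isometric and both increments are at most the product distance.
-/
theorem SubJet.of_touch (he : Isometry e) {P : E → ℝ} {β : ℝ → ℝ}
    (hP : HasFDerivAt P (innerSL ℝ w) (e z.1)) (hβ : HasDerivAt β a z.2)
    (h : ∀ᶠ y in 𝓝 z, u z + (P (e y.1) - P (e z.1)) + (β y.2 - β z.2) ≤ u y) :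
    SubJet e u z w a := by
  intro ε hε
  have h1 : ∀ᶠ y : X × ℝ in 𝓝 z,
      ‖P (e y.1) - P (e z.1) - innerSL ℝ w (e y.1 - e z.1)‖ ≤ ε / 2 * ‖e y.1 - e z.1‖ := by
    have ht : Tendsto (fun y : X × ℝ => e y.1) (𝓝 z) (𝓝 (e z.1)) :=
      (he.continuous.comp continuous_fst).tendsto z
    exact ht.eventually (hP.isLittleO.def (half_pos hε))
  have h2 : ∀ᶠ y : X × ℝ in 𝓝 z,
      ‖β y.2 - β z.2 - (y.2 - z.2) • a‖ ≤ ε / 2 * ‖y.2 - z.2‖ :=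
    (continuous_snd.tendsto z).eventually ((hasDerivAt_iff_isLittleO.1 hβ).def (half_pos hε))
  filter_upwards [h, h1, h2] with y hy h1 h2
  have e1 : ‖e y.1 - e z.1‖ ≤ dist y z := by
    rw [← dist_eq_norm, he.dist_eq, Prod.dist_eq]; exact le_max_left _ _
  have e2 : ‖y.2 - z.2‖ ≤ dist y z := by
    rw [← dist_eq_norm, Prod.dist_eq]; exact le_max_right _ _
  have h1' := abs_le.1 h1
  have h2' := abs_le.1 h2
  rw [innerSL_apply_apply] at h1'
  rw [smul_eq_mul] at h2'
  nlinarith [h1'.1, h2'.1]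

theorem SupJet.of_touch (he : Isometry e) {P : E → ℝ} {β : ℝ → ℝ}
    (hP : HasFDerivAt P (innerSL ℝ w) (e z.1)) (hβ : HasDerivAt β a z.2)
    (h : ∀ᶠ y in 𝓝 z, u y ≤ u z + (P (e y.1) - P (e z.1)) + (β y.2 - β z.2)) :
    SupJet e u z w a := by
  refine SubJet.of_touch he (P := fun x => -P x) (β := fun x => -β x) ?_ hβ.neg ?_
  · rw [map_neg]; exact hP.neg
  · filter_upwards [h] with y hy; linarith

theorem hasFDerivAt_quadratic (w c x : E) (A : ℝ) :
    HasFDerivAt (fun y : E => ⟪w, y⟫ - A * ‖y - c‖ ^ 2)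
      (innerSL ℝ (w - (2 * A) • (x - c))) x := by
  have h1 : HasFDerivAt (fun y : E => ⟪w, y⟫) (innerSL ℝ w) x := (innerSL ℝ w).hasFDerivAt
  have h2 := ((hasStrictFDerivAt_norm_sq (x - c)).hasFDerivAt.comp x
    ((hasFDerivAt_id x).sub_const c)).const_mul A
  refine (h1.sub h2).congr_fderiv ?_
  ext y
  simp [mul_assoc]
  ring

theorem hasDerivAt_quadratic (a c t A : ℝ) :
    HasDerivAt (fun s : ℝ => a * s - A * (s - c) ^ 2) (a - 2 * A * (t - c)) t := by
  have h := ((hasDerivAt_id t).const_mul a).sub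
    ((((hasDerivAt_id t).sub_const c).pow 2).const_mul A)
  refine h.congr_deriv ?_
  simp; ring

/-- The sum of the squares of the space and time increments. -/
def sqDist (y z : X × ℝ) : ℝ := dist y.1 z.1 ^ 2 + (y.2 - z.2) ^ 2

theorem sqDist_nonneg (y z : X × ℝ) : 0 ≤ sqDist y z := by unfold sqDist; positivity

theorem sqDist_comm (y z : X × ℝ) : sqDist y z = sqDist z y := by
  unfold sqDist; rw [dist_comm]; ring

@[simp] theorem sqDist_self (z : X × ℝ) : sqDist z z = 0 := by simp [sqDist]

theorem dist_sq_le_sqDist (y z : X × ℝ) : dist y z ^ 2 ≤ sqDist y z := by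
  rw [Prod.dist_eq, sqDist, Real.dist_eq]
  rcases max_choice (dist y.1 z.1) |y.2 - z.2| with h | h <;> rw [h]
  · nlinarith [sq_nonneg (y.2 - z.2)]
  · rw [sq_abs]; nlinarith [sq_nonneg (dist y.1 z.1)]

theorem continuous_sqDist : Continuous fun p : (X × ℝ) × (X × ℝ) => sqDist p.1 p.2 := by
  unfold sqDist; fun_prop

/-- Minimize `v` minus the paraboloid over the closed ball. The value at the centre is at most `c`
and the sphere lies strictly above, so the minimum is interior and is a touching point. Minimality
over the whole ball is recorded because the construction of global test functions needs it. -/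
theorem exists_subJet_of_sphere [CompactSpace X] (he : Isometry e) {ρ A c : ℝ} (hρ : 0 < ρ)
    (hv : LowerSemicontinuousOn v (Metric.closedBall z ρ))
    (hs : ∀ y, dist y z = ρ → c + ⟪w, e y.1 - e z.1⟫ + a * (y.2 - z.2) - A * ρ ^ 2 < v y)
    (hA : 0 ≤ A) (hz : v z ≤ c) :
    ∃ y, dist y z < ρ ∧
      SubJet e v y (w - (2 * A) • (e y.1 - e z.1)) (a - 2 * A * (y.2 - z.2)) ∧
      v y ≤ c + ⟪w, e y.1 - e z.1⟫ + a * (y.2 - z.2) - A * sqDist y z ∧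
      ∀ x, dist x z ≤ ρ → v y - (⟪w, e y.1⟫ + a * y.2 - A * sqDist y z) ≤
        v x - (⟪w, e x.1⟫ + a * x.2 - A * sqDist x z) := by
  have hK : IsCompact (Metric.closedBall z ρ) := by
    rw [← closedBall_prod_same]
    exact Metric.isClosed_closedBall.isCompact.prod (isCompact_closedBall _ _)
  have hc : Continuous fun y : X × ℝ => -(⟪w, e y.1⟫ + a * y.2 - A * sqDist y z) := by
    have := he.continuous
    unfold sqDist; fun_prop
  obtain ⟨y, hy, hmin⟩ := LowerSemicontinuousOn.exists_isMinOn
    ⟨z, Metric.mem_closedBall_self hρ.le⟩ hK (hv.add (hc.lowerSemicontinuous.lowerSemicontinuousOn _))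
  have hmin' : ∀ x, dist x z ≤ ρ → v y - (⟪w, e y.1⟫ + a * y.2 - A * sqDist y z) ≤
        v x - (⟪w, e x.1⟫ + a * x.2 - A * sqDist x z) := fun x hx => by
    have := hmin (Metric.mem_closedBall.2 hx)
    simp only [mem_ofPred_eq] at this
    linarith
  have hle : v y ≤ c + ⟪w, e y.1 - e z.1⟫ + a * (y.2 - z.2) - A * sqDist y z := by
    have := hmin' z (by simpa using hρ.le)
    rw [sqDist_self] at this
    rw [inner_sub_right]; linarith
  have hlt : dist y z < ρ := by
    refine lt_of_le_of_ne (Metric.mem_closedBall.1 hy) fun h => ?_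
    have h1 := hs y h
    have h2 := dist_sq_le_sqDist y z
    rw [h] at h2
    nlinarith
  refine ⟨y, hlt, ?_, hle, hmin'⟩
  refine SubJet.of_touch he (hasFDerivAt_quadratic w (e z.1) (e y.1) A)
    (hasDerivAt_quadratic a z.2 y.2 A) ?_
  filter_upwards [Metric.ball_mem_nhds y (sub_pos.2 hlt)] with x hx
  have h1 := hmin' x (by
    have := dist_triangle x y z
    have := Metric.mem_ball.1 hx
    linarith)
  simp only [sqDist, ← he.dist_eq, dist_eq_norm] at h1
  linarith

end Jets

end HamiltonJacobi

/-! ### Tangent fields, structure conditions on the Hamiltonian, perturbation of jets -/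

namespace HamiltonJacobi

variable {X E : Type*} [MetricSpace X] [NormedAddCommGroup E] [InnerProductSpace ℝ E]

/-- The isometric map `e : X → E` has the subspaces `T x` as tangent spaces: every vector of `T x`
is a tangent direction of the image of `e`, and secants are uniformly close to being tangent. -/
structure IsTangentField (e : X → E) (T : X → Submodule ℝ E) : Prop where
  isometry : Isometry e
  curve : ∀ x, ∀ h ∈ T x, ∃ c : ℝ → X,
    Tendsto (fun τ : ℝ => τ⁻¹ • (e (c τ) - e x)) (𝓝[>] 0) (𝓝 h)
  approx : ∀ κ > 0, ∃ ρ > 0, ∀ x y, dist x y < ρ → ∃ h ∈ T x, ‖e y - e x - h‖ ≤ κ * dist x y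

/-- The structure conditions on a Hamiltonian `G x w r`, where the covector `w` acts on `T x`. -/
structure IsHamiltonian (T : X → Submodule ℝ E) (G : X → E → ℝ → ℝ) (L : ℝ) : Prop where
  cont : Continuous fun z : X × E × ℝ => G z.1 z.2.1 z.2.2
  convex : ∀ x r, ConvexOn ℝ univ fun w => G x w r
  nonneg : 0 ≤ L
  lip : ∀ x w r r', |G x w r - G x w r'| ≤ L * |r - r'|
  tang : ∀ x w w' r, (∀ h ∈ T x, ⟪w, h⟫ = ⟪w', h⟫) → G x w r = G x w' r
  coer : ∀ R > 0, ∃ K > 0, ∀ x, ∀ p ∈ T x, ∀ r, |r| ≤ R → K ≤ ‖p‖ → R < G x p r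

variable {e : X → E} {T : X → Submodule ℝ E} {G : X → E → ℝ → ℝ} {L : ℝ}
  {u v : X × ℝ → ℝ} {z : X × ℝ} {w w' : E} {a a' : ℝ}

/-- The Hamiltonian obtained by reversing the signs of the solution. -/
theorem IsHamiltonian.reflect (hG : IsHamiltonian T G L) :
    IsHamiltonian T (fun x w r => G x (-w) (-r)) L where
  cont := hG.cont.comp (f := fun z : X × E × ℝ => (z.1, -z.2.1, -z.2.2)) (by fun_prop)
  convex x r := by
    have := (hG.convex x (-r)).comp_linearMap (-LinearMap.id)
    simpa [Function.comp_def] using this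
  nonneg := hG.nonneg
  lip x w r r' := by
    refine (hG.lip x (-w) (-r) (-r')).trans_eq ?_
    rw [neg_sub_neg, abs_sub_comm]
  tang x w w' r h := hG.tang x _ _ _ fun k hk => by simp [inner_neg_left, h k hk]
  coer R hR := by
    obtain ⟨K, hK, h⟩ := hG.coer R hR
    exact ⟨K, hK, fun x p hp r hr hn => h x (-p) (neg_mem hp) (-r) (by simpa) (by simpa)⟩

/-- The common end of the stability arguments. Applied to `-G` and `-a`, it also gives the reverse
inequality. -/
theorem le_zero_of_approx (hG : Continuous fun z : X × E × ℝ => G z.1 z.2.1 z.2.2) {x : X} {r : ℝ}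
    (h : ∀ δ > 0, ∃ x' w' a' r', dist x' x < δ ∧ ‖w' - w‖ < δ ∧ |a' - a| < δ ∧ |r' - r| < δ ∧
      a' + G x' w' r' ≤ δ) : a + G x w r ≤ 0 := by
  have hn : ∀ n : ℕ, (0 : ℝ) < 1 / (n + 1) := fun n => Nat.one_div_pos_of_nat
  choose x' w' a' r' h1 h2 h3 h4 h5 using fun n : ℕ => h _ (hn n)
  have h0 := tendsto_one_div_add_atTop_nhds_zero_nat (𝕜 := ℝ)
  have t1 : Tendsto x' atTop (𝓝 x) := tendsto_iff_dist_tendsto_zero.2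
    (squeeze_zero (fun _ => dist_nonneg) (fun n => (h1 n).le) h0)
  have t2 : Tendsto w' atTop (𝓝 w) := tendsto_iff_norm_sub_tendsto_zero.2
    (squeeze_zero (fun _ => norm_nonneg _) (fun n => (h2 n).le) h0)
  have t3 : Tendsto a' atTop (𝓝 a) := tendsto_iff_norm_sub_tendsto_zero.2
    (squeeze_zero (fun _ => norm_nonneg _) (fun n => (h3 n).le) h0)
  have t4 : Tendsto r' atTop (𝓝 r) := tendsto_iff_norm_sub_tendsto_zero.2
    (squeeze_zero (fun _ => norm_nonneg _) (fun n => (h4 n).le) h0)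
  have t5 := (hG.tendsto (x, w, r)).comp (t1.prodMk_nhds (t2.prodMk_nhds t4))
  exact le_of_tendsto_of_tendsto' (t3.add t5) h0 h5

/-- Divide the subjet inequality along the curve by `τ`, let `τ → 0`, then `ε → 0`: a subjet is
dominated by every upper bound on the difference quotients in a tangent direction. -/
theorem SubJet.le_of_curve (he : Isometry e) (hu : SubJet e u z w a) {c : ℝ → X} {h : E}
    (hc : Tendsto (fun τ : ℝ => τ⁻¹ • (e (c τ) - e z.1)) (𝓝[>] 0) (𝓝 h)) {σ k₀ : ℝ} {k : ℝ → ℝ}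
    (hk : Tendsto k (𝓝[>] 0) (𝓝 k₀))
    (hle : ∀ᶠ τ in 𝓝[>] 0, u (c τ, z.2 + τ * σ) ≤ u z + τ * k τ) :
    ⟪w, h⟫ + a * σ ≤ k₀ := by
  have hτ : Tendsto (fun τ : ℝ => τ) (𝓝[>] 0) (𝓝 0) := tendsto_id.mono_left nhdsWithin_le_nhds
  have hpos : ∀ᶠ τ : ℝ in 𝓝[>] 0, 0 < τ := self_mem_nhdsWithin
  have hec : Tendsto (fun τ => dist (c τ) z.1) (𝓝[>] 0) (𝓝 0) := by
    have h1 := hτ.smul hc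
    rw [zero_smul] at h1
    refine (tendsto_zero_iff_norm_tendsto_zero.1 h1).congr' ?_
    filter_upwards [hpos] with τ hτ
    rw [smul_inv_smul₀ hτ.ne', ← dist_eq_norm, he.dist_eq]
  have hz : Tendsto (fun τ => (c τ, z.2 + τ * σ)) (𝓝[>] 0) (𝓝 z) := by
    refine (tendsto_iff_dist_tendsto_zero.2 hec).prodMk_nhds ?_
    have := (hτ.mul_const σ).const_add z.2
    simpa using this
  have key : ∀ ε > 0, ⟪w, h⟫ + a * σ - ε * (‖h‖ + |σ|) ≤ k₀ := by
    intro ε hε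
    have hl : Tendsto (fun τ : ℝ => ⟪w, τ⁻¹ • (e (c τ) - e z.1)⟫ + a * σ
        - ε * (‖τ⁻¹ • (e (c τ) - e z.1)‖ + |σ|)) (𝓝[>] 0)
        (𝓝 (⟪w, h⟫ + a * σ - ε * (‖h‖ + |σ|))) :=
      ((tendsto_const_nhds.inner hc).add_const _).sub ((hc.norm.add_const _).const_mul ε)
    refine le_of_tendsto_of_tendsto hl hk ?_
    filter_upwards [hpos, hz.eventually (hu ε hε), hle] with τ hτ h1 h2
    obtain ⟨d, hd⟩ : ∃ d, d = τ⁻¹ • (e (c τ) - e z.1) := ⟨_, rfl⟩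
    have hd' : e (c τ) - e z.1 = τ • d := by rw [hd, smul_inv_smul₀ hτ.ne']
    rw [← hd]
    have h3 : dist (c τ, z.2 + τ * σ) z ≤ τ * (‖d‖ + |σ|) := by
      rw [Prod.dist_eq]
      simp only
      rw [← he.dist_eq, dist_eq_norm, hd', norm_smul, Real.dist_eq, add_sub_cancel_left, abs_mul,
        Real.norm_eq_abs, abs_of_pos hτ]
      refine max_le ?_ ?_ <;> gcongr <;> linarith [norm_nonneg d, abs_nonneg σ]
    simp only [hd', inner_smul_right] at h1
    have h4 : τ * (⟪w, d⟫ + a * σ - ε * (‖d‖ + |σ|)) ≤ τ * k τ := by nlinarith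
    exact le_of_mul_le_mul_left h4 hτ
  have hl : Tendsto (fun ε : ℝ => ⟪w, h⟫ + a * σ - ε * (‖h‖ + |σ|)) (𝓝[>] 0)
      (𝓝 (⟪w, h⟫ + a * σ - 0 * (‖h‖ + |σ|))) := (hτ.mul_const _).const_sub _
  rw [zero_mul, sub_zero] at hl
  exact le_of_tendsto hl (by filter_upwards [hpos] with ε hε using key ε hε)

theorem tendsto_curve (he : Isometry e) {x : X} {c : ℝ → X} {h : E}
    (hc : Tendsto (fun τ : ℝ => τ⁻¹ • (e (c τ) - e x)) (𝓝[>] 0) (𝓝 h)) :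
    Tendsto c (𝓝[>] 0) (𝓝 x) := by
  have hτ : Tendsto (fun τ : ℝ => τ) (𝓝[>] 0) (𝓝 0) := tendsto_id.mono_left nhdsWithin_le_nhds
  have h1 := hτ.smul hc
  rw [zero_smul] at h1
  refine tendsto_iff_dist_tendsto_zero.2 ((tendsto_zero_iff_norm_tendsto_zero.1 h1).congr' ?_)
  filter_upwards [self_mem_nhdsWithin] with τ hτ
  rw [smul_inv_smul₀ (ne_of_gt hτ), ← dist_eq_norm, he.dist_eq]

/-- The space part of a subjet of a function that is Lipschitz in space is bounded on `T x`. -/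
theorem SubJet.inner_le (hT : IsTangentField e T) (hu : SubJet e u z w a) {K : ℝ}
    (hK : ∀ᶠ y in 𝓝 z.1, u (y, z.2) ≤ u z + K * dist y z.1) {h : E} (hh : h ∈ T z.1) :
    ⟪w, h⟫ ≤ K * ‖h‖ := by
  obtain ⟨c, hc⟩ := hT.curve z.1 h hh
  have := hu.le_of_curve hT.isometry hc (σ := 0) (hc.norm.const_mul K) (by
    filter_upwards [(tendsto_curve hT.isometry hc).eventually hK, self_mem_nhdsWithin] with τ h1 h2
    have h2 : 0 < τ := h2
    rw [mul_zero, add_zero]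
    refine h1.trans_eq ?_
    rw [norm_smul, norm_inv, Real.norm_eq_abs, abs_of_pos h2, ← hT.isometry.dist_eq, dist_eq_norm]
    field_simp)
  simpa using this

theorem SubJet.time_le (hT : IsTangentField e T) (hu : SubJet e u z w a) {k₀ σ : ℝ} {k : ℝ → ℝ}
    (hk : Tendsto k (𝓝[>] 0) (𝓝 k₀))
    (hle : ∀ᶠ τ in 𝓝[>] 0, u (z.1, z.2 + τ * σ) ≤ u z + τ * k τ) : a * σ ≤ k₀ := by
  simpa using hu.le_of_curve hT.isometry (c := fun _ => z.1) (h := 0) (by simp) hk hle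

section Projection

variable [FiniteDimensional ℝ E]

/-- `p` is the orthogonal projection. The identity `‖p‖ ^ 2 = ⟪w, p⟫` turns a bound for `w` on `S`
into a bound for `‖p‖`. -/
theorem exists_mem_inner_eq (S : Submodule ℝ E) (w : E) :
    ∃ p ∈ S, (∀ h ∈ S, ⟪w, h⟫ = ⟪p, h⟫) ∧ ‖p‖ ^ 2 = ⟪w, p⟫ := by
  have key : ∀ h ∈ S, ⟪w, h⟫ = ⟪S.starProjection w, h⟫ := fun h hh => by
    have := S.starProjection_inner_eq_zero w h hh
    rw [inner_sub_left] at this; linarith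
  refine ⟨S.starProjection w, S.starProjection_apply_mem w, key, ?_⟩
  rw [key _ (S.starProjection_apply_mem w), real_inner_self_eq_norm_sq]

/-- Only the tangential part of `w` matters: where it is large coercivity makes `G` positive, and
elsewhere the arguments range over a compact set. -/
theorem IsHamiltonian.exists_neg_le [CompactSpace X] (hG : IsHamiltonian T G L) (R : ℝ) :
    ∃ C ≥ 0, ∀ x w r, |r| ≤ R → -C ≤ G x w r := by
  obtain ⟨K, hK, hc⟩ := hG.coer (max R 1) (by positivity)
  have hcomp : IsCompact ((univ : Set X) ×ˢ (Metric.closedBall (0 : E) K ×ˢ Icc (-R) R)) :=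
    isCompact_univ.prod ((isCompact_closedBall _ _).prod isCompact_Icc)
  obtain ⟨C, hC⟩ := (hcomp.image hG.cont).bddBelow
  refine ⟨max 0 (-C), le_max_left _ _, fun x w r hr => ?_⟩
  obtain ⟨p, hp, hwp, -⟩ := exists_mem_inner_eq (T x) w
  rw [hG.tang x w p r hwp]
  rcases le_total K ‖p‖ with h | h
  · have := hc x p hp r (hr.trans (le_max_left _ _)) h
    have h1 := le_max_right R 1
    have h2 := le_max_left 0 (-C)
    linarith
  · have := hC ⟨(x, p, r), ⟨mem_univ _, by simpa using h, abs_le.1 hr⟩, rfl⟩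
    have h2 := le_max_right 0 (-C)
    simp only at this
    linarith

theorem IsHamiltonian.exists_abs_le [CompactSpace X] (hG : IsHamiltonian T G L) (K R : ℝ) :
    ∃ C ≥ 0, ∀ x w r, (∀ h ∈ T x, ⟪w, h⟫ ≤ K * ‖h‖) → |r| ≤ R → |G x w r| ≤ C := by
  have hcomp : IsCompact ((univ : Set X) ×ˢ (Metric.closedBall (0 : E) (max K 0) ×ˢ Icc (-R) R)) :=
    isCompact_univ.prod ((isCompact_closedBall _ _).prod isCompact_Icc)
  obtain ⟨C, hC⟩ := hcomp.exists_bound_of_continuousOn hG.cont.continuousOn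
  refine ⟨max 0 C, le_max_left _ _, fun x w r hw hr => ?_⟩
  obtain ⟨p, hp, hwp, hpp⟩ := exists_mem_inner_eq (T x) w
  rw [hG.tang x w p r hwp]
  refine (hC (x, p, r) ⟨mem_univ _, ?_, abs_le.1 hr⟩).trans (le_max_right _ _)
  rw [mem_closedBall_zero_iff]
  have h1 := hw p hp
  rw [← hpp] at h1
  rcases (norm_nonneg p).eq_or_lt with h | h
  · rw [← h]; exact le_max_right _ _
  · refine le_max_of_le_left ?_
    nlinarith

end Projection

/-- Subjets are stable under perturbations of the function that respect the linear lower bound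
given by the subjet on a small sphere. -/
theorem SubJet.exists_near_of_sphere [CompactSpace X] (he : Isometry e) (h : SubJet e v z w a)
    {κ : ℝ} (hκ : 0 < κ) : ∃ ρ₀ > 0, ∀ ρ, 0 < ρ → ρ ≤ ρ₀ →
      (∀ y, dist y z ≤ ρ → v z + ⟪w, e y.1 - e z.1⟫ + a * (y.2 - z.2) - κ * ρ ≤ v y) ∧
      ∀ v' : X × ℝ → ℝ, LowerSemicontinuousOn v' (Metric.closedBall z ρ) →
      (∀ y, dist y z = ρ →
        v z + ⟪w, e y.1 - e z.1⟫ + a * (y.2 - z.2) - 5 / 4 * (κ * ρ) ≤ v' y) →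
      v' z ≤ v z + κ * ρ / 4 →
      ∃ y w' a', dist y z < ρ ∧ ‖w' - w‖ ≤ 4 * κ ∧ |a' - a| ≤ 4 * κ ∧ SubJet e v' y w' a' ∧
        v' y ≤ v z + κ * ρ / 4 + (‖w‖ + |a|) * ρ := by
  obtain ⟨ρ₀, hρ₀, hb⟩ := Metric.eventually_nhds_iff.1 (h κ hκ)
  refine ⟨ρ₀ / 2, half_pos hρ₀, fun ρ hρ hρ' => ⟨fun y hy => ?_, fun v' hv' hs hz => ?_⟩⟩
  · have h1 := hb (show dist y z < ρ₀ by linarith)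
    have h2 : κ * dist y z ≤ κ * ρ := by gcongr
    linarith
  have hA : (2 * κ / ρ) * ρ = 2 * κ := by field_simp
  -- With `A = 2κ/ρ` the quadratic costs `2κρ` on the sphere, more than the losses `5/4 κρ` and
  -- `κρ/4` together, while its gradient in the ball is at most `2Aρ = 4κ`.
  obtain ⟨y, hy, hj, hle, -⟩ := exists_subJet_of_sphere he (v := v') (w := w) (a := a)
    (A := 2 * κ / ρ) (c := v z + κ * ρ / 4) hρ hv' (fun y hy => by
      have h2 := hs y hy
      rw [pow_two, ← mul_assoc, hA]
      nlinarith) (by positivity) hz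
  have hd1 : ‖e y.1 - e z.1‖ ≤ dist y z := by
    rw [← dist_eq_norm, he.dist_eq, Prod.dist_eq]; exact le_max_left _ _
  have hd2 : |y.2 - z.2| ≤ dist y z := by
    rw [← Real.dist_eq, Prod.dist_eq]; exact le_max_right _ _
  have hA0 : 0 ≤ 2 * κ / ρ := by positivity
  refine ⟨y, _, _, hy, ?_, ?_, hj, hle.trans ?_⟩
  · rw [sub_sub_cancel_left, norm_neg, norm_smul, Real.norm_eq_abs,
      abs_of_nonneg (by positivity)]
    nlinarith
  · rw [sub_sub_cancel_left, abs_neg, abs_mul, abs_of_nonneg (by positivity : 0 ≤ 2 * (2 * κ / ρ))]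
    nlinarith
  · have h1 := real_inner_le_norm w (e y.1 - e z.1)
    have h2 := le_abs_self (a * (y.2 - z.2))
    rw [abs_mul] at h2
    have h3 := mul_nonneg hA0 (sqDist_nonneg y z)
    have h4 : ‖w‖ * ‖e y.1 - e z.1‖ ≤ ‖w‖ * ρ := by gcongr; linarith
    have h5 : |a| * |y.2 - z.2| ≤ |a| * ρ := by gcongr; linarith
    linarith

theorem SubJet.exists_near [CompactSpace X] (he : Isometry e) (h : SubJet e v z w a) {κ : ℝ}
    (hκ : 0 < κ) : ∃ ρ₀ > 0, ∀ ρ, 0 < ρ → ρ ≤ ρ₀ → ∀ v' : X × ℝ → ℝ,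
      LowerSemicontinuousOn v' (Metric.closedBall z ρ) →
      (∀ y, dist y z = ρ → v y - κ * ρ / 4 ≤ v' y) → v' z ≤ v z + κ * ρ / 4 →
      ∃ y w' a', dist y z < ρ ∧ ‖w' - w‖ ≤ 4 * κ ∧ |a' - a| ≤ 4 * κ ∧ SubJet e v' y w' a' ∧
        v' y ≤ v z + κ * ρ / 4 + (‖w‖ + |a|) * ρ := by
  obtain ⟨ρ₀, hρ₀, hn⟩ := h.exists_near_of_sphere he hκ
  refine ⟨ρ₀, hρ₀, fun ρ hρ hρ' v' hv' hs hz => (hn ρ hρ hρ').2 v' hv' (fun y hy => ?_) hz⟩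
  have h1 := (hn ρ hρ hρ').1 y hy.le
  have h2 := hs y hy
  linarith

end HamiltonJacobi

/-! ### Linear growth in time from bounds on subjets -/

namespace HamiltonJacobi

variable {X E : Type*} [MetricSpace X] [NormedAddCommGroup E] [InnerProductSpace ℝ E]
  {e : X → E} {T : X → Submodule ℝ E} {G : X → E → ℝ → ℝ} {L : ℝ}
  {u v : X × ℝ → ℝ} {z : X × ℝ} {w w' : E} {a a' : ℝ}

/-- Near a point, a lower semicontinuous function plus a large multiple of the squared distance
exceeds any number below its value. -/
theorem exists_lt_add_sq_dist [CompactSpace X] {f : X → ℝ} (hf : LowerSemicontinuous f) {x : X}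
    {c : ℝ} (hc : c < f x) : ∃ k > 0, ∀ y, c < f y + k * dist y x ^ 2 := by
  obtain ⟨δ, hδ, hb⟩ := Metric.eventually_nhds_iff.1 (hf x c hc)
  obtain ⟨m, -, hm⟩ := LowerSemicontinuousOn.exists_isMinOn (s := (univ : Set X)) ⟨x, mem_univ _⟩
    isCompact_univ (hf.lowerSemicontinuousOn _)
  refine ⟨(|c - f m| + 1) / δ ^ 2, by positivity, fun y => ?_⟩
  by_cases h : dist y x < δ
  · have h1 := hb h
    have : 0 ≤ (|c - f m| + 1) / δ ^ 2 * dist y x ^ 2 := by positivity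
    linarith
  · have h1 : f m ≤ f y := hm (mem_univ y)
    have h2 : (|c - f m| + 1) ≤ (|c - f m| + 1) / δ ^ 2 * dist y x ^ 2 := by
      rw [div_mul_eq_mul_div, le_div_iff₀ (by positivity)]
      have : δ ≤ dist y x := not_lt.1 h
      gcongr
    have h3 := le_abs_self (c - f m)
    linarith

/-- A bound on the time components of the subjets bounds the growth in time. -/
theorem growth_le_of_subJet [CompactSpace X] (he : Isometry e) (hv : LowerSemicontinuous v)
    {α β N C : ℝ} (hC : 0 ≤ C)
    (hJ : ∀ z w a, z.2 ∈ Ioo α β → v z < N → SubJet e v z w a → a ≤ C) {x : X} {t t' : ℝ}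
    (hα : α < t) (htt : t ≤ t') (hβ : t' < β) (hN : v (x, t) + C * (t' - t) < N) :
    v (x, t') ≤ v (x, t) + C * (t' - t) := by
  by_contra! hcon
  obtain ⟨l, hl⟩ : ∃ l, l = t' - t := ⟨_, rfl⟩
  have hl0 : 0 < l := by
    rw [hl, sub_pos]
    refine htt.lt_of_ne fun h => ?_
    subst h; simp at hcon
  obtain ⟨D, hD0, hD1, hD2⟩ : ∃ D > 0, v (x, t) + C * l + D ≤ v (x, t') ∧
      v (x, t) + C * l + D ≤ N := by
    refine ⟨min (v (x, t')) N - (v (x, t) + C * l), ?_, ?_, ?_⟩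
    · rw [hl, gt_iff_lt, sub_pos]; exact lt_min hcon hN
    · have := min_le_left (v (x, t')) N; linarith
    · have := min_le_right (v (x, t')) N; linarith
  obtain ⟨τ, hατ, hτt⟩ := exists_between hα
  -- The test function is `C' s - (D/4) q(s) ^ n - k dist(·, x)²` on times in `[τ, t']`. As `q`
  -- decreases, its time slope is at least `C' > C`, so an interior minimum contradicts `hJ`. Since
  -- `q > 1` at `τ`, a large `n` keeps the minimum off the bottom; a large `k` keeps it off the top,
  -- where `q` vanishes. The competitor is `(x, t)`, where `q = 1`.
  obtain ⟨C', hC'⟩ : ∃ C', C' = C + D / (4 * l) := ⟨_, rfl⟩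
  have hCl : C' * l = C * l + D / 4 := by rw [hC']; field_simp
  have hCC : C < C' := by rw [hC']; have : 0 < D / (4 * l) := by positivity
                          linarith
  obtain ⟨q, hq⟩ : ∃ q : ℝ → ℝ, q = fun s => (t' - s) / l := ⟨_, rfl⟩
  have hqτ : 1 < q τ := by rw [hq]; simp only; rw [one_lt_div hl0]; linarith
  have hqt : q t = 1 := by rw [hq]; simp only; rw [← hl, div_self hl0.ne']
  have hK : IsCompact ((univ : Set X) ×ˢ Icc τ t') := isCompact_univ.prod isCompact_Icc
  have hne : ((univ : Set X) ×ˢ Icc τ t').Nonempty := ⟨(x, t'), mem_univ _, by linarith, le_rfl⟩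
  obtain ⟨m, -, hm⟩ := LowerSemicontinuousOn.exists_isMinOn hne hK (hv.lowerSemicontinuousOn _)
  obtain ⟨n, hn⟩ := pow_unbounded_of_one_lt
    ((v (x, t) - C' * t + D / 4 - v m + C' * τ) / (D / 4)) hqτ
  rw [div_lt_iff₀ (by positivity)] at hn
  have hvt : LowerSemicontinuous fun y => v (y, t') := hv.comp (by fun_prop)
  obtain ⟨k, hk0, hk⟩ := exists_lt_add_sq_dist hvt (x := x) (c := v (x, t) + C' * l + D / 4)
    (by linarith)
  obtain ⟨F, hF⟩ : ∃ F : X × ℝ → ℝ, F = fun y =>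
    v y + (k * dist y.1 x ^ 2 + (-(C' * y.2) + D / 4 * q y.2 ^ n)) := ⟨_, rfl⟩
  have hFl : LowerSemicontinuous F := by
    rw [hF]
    refine hv.add (Continuous.lowerSemicontinuous ?_)
    rw [hq]; fun_prop
  obtain ⟨y, hy, hmin⟩ := LowerSemicontinuousOn.exists_isMinOn (f := F) hne hK (hFl.lowerSemicontinuousOn _)
  have hFx : F y ≤ v (x, t) - C' * t + D / 4 := by
    have := hmin (show (x, t) ∈ (univ : Set X) ×ˢ Icc τ t' from ⟨mem_univ _, by
      constructor <;> simp only <;> linarith⟩)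
    simp only [mem_ofPred_eq] at this
    refine this.trans_eq ?_
    rw [hF]; simp [hqt]; ring
  have hFy : F y = v y + (k * dist y.1 x ^ 2 + (-(C' * y.2) + D / 4 * q y.2 ^ n)) := by rw [hF]
  have hkd : 0 ≤ k * dist y.1 x ^ 2 := by positivity
  have hτy : τ < y.2 := by
    refine lt_of_le_of_ne hy.2.1 fun h => ?_
    rw [← h] at hFy
    have h1 : v m ≤ v y := hm hy
    nlinarith
  have hyt : y.2 < t' := by
    refine lt_of_le_of_ne hy.2.2 fun h => ?_
    have h1 := hk y.1
    rw [← h, Prod.mk.eta] at h1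
    have h2 : 0 ≤ D / 4 * q y.2 ^ n := by
      rw [hq]; simp only [h, sub_self, zero_div]; positivity
    rw [h] at hFy h2
    nlinarith
  have hq0 : 0 ≤ q y.2 := by rw [hq]; exact div_nonneg (by linarith) hl0.le
  have hqn : 0 ≤ D / 4 * q y.2 ^ n := by positivity
  have hvy : v y < N := by
    have : C' * (y.2 - t) ≤ C' * l := by
      gcongr
      · linarith
      · rw [hl]; linarith
    linarith
  have hqd : HasDerivAt (fun s => C' * s - D / 4 * q s ^ n)
      (C' - D / 4 * (n * q y.2 ^ (n - 1) * (-1 / l))) y.2 := by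
    have h1 : HasDerivAt q (-1 / l) y.2 := by
      rw [hq]; exact ((hasDerivAt_id y.2).const_sub t').div_const l
    have h2 := ((hasDerivAt_id y.2).const_mul C').sub ((h1.pow n).const_mul (D / 4))
    exact h2.congr_deriv (by simp)
  have hjet := SubJet.of_touch (u := v) (z := y) he
    (hasFDerivAt_quadratic (0 : E) (e x) (e y.1) k) hqd (by
    filter_upwards [(continuous_snd.tendsto y).eventually (Ioo_mem_nhds hτy hyt)] with y' hy'
    have h1 : F y ≤ F y' := hmin ⟨mem_univ _, hy'.1.le, hy'.2.le⟩
    rw [hF] at h1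
    simp only [inner_zero_left, ← dist_eq_norm, he.dist_eq]
    linarith)
  have hle := hJ y _ _ ⟨by linarith, by linarith⟩ hvy hjet
  have h3 : 0 ≤ D / 4 * (n * q y.2 ^ (n - 1) * (1 / l)) := by positivity
  have h4 : D / 4 * (n * q y.2 ^ (n - 1) * (-1 / l)) = -(D / 4 * (n * q y.2 ^ (n - 1) * (1 / l))) := by
    ring
  linarith

end HamiltonJacobi

/-! ### Comparison of a semicontinuous supersolution with a Lipschitz subsolution -/

namespace HamiltonJacobi

variable {X E : Type*} [MetricSpace X] [NormedAddCommGroup E] [InnerProductSpace ℝ E]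
  {e : X → E} {T : X → Submodule ℝ E} {G : X → E → ℝ → ℝ} {L : ℝ}
  {u v b : X × ℝ → ℝ} {z : X × ℝ} {w w' : E} {a a' : ℝ}

/-- The logarithmic growth rate exceeds `L`, which defeats the dependence of the Hamiltonian on the
solution; the blow-up at `T₀` removes the need for a terminal condition. -/
theorem hasDerivAt_exp_div_sub (L T₀ : ℝ) {t : ℝ} (ht : t < T₀) :
    HasDerivAt (fun s => Real.exp (L * s) / (T₀ - s))
      ((L + 1 / (T₀ - t)) * (Real.exp (L * t) / (T₀ - t))) t := by
  have h0 : T₀ - t ≠ 0 := (sub_pos.2 ht).ne'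
  have h1 : HasDerivAt (fun s => Real.exp (L * s)) (Real.exp (L * t) * L) t := by
    simpa using ((hasDerivAt_id t).const_mul L).exp
  have h2 : HasDerivAt (fun s => T₀ - s) (-1) t := by
    simpa using (hasDerivAt_id t).const_sub T₀
  refine (h1.div h2 h0).congr_deriv ?_
  field_simp
  ring

/-- Comparison of a lower semicontinuous supersolution with a Lipschitz subsolution. -/
theorem comparison [CompactSpace X] [FiniteDimensional ℝ E] (he : Isometry e)
    (hG : Continuous fun z : X × E × ℝ => G z.1 z.2.1 z.2.2) (hL : 0 ≤ L)
    (hlip : ∀ x w r r', |G x w r - G x w r'| ≤ L * |r - r'|) {T₀ N : ℝ} {K : ℝ≥0}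
    (hu : LowerSemicontinuous u) (hb : LipschitzOnWith K b (univ ×ˢ Icc 0 T₀))
    (hbN : ∀ z, z.2 ∈ Icc 0 T₀ → b z ≤ N)
    (hu' : ∀ z w a, z.2 ∈ Ioo 0 T₀ → u z < N → SubJet e u z w a → 0 ≤ a + G z.1 w (u z))
    (hb' : ∀ z w a, z.2 ∈ Ioo 0 T₀ → SupJet e b z w a → a + G z.1 w (b z) ≤ 0)
    (h0 : ∀ x, b (x, 0) ≤ u (x, 0)) (x : X) {t : ℝ} (ht : t ∈ Ico 0 T₀) :
    b (x, t) ≤ u (x, t) := by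
  by_contra! hcon
  obtain ⟨ht0, htT⟩ := ht
  -- the weight
  obtain ⟨θ, hθ⟩ : ∃ θ : ℝ → ℝ, ∀ s, θ s = Real.exp (L * s) / (T₀ - s) := ⟨_, fun _ => rfl⟩
  obtain ⟨ϑ, hϑ⟩ : ∃ ϑ : ℝ → ℝ, ∀ s, ϑ s = (T₀ - s) * Real.exp (-(L * s)) := ⟨_, fun _ => rfl⟩
  have hθd : ∀ s < T₀, HasDerivAt θ ((L + 1 / (T₀ - s)) * θ s) s := fun s hs => by
    rw [funext hθ]; exact hasDerivAt_exp_div_sub L T₀ hs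
  have hθpos : ∀ s < T₀, 0 < θ s := fun s hs => by
    rw [hθ]; have := sub_pos.2 hs; positivity
  have hθϑ : ∀ s < T₀, θ s * ϑ s = 1 := fun s hs => by
    have := sub_pos.2 hs
    rw [hθ, hϑ, Real.exp_neg]; field_simp
  have hϑpos : ∀ s < T₀, 0 < ϑ s := fun s hs => by
    rw [hϑ]; have := sub_pos.2 hs; positivity
  have hϑc : Continuous ϑ := by rw [funext hϑ]; fun_prop
  -- bounds
  have hK0 : IsCompact ((univ : Set X) ×ˢ Icc 0 T₀) := isCompact_univ.prod isCompact_Icc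
  have hne0 : ((univ : Set X) ×ˢ Icc 0 T₀).Nonempty := ⟨(x, t), mem_univ _, ht0, htT.le⟩
  obtain ⟨m, -, hm⟩ := LowerSemicontinuousOn.exists_isMinOn hne0 hK0 (hu.lowerSemicontinuousOn _)
  obtain ⟨B, hB⟩ : ∃ B, B = N - u m := ⟨_, rfl⟩
  have hbu : ∀ z, z.2 ∈ Icc 0 T₀ → b z - u z ≤ B := fun z hz => by
    have h1 : u m ≤ u z := hm ⟨mem_univ _, hz⟩
    have := hbN z hz
    linarith
  have hB0 : 0 < B := (sub_pos.2 hcon).trans_le (hbu _ ⟨ht0, htT.le⟩)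
  -- As `ϑ` vanishes at `T₀`, the crude bound `B` for `b - u` weighs less at `T'` than the actual
  -- difference at `(x, t)`. Hence the optimal constant cannot be reached at the final time `T'`.
  obtain ⟨T', ⟨htT', hT'⟩, hBT⟩ : ∃ T' ∈ Ioo t T₀, B * ϑ T' < (b (x, t) - u (x, t)) * ϑ t := by
    have h1 : Tendsto (fun s => B * ϑ s) (𝓝[<] T₀) (𝓝 (B * ϑ T₀)) :=
      ((hϑc.const_mul B).tendsto T₀).mono_left nhdsWithin_le_nhds
    have h2 : B * ϑ T₀ < (b (x, t) - u (x, t)) * ϑ t := by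
      rw [hϑ T₀, sub_self, zero_mul, mul_zero]
      exact mul_pos (sub_pos.2 hcon) (hϑpos t htT)
    obtain ⟨s, hs1, hs2⟩ := ((h1.eventually (gt_mem_nhds h2)).and (Ioo_mem_nhdsLT htT)).exists
    exact ⟨s, hs2, hs1⟩
  obtain ⟨S, hS⟩ : ∃ S : Set (X × ℝ), S = univ ×ˢ Icc 0 T' := ⟨_, rfl⟩
  have hSc : IsCompact S := by rw [hS]; exact isCompact_univ.prod isCompact_Icc
  have hSsub : S ⊆ univ ×ˢ Icc 0 T₀ := by
    rw [hS]; exact prod_mono le_rfl (Icc_subset_Icc_right hT'.le)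
  have hxS : (x, t) ∈ S := by rw [hS]; exact ⟨mem_univ _, ht0, htT'.le⟩
  have hST : ∀ z ∈ S, z.2 < T₀ := fun z hz => by
    rw [hS] at hz; exact hz.2.2.trans_lt hT'
  -- the optimal constant
  obtain ⟨F, hF⟩ : ∃ F : X × ℝ → ℝ, ∀ z, F z = (b z - u z) * ϑ z.2 := ⟨_, fun _ => rfl⟩
  have hFb : BddAbove (F '' S) := by
    refine ⟨B * T₀, ?_⟩
    rintro _ ⟨z, hz, rfl⟩
    have h1 := hbu z (hSsub hz).2
    have h2 := hϑpos z.2 (hST z hz)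
    have h3 : ϑ z.2 ≤ T₀ := by
      rw [hϑ]
      have h4 : Real.exp (-(L * z.2)) ≤ 1 := Real.exp_le_one_iff.2 (by
        have := mul_nonneg hL (hSsub hz).2.1; linarith)
      have h5 := (hSsub hz).2.1
      have h6 := (hSsub hz).2.2
      nlinarith
    rw [hF]
    calc (b z - u z) * ϑ z.2 ≤ B * ϑ z.2 := by gcongr
      _ ≤ B * T₀ := by gcongr
  obtain ⟨c, hc⟩ : ∃ c, c = sSup (F '' S) := ⟨_, rfl⟩
  have hFc : ∀ z ∈ S, F z ≤ c := fun z hz => by rw [hc]; exact le_csSup hFb ⟨z, hz, rfl⟩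
  have hcBT : B * ϑ T' < c := hBT.trans_le (by simpa [hF] using hFc _ hxS)
  have hc0 : 0 < c := (mul_pos hB0 (hϑpos T' hT')).trans hcBT
  have hcθ : ∀ z ∈ S, b z - u z ≤ c * θ z.2 := fun z hz => by
    have h1 := mul_le_mul_of_nonneg_right (hFc z hz) (hθpos _ (hST z hz)).le
    rw [hF, mul_assoc, mul_comm (ϑ _), hθϑ _ (hST z hz), mul_one] at h1
    exact h1
  -- doubling
  have hθS : ContinuousOn (fun z : X × ℝ => θ z.2) S := fun z hz =>
    ((hθd z.2 (hST z hz)).continuousAt.comp continuous_snd.continuousAt).continuousWithinAt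
  have hbS : ContinuousOn b S := hb.continuousOn.mono hSsub
  have hmin : ∀ n : ℕ, ∃ p ∈ S ×ˢ S, ∀ q ∈ S ×ˢ S,
      u p.1 + (c * θ p.1.2 - b p.2 + (n + 1) * sqDist p.1 p.2) ≤
        u q.1 + (c * θ q.1.2 - b q.2 + (n + 1) * sqDist q.1 q.2) := fun n => by
    have hl : LowerSemicontinuousOn (fun p : (X × ℝ) × (X × ℝ) =>
        u p.1 + (c * θ p.1.2 - b p.2 + (n + 1) * sqDist p.1 p.2)) (S ×ˢ S) := by
      refine ((hu.comp continuous_fst).lowerSemicontinuousOn _).add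
        (ContinuousOn.lowerSemicontinuousOn ?_)
      refine ContinuousOn.add (ContinuousOn.sub ?_ ?_) ?_
      · exact (hθS.comp continuousOn_fst fun p hp => hp.1).const_mul c
      · exact hbS.comp continuousOn_snd fun p hp => hp.2
      · exact (continuous_sqDist.const_mul _).continuousOn
    obtain ⟨p, hp, h⟩ := LowerSemicontinuousOn.exists_isMinOn (Set.Nonempty.prod ⟨_, hxS⟩ ⟨_, hxS⟩)
      (hSc.prod hSc) hl
    exact ⟨p, hp, fun q hq => h hq⟩
  choose p hp hpm using hmin
  -- A positive minimum `δ` would already bound `u + cθ - b` below on the diagonal, and `c` could be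
  -- lowered by `δ / M`, where `M` bounds `θ`.
  have hp0 : ∀ n : ℕ, u (p n).1 + (c * θ (p n).1.2 - b (p n).2 +
      (n + 1) * sqDist (p n).1 (p n).2) ≤ 0 := fun n => by
    by_contra! hpos
    obtain ⟨δ, hδ⟩ : ∃ δ, δ = u (p n).1 + (c * θ (p n).1.2 - b (p n).2 +
      (n + 1) * sqDist (p n).1 (p n).2) := ⟨_, rfl⟩
    rw [← hδ] at hpos
    obtain ⟨M, hM⟩ := hSc.bddAbove_image hθS
    have hM0 : 0 < M := (hθpos t htT).trans_le (hM ⟨_, hxS, rfl⟩)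
    have : c ≤ c - δ / M := by
      conv_lhs => rw [hc]
      refine csSup_le ⟨_, _, hxS, rfl⟩ ?_
      rintro _ ⟨z, hz, rfl⟩
      have h1 := hpm n (z, z) ⟨hz, hz⟩
      rw [← hδ] at h1
      simp only [sqDist_self, mul_zero, add_zero] at h1
      have h2 : θ z.2 ≤ M := hM ⟨z, hz, rfl⟩
      have h3 := hθpos z.2 (hST z hz)
      have h4 : ϑ z.2 = 1 / θ z.2 := by
        rw [eq_div_iff h3.ne', mul_comm, hθϑ _ (hST z hz)]
      rw [hF, h4]
      have h5 : δ / M ≤ δ / θ z.2 := by gcongr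
      have h6 : (b z - u z) * (1 / θ z.2) ≤ (c * θ z.2 - δ) * (1 / θ z.2) := by
        exact mul_le_mul_of_nonneg_right (by linarith) (by positivity)
      have h7 : (c * θ z.2 - δ) * (1 / θ z.2) = c - δ / θ z.2 := by field_simp
      linarith
    have := div_pos hpos hM0
    linarith
  -- Comparison with a diagonal pair bounds the penalty by `K` times the distance. The Lipschitz
  -- bound on `b` alone thus keeps the doubling covectors `W n` in a compact set; no coercivity is
  -- used.
  have hpd : ∀ n : ℕ, (n + 1) * dist (p n).1 (p n).2 ≤ K := fun n => by
    have h1 := hpm n ((p n).1, (p n).1) ⟨(hp n).1, (hp n).1⟩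
    simp only [sqDist_self, mul_zero, add_zero] at h1
    have h2 := hb.dist_le_mul _ (hSsub (hp n).2) _ (hSsub (hp n).1)
    rw [Real.dist_eq, dist_comm] at h2
    have h3 := le_abs_self (b (p n).2 - b (p n).1)
    have h4 := dist_sq_le_sqDist (p n).1 (p n).2
    rcases (dist_nonneg (x := (p n).1) (y := (p n).2)).eq_or_lt with h | h
    · rw [← h]; simp
    · have h5 : (n + 1) * dist (p n).1 (p n).2 ^ 2 ≤ (n + 1) * sqDist (p n).1 (p n).2 := by gcongr
      nlinarith
  have hdist : Tendsto (fun n => dist (p n).1 (p n).2) atTop (𝓝 0) := by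
    have h1 : Tendsto (fun n : ℕ => (K : ℝ) * (1 / ((n : ℝ) + 1))) atTop (𝓝 (K * 0)) :=
      tendsto_one_div_add_atTop_nhds_zero_nat.const_mul _
    rw [mul_zero] at h1
    refine squeeze_zero (fun _ => dist_nonneg) (fun n => ?_) h1
    rw [mul_one_div, le_div_iff₀ (by positivity), mul_comm]
    exact hpd n
  obtain ⟨W, hW⟩ : ∃ W : ℕ → E, ∀ n : ℕ,
    W n = 0 - (2 * ((n : ℝ) + 1)) • (e (p n).1.1 - e (p n).2.1) := ⟨_, fun _ => rfl⟩
  have hWb : ∀ n, W n ∈ Metric.closedBall (0 : E) (2 * K) := fun n => by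
    rw [mem_closedBall_zero_iff, hW, zero_sub, norm_neg, norm_smul, ← dist_eq_norm, he.dist_eq,
      Real.norm_eq_abs, abs_of_nonneg (by positivity)]
    have h1 := hpd n
    have h2 : dist (p n).1.1 (p n).2.1 ≤ dist (p n).1 (p n).2 := by
      rw [Prod.dist_eq]; exact le_max_left _ _
    have h3 : ((n : ℝ) + 1) * dist (p n).1.1 (p n).2.1 ≤ (n + 1) * dist (p n).1 (p n).2 := by gcongr
    linarith
  obtain ⟨⟨zl, wl⟩, ⟨hzl, -⟩, φ, hφ, hlim⟩ := (hSc.prod (isCompact_closedBall (0 : E) (2 * K))).tendsto_subseq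
    (x := fun n => ((p n).1, W n)) fun n => ⟨(hp n).1, hWb n⟩
  have hz1 : Tendsto (fun n => (p (φ n)).1) atTop (𝓝 zl) := (continuous_fst.tendsto _).comp hlim
  have hw1 : Tendsto (fun n => W (φ n)) atTop (𝓝 wl) := (continuous_snd.tendsto _).comp hlim
  have hz2 : Tendsto (fun n => (p (φ n)).2) atTop (𝓝 zl) :=
    tendsto_of_tendsto_of_dist hz1 (hdist.comp hφ.tendsto_atTop)
  have hzT := hST zl hzl
  have hb2 : Tendsto (fun n => b (p (φ n)).2) atTop (𝓝 (b zl)) :=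
    (hbS zl hzl).tendsto.comp (tendsto_nhdsWithin_iff.2
      ⟨hz2, Eventually.of_forall fun n => (hp _).2⟩)
  have ht1 : Tendsto (fun n => (p (φ n)).1.2) atTop (𝓝 zl.2) := (continuous_snd.tendsto _).comp hz1
  have ht2 : Tendsto (fun n => (p (φ n)).2.2) atTop (𝓝 zl.2) := (continuous_snd.tendsto _).comp hz2
  have hθ1 : Tendsto (fun n => θ (p (φ n)).1.2) atTop (𝓝 (θ zl.2)) :=
    (hθd _ hzT).continuousAt.tendsto.comp ht1
  have hun : ∀ n, u (p n).1 ≤ b (p n).2 - c * θ (p n).1.2 := fun n => by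
    have h1 := hp0 n
    have h2 : 0 ≤ ((n : ℝ) + 1) * sqDist (p n).1 (p n).2 :=
      mul_nonneg (by positivity) (sqDist_nonneg _ _)
    linarith
  have hul : b zl - c * θ zl.2 ≤ u zl := by have := hcθ zl hzl; linarith
  -- `u` is only lower semicontinuous, but `hp0` supplies the matching upper bound, so its values
  -- converge along the sequence.
  have hu1 : Tendsto (fun n => u (p (φ n)).1) atTop (𝓝 (u zl)) := by
    refine tendsto_order.2 ⟨fun r hr => hz1.eventually (hu zl r hr), fun r hr => ?_⟩
    filter_upwards [(hb2.sub (hθ1.const_mul c)).eventually (gt_mem_nhds (hul.trans_lt hr))] with n hn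
    exact (hun _).trans_lt hn
  have huz : u zl = b zl - c * θ zl.2 := le_antisymm
    (le_of_tendsto_of_tendsto' hu1 (hb2.sub (hθ1.const_mul c)) fun n => hun _) hul
  have hθzl := hθpos _ hzT
  have hzl0 : 0 < zl.2 := by
    refine lt_of_le_of_ne (hSsub hzl).2.1 fun h => ?_
    have h1 := h0 zl.1
    have h2 : (zl.1, (0 : ℝ)) = zl := by rw [h]
    rw [h2] at h1
    have := mul_pos hc0 hθzl
    linarith
  have hzlT : zl.2 < T' := by
    have h1 : zl.2 ≤ T' := by rw [hS] at hzl; exact hzl.2.2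
    refine lt_of_le_of_ne h1 fun h => ?_
    have h1 := hbu zl (hSsub hzl).2
    have h2 : c * ϑ T' * θ T' = c := by rw [mul_assoc, mul_comm (ϑ _), hθϑ _ hT', mul_one]
    have h3 : B * ϑ T' * θ T' = B := by rw [mul_assoc, mul_comm (ϑ _), hθϑ _ hT', mul_one]
    rw [h] at huz hθzl
    have h4 := mul_lt_mul_of_pos_right hcBT hθzl
    rw [h3] at h4
    linarith
  have hineq : ∀ᶠ n in atTop, c * ((L + 1 / (T₀ - (p (φ n)).1.2)) * θ (p (φ n)).1.2) ≤
      G (p (φ n)).1.1 (W (φ n)) (u (p (φ n)).1) - G (p (φ n)).2.1 (W (φ n)) (b (p (φ n)).2) := by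
    filter_upwards [ht1.eventually (Ioo_mem_nhds hzl0 hzlT),
      ht2.eventually (Ioo_mem_nhds hzl0 hzlT)] with n h1 h2
    generalize φ n = k at h1 h2 ⊢
    have hd := hθd (p k).1.2 (h1.2.trans hT')
    have hsd : ∀ x y : X × ℝ, sqDist x y = ‖e x.1 - e y.1‖ ^ 2 + (x.2 - y.2) ^ 2 := fun x y => by
      rw [sqDist, ← he.dist_eq, dist_eq_norm]
    have j1 := SubJet.of_touch (u := u) (z := (p k).1) he
      (hasFDerivAt_quadratic (0 : E) (e (p k).2.1) (e (p k).1.1) (k + 1))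
      ((hasDerivAt_quadratic 0 (p k).2.2 (p k).1.2 (k + 1)).sub (hd.const_mul c)) (by
      filter_upwards [(continuous_snd.tendsto (p k).1).eventually (Ioo_mem_nhds h1.1 h1.2)] with y hy
      have h3 := hpm k (y, (p k).2) ⟨by rw [hS]; exact ⟨mem_univ _, hy.1.le, hy.2.le⟩, (hp k).2⟩
      simp only [hsd] at h3
      simp only [inner_zero_left, Pi.sub_apply]
      linarith)
    have j2 := SupJet.of_touch (u := b) (z := (p k).2) (w := W k) he
      (P := fun y => -(⟪(0 : E), y⟫ - ((k : ℝ) + 1) * ‖y - e (p k).1.1‖ ^ 2)) (by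
      refine (hasFDerivAt_quadratic (0 : E) (e (p k).1.1) (e (p k).2.1) (k + 1)).neg.congr_fderiv ?_
      rw [← map_neg, hW]
      congr 1
      rw [zero_sub, zero_sub, neg_neg, ← smul_neg, neg_sub])
      (hasDerivAt_quadratic 0 (p k).1.2 (p k).2.2 (k + 1)).neg (by
      filter_upwards [(continuous_snd.tendsto (p k).2).eventually (Ioo_mem_nhds h2.1 h2.2)] with y hy
      have h3 := hpm k ((p k).1, y) ⟨(hp k).1, by rw [hS]; exact ⟨mem_univ _, hy.1.le, hy.2.le⟩⟩
      simp only [sqDist_comm (p k).1, hsd] at h3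
      simp only [inner_zero_left, Pi.neg_apply]
      linarith)
    have h4 : u (p k).1 < N := by
      have h5 := hun k
      have h6 := hbN _ (hSsub (hp k).2).2
      have h7 := mul_pos hc0 (hθpos _ (h1.2.trans hT'))
      linarith
    have i1 := hu' _ _ _ ⟨h1.1, h1.2.trans hT'⟩ h4 j1
    have i2 := hb' _ _ _ ⟨h2.1, h2.2.trans hT'⟩ j2
    rw [← hW] at i1
    linarith
  have hGl : Tendsto (fun n => G (p (φ n)).1.1 (W (φ n)) (u (p (φ n)).1) -
      G (p (φ n)).2.1 (W (φ n)) (b (p (φ n)).2)) atTop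
      (𝓝 (G zl.1 wl (u zl) - G zl.1 wl (b zl))) := by
    refine Tendsto.sub ?_ ?_
    · exact (hG.tendsto (zl.1, wl, u zl)).comp
        (((continuous_fst.tendsto _).comp hz1).prodMk_nhds (hw1.prodMk_nhds hu1))
    · exact (hG.tendsto (zl.1, wl, b zl)).comp
        (((continuous_fst.tendsto _).comp hz2).prodMk_nhds (hw1.prodMk_nhds hb2))
  have hθl : Tendsto (fun n => c * ((L + 1 / (T₀ - (p (φ n)).1.2)) * θ (p (φ n)).1.2)) atTop
      (𝓝 (c * ((L + 1 / (T₀ - zl.2)) * θ zl.2))) := by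
    refine Tendsto.const_mul c (Tendsto.mul (Tendsto.const_add L ?_) hθ1)
    exact tendsto_const_nhds.div (ht1.const_sub _) (sub_pos.2 hzT).ne'
  -- In the limit both Hamiltonians have the same point and covector, and their values differ by at
  -- most `L c θ`, which is less than the left side.
  have hfin := le_of_tendsto_of_tendsto hθl hGl hineq
  have h1 := (le_abs_self _).trans (hlip zl.1 wl (u zl) (b zl))
  have h2 : |u zl - b zl| = c * θ zl.2 := by
    rw [abs_sub_comm, huz, sub_sub_cancel, abs_of_pos (mul_pos hc0 hθzl)]
  rw [h2] at h1
  have h3 : 0 < c * (1 / (T₀ - zl.2) * θ zl.2) := by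
    have := sub_pos.2 hzT
    positivity
  nlinarith

end HamiltonJacobi

/-! ### Convexity: from superjets to subjets -/

namespace HamiltonJacobi

variable {X E : Type*} [MetricSpace X] [NormedAddCommGroup E] [InnerProductSpace ℝ E]
  {e : X → E} {T : X → Submodule ℝ E} {G : X → E → ℝ → ℝ} {L : ℝ}
  {u v b : X × ℝ → ℝ} {z : X × ℝ} {w w' : E} {a a' : ℝ}

/-- A linear functional on `E × ℝ` separating a covector from a sublevel set of a Hamiltonian acts
on covectors as a tangent vector. -/
theorem IsHamiltonian.exists_separation [FiniteDimensional ℝ E] (hG : IsHamiltonian T G L) {x : X}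
    {r δ : ℝ} (h : δ < a + G x w r) : ∃ h ∈ T x, ∃ σ k : ℝ, k < ⟪w, h⟫ + a * σ ∧
      ∀ w' a', a' + G x w' r ≤ δ → ⟪w', h⟫ + a' * σ < k := by
  have hGc : Continuous fun w => G x w r :=
    hG.cont.comp (f := fun w => (x, w, r)) (by fun_prop)
  have hconv : Convex ℝ {p : E × ℝ | p.2 + G x p.1 r ≤ δ} := by
    have h1 : ConvexOn ℝ univ fun p : E × ℝ => p.2 + G x p.1 r :=
      ((LinearMap.snd ℝ E ℝ).convexOn convex_univ).add
        ((hG.convex x r).comp_linearMap (LinearMap.fst ℝ E ℝ))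
    simpa using h1.convex_le δ
  have hclosed : IsClosed {p : E × ℝ | p.2 + G x p.1 r ≤ δ} :=
    isClosed_le (continuous_snd.add (hGc.comp continuous_fst)) continuous_const
  obtain ⟨f, k, hf, hk⟩ := geometric_hahn_banach_closed_point (x := (w, a)) hconv hclosed
    (not_le.2 h)
  obtain ⟨d, hd⟩ : ∃ d : E, ∀ y, ⟪y, d⟫ = f (y, 0) := by
    refine ⟨(InnerProductSpace.toDual ℝ E).symm (f.comp (ContinuousLinearMap.inl ℝ E ℝ)),
      fun y => ?_⟩
    rw [real_inner_comm, InnerProductSpace.toDual_symm_apply]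
    rfl
  have hfd : ∀ y s, f (y, s) = ⟪y, d⟫ + s * f (0, 1) := fun y s => by
    have : ((y, s) : E × ℝ) = (y, 0) + s • (0, 1) := by ext <;> simp
    rw [this, map_add, map_smul, hd, smul_eq_mul]
  refine ⟨d, ?_, f (0, 1), k, by rwa [← hfd], fun w' a' h' => by rw [← hfd]; exact hf _ h'⟩
  obtain ⟨p, hp, hdp, -⟩ := exists_mem_inner_eq (T x) d
  obtain ⟨n, hn⟩ : ∃ n, n = d - p := ⟨_, rfl⟩
  have hnT : ∀ q ∈ T x, ⟪n, q⟫ = 0 := fun q hq => by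
    rw [hn, inner_sub_left, hdp q hq, sub_self]
  have hnd : ⟪n, d⟫ = ‖n‖ ^ 2 := by
    have : d = n + p := by rw [hn]; abel
    conv_lhs => rw [this]
    rw [inner_add_right, hnT p hp, add_zero, real_inner_self_eq_norm_sq]
  -- The sublevel set is invariant under normal translations, so the functional cannot have a normal
  -- component: `s` is chosen to make it reach the bound `k` at a point of that set.
  have hn0 : n = 0 := by
    by_contra hne
    have hpos : 0 < ‖n‖ ^ 2 := by positivity
    obtain ⟨s, hs⟩ : ∃ s, s = (k - (δ - G x 0 r) * f (0, 1)) / ‖n‖ ^ 2 := ⟨_, rfl⟩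
    have h1 := hf (s • n, δ - G x 0 r) (by
      rw [mem_ofPred_eq, hG.tang x (s • n) 0 r fun q hq => by
        rw [inner_smul_left, hnT q hq, mul_zero, inner_zero_left]]
      linarith)
    rw [hfd, inner_smul_left, hnd, hs] at h1
    simp only [conj_trivial, div_mul_cancel₀ _ hpos.ne'] at h1
    linarith
  rw [hn0] at hn
  rwa [sub_eq_zero.1 hn.symm]

theorem norm_fst_sub_le (he : Isometry e) (y z : X × ℝ) : ‖e y.1 - e z.1‖ ≤ dist y z := by
  rw [← dist_eq_norm, he.dist_eq, Prod.dist_eq]; exact le_max_left _ _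

theorem abs_snd_sub_le (y z : X × ℝ) : |y.2 - z.2| ≤ dist y z := by
  rw [← Real.dist_eq, Prod.dist_eq]; exact le_max_right _ _

/-- For convex Hamiltonians, a Lipschitz function which is a subsolution in the sense of superjets
is a subsolution in the sense of subjets. -/
theorem subJet_le_of_supJet_le [CompactSpace X] [FiniteDimensional ℝ E] (hT : IsTangentField e T)
    (hG : IsHamiltonian T G L) {η : ℝ} {K : ℝ≥0} (hη : 0 < η)
    (hv : LipschitzOnWith K v (univ ×ˢ Icc (z.2 - η) (z.2 + η)))
    (hJ : ∀ y w a, y.2 ∈ Ioo (z.2 - η) (z.2 + η) → SupJet e v y w a → a + G y.1 w (v y) ≤ 0)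
    (h : SubJet e v z w a) : a + G z.1 w (v z) ≤ 0 := by
  have he := hT.isometry
  refine le_zero_of_approx hG.cont fun δ hδ => ?_
  obtain ⟨S, hS⟩ : ∃ S : Set (X × ℝ), S = univ ×ˢ Icc (z.2 - η) (z.2 + η) := ⟨_, rfl⟩
  rw [← hS] at hv
  have hSc : IsCompact S := by rw [hS]; exact isCompact_univ.prod isCompact_Icc
  have hmemS : ∀ y, dist y z ≤ η → y ∈ S := fun y hy => by
    rw [hS]
    have := abs_le.1 ((abs_snd_sub_le y z).trans hy)
    exact ⟨mem_univ _, by linarith, by linarith⟩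
  have hzS : z ∈ S := hmemS z (by simpa using hη.le)
  have hvd : ∀ x ∈ S, ∀ y ∈ S, |v x - v y| ≤ K * dist x y := fun x hx y hy => by
    rw [← Real.dist_eq]; exact hv.dist_le_mul x hx y hy
  obtain ⟨R, hR⟩ := hSc.exists_bound_of_continuousOn hv.continuousOn
  have hcomp : IsCompact ((univ : Set X) ×ˢ (Metric.closedBall (0 : E) (2 * K) ×ˢ Icc (-R) R)) :=
    isCompact_univ.prod ((isCompact_closedBall _ _).prod isCompact_Icc)
  obtain ⟨μ, hμ, hGμ⟩ := Metric.uniformContinuousOn_iff.1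
    (hcomp.uniformContinuousOn_of_continuous hG.cont.continuousOn) δ hδ
  have hK1 : (0 : ℝ) < K + 1 := by positivity
  obtain ⟨κ, hκ⟩ : ∃ κ, κ = δ / 5 := ⟨_, rfl⟩
  have hκ0 : 0 < κ := by rw [hκ]; positivity
  obtain ⟨ρ₀, hρ₀, hnear⟩ := h.exists_near he hκ0
  obtain ⟨ρ, hρ, hρlt⟩ : ∃ ρ > 0, ρ < min (min ρ₀ (η / 4)) (δ / (K + 1)) :=
    exists_between (by positivity)
  have hρρ₀ : ρ ≤ ρ₀ := (hρlt.trans_le ((min_le_left _ _).trans (min_le_left _ _))).le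
  have hρη : ρ < η / 4 := hρlt.trans_le ((min_le_left _ _).trans (min_le_right _ _))
  have hρδ : (K + 1) * ρ < δ := by
    have := hρlt.trans_le (min_le_right _ _)
    rwa [lt_div_iff₀ hK1, mul_comm] at this
  -- the sup-convolution
  obtain ⟨N, hN⟩ : ∃ N : ℝ, N = K / (η / 4) + (K + 1) * K / (μ / 2) + K ^ 2 / (κ * ρ / 4) + 1 :=
    ⟨_, rfl⟩
  have hK0 : (0 : ℝ) ≤ K := K.2
  have hN0 : 0 < N := by rw [hN]; positivity
  -- One bound for each summand of `N`: maximizers stay inside the time window, `G` oscillates by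
  -- less than `δ` between a point and its maximizer, and the sup-convolution at `z` exceeds `v z`
  -- by at most `κρ/4`.
  have hN1 : K / N ≤ η / 4 := by
    rw [div_le_iff₀ hN0, mul_comm, ← div_le_iff₀ (by positivity), hN]
    have : 0 ≤ (K + 1) * K / (μ / 2) := by positivity
    have : 0 ≤ K ^ 2 / (κ * ρ / 4) := by positivity
    linarith
  have hN2 : (K + 1) * (K / N) ≤ μ / 2 := by
    rw [← mul_div_assoc, div_le_iff₀ hN0, mul_comm (μ / 2), ← div_le_iff₀ (by positivity), hN]
    have : 0 ≤ K / (η / 4) := by positivity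
    have : 0 ≤ K ^ 2 / (κ * ρ / 4) := by positivity
    linarith
  have hN3 : K ^ 2 / N ≤ κ * ρ / 4 := by
    rw [div_le_iff₀ hN0, mul_comm (κ * ρ / 4), ← div_le_iff₀ (by positivity), hN]
    have : 0 ≤ K / (η / 4) := by positivity
    have : 0 ≤ (K + 1) * K / (μ / 2) := by positivity
    linarith
  have hmax : ∀ y : X × ℝ, ∃ x ∈ S, ∀ x' ∈ S, v x' - N * sqDist y x' ≤ v x - N * sqDist y x :=
      fun y => by
    have h1 : ContinuousOn (fun x => v x - N * sqDist y x) S :=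
      hv.continuousOn.sub ((continuous_sqDist.comp
        (continuous_const.prodMk continuous_id)).const_mul N).continuousOn
    obtain ⟨x, hx, hm⟩ := hSc.exists_isMaxOn ⟨z, hzS⟩ h1
    exact ⟨x, hx, fun x' hx' => hm hx'⟩
  choose Y hYS hY using hmax
  have hYd : ∀ y ∈ S, dist y (Y y) ≤ K / N := fun y hy => by
    have h1 := hY y y hy
    rw [sqDist_self, mul_zero, sub_zero] at h1
    have h2 := (le_abs_self _).trans (hvd _ (hYS y) _ hy)
    have h3 := dist_sq_le_sqDist y (Y y)
    rw [dist_comm] at h2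
    rw [le_div_iff₀ hN0]
    rcases (dist_nonneg (x := y) (y := Y y)).eq_or_lt with h | h
    · rw [← h, zero_mul]; exact hK0
    · have h4 : N * dist y (Y y) ^ 2 ≤ N * sqDist y (Y y) := by gcongr
      nlinarith
  obtain ⟨V, hV⟩ : ∃ V : X × ℝ → ℝ, ∀ y, V y = v (Y y) - N * sqDist y (Y y) := ⟨_, fun _ => rfl⟩
  have hVge : ∀ y, ∀ x ∈ S, v x - N * sqDist y x ≤ V y := fun y x hx => by
    rw [hV]; exact hY y x hx
  have hVl : LowerSemicontinuous V := fun y c hc => by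
    have hc : c < V y := hc
    rw [hV] at hc
    have h1 : Continuous fun y' => v (Y y) - N * sqDist y' (Y y) :=
      continuous_const.sub ((continuous_sqDist.comp
        (continuous_id.prodMk continuous_const)).const_mul N)
    filter_upwards [(h1.tendsto y).eventually (lt_mem_nhds hc)] with y' hy'
    exact lt_of_lt_of_le hy' (hVge _ _ (hYS y))
  obtain ⟨z₁, w₁, a₁, hz₁, hw₁, ha₁, hj, -⟩ := hnear ρ hρ hρρ₀ V (hVl.lowerSemicontinuousOn _)
    (fun y hy => by
      have h1 := hVge y y (hmemS y (by rw [hy]; linarith))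
      rw [sqDist_self] at h1
      have : 0 < κ * ρ := by positivity
      linarith) (by
      have h1 := hYd z hzS
      have h2 := (le_abs_self _).trans (hvd _ (hYS z) _ hzS)
      have h3 : K * dist (Y z) z ≤ K * (K / N) := by rw [dist_comm]; gcongr
      have h4 : K * (K / N) = K ^ 2 / N := by ring
      have h5 := mul_nonneg hN0.le (sqDist_nonneg z (Y z))
      rw [hV]
      linarith)
  have hz₁S : z₁ ∈ S := hmemS z₁ (by linarith)
  have hx₁ : dist z₁.1 z.1 ≤ dist z₁ z := by rw [Prod.dist_eq]; exact le_max_left _ _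
  have hKρ : 0 ≤ K * ρ := by positivity
  have h4κ : 4 * κ < δ := by rw [hκ]; linarith
  refine ⟨z₁.1, w₁, a₁, v z₁, by linarith, by linarith, by linarith, ?_, ?_⟩
  · have h1 := hvd _ hz₁S _ hzS
    have h2 : K * dist z₁ z ≤ K * ρ := by gcongr
    linarith
  -- If the inequality fails, a direction `(d, σ)` separates `(w₁, a₁)` from the convex set `a' + G
  -- ≤ δ`. The superjets `(W, b)` of `v` at the nearby maximizers lie in this set, so `V` cannot
  -- grow in that direction as fast as its subjet at `z₁` demands.
  by_contra! hcon
  obtain ⟨d, hd, σ, k, hk, hsep⟩ := hG.exists_separation hcon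
  obtain ⟨c, hc⟩ := hT.curve z₁.1 d hd
  have hτ : Tendsto (fun τ : ℝ => τ) (𝓝[>] 0) (𝓝 0) := tendsto_id.mono_left nhdsWithin_le_nhds
  have hct : Tendsto (fun τ => (c τ, z₁.2 + τ * σ)) (𝓝[>] 0) (𝓝 z₁) := by
    refine (tendsto_curve he hc).prodMk_nhds ?_
    simpa using (hτ.mul_const σ).const_add z₁.2
  have hklim : Tendsto (fun τ : ℝ => k + 2 * K * ‖τ⁻¹ • (e (c τ) - e z₁.1) - d‖ +
      N * τ * (‖τ⁻¹ • (e (c τ) - e z₁.1)‖ ^ 2 + σ ^ 2)) (𝓝[>] 0)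
      (𝓝 (k + 2 * K * ‖d - d‖ + N * 0 * (‖d‖ ^ 2 + σ ^ 2))) :=
    (((hc.sub_const d).norm.const_mul _).const_add k).add
      ((hτ.const_mul N).mul ((hc.norm.pow 2).add_const _))
  simp only [sub_self, norm_zero, mul_zero, zero_mul, add_zero] at hklim
  have hrad : 0 < min (η / 4) (μ / 2 / (K + 1)) := by positivity
  refine absurd (hj.le_of_curve he hc (σ := σ) hklim ?_) (not_le.2 hk)
  filter_upwards [hct.eventually (Metric.ball_mem_nhds z₁ hrad), self_mem_nhdsWithin]
    with τ hτ1 hτ0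
  have hτ0 : 0 < τ := hτ0
  obtain ⟨y, hy⟩ : ∃ y, y = (c τ, z₁.2 + τ * σ) := ⟨_, rfl⟩
  rw [← hy] at hτ1 ⊢
  have hyz : dist y z₁ < η / 4 := (Metric.mem_ball.1 hτ1).trans_le (min_le_left _ _)
  have hyμ : (K + 1) * dist y z₁ < μ / 2 := by
    have := (Metric.mem_ball.1 hτ1).trans_le (min_le_right _ _)
    rwa [lt_div_iff₀ hK1, mul_comm] at this
  have hyS : y ∈ S := hmemS y (by have := dist_triangle y z₁ z; linarith)
  have hyY := hYd y hyS
  have hYz : dist (Y y) z < η := by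
    have h1 := dist_triangle (Y y) y z
    have h2 := dist_triangle y z₁ z
    rw [dist_comm (Y y) y] at h1
    linarith
  have hYI : (Y y).2 ∈ Ioo (z.2 - η) (z.2 + η) := by
    have := abs_lt.1 ((abs_snd_sub_le (Y y) z).trans_lt hYz)
    constructor <;> linarith
  have hsd : ∀ x y : X × ℝ, sqDist x y = ‖e x.1 - e y.1‖ ^ 2 + (x.2 - y.2) ^ 2 := fun x y => by
    rw [sqDist, ← he.dist_eq, dist_eq_norm]
  obtain ⟨W, hW⟩ : ∃ W : E, W = (2 * N) • (e (Y y).1 - e y.1) := ⟨_, rfl⟩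
  obtain ⟨b, hb⟩ : ∃ b : ℝ, b = 2 * N * ((Y y).2 - y.2) := ⟨_, rfl⟩
  have hsup : SupJet e v (Y y) W b := by
    refine SupJet.of_touch he (P := fun x => -(⟪(0 : E), x⟫ - N * ‖x - e y.1‖ ^ 2))
      (β := fun s => -(0 * s - N * (s - y.2) ^ 2)) ?_ ?_ ?_
    · refine (hasFDerivAt_quadratic (0 : E) (e y.1) (e (Y y).1) N).neg.congr_fderiv ?_
      rw [← map_neg, zero_sub, neg_neg, hW]
    · refine (hasDerivAt_quadratic 0 y.2 (Y y).2 N).neg.congr_deriv ?_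
      rw [hb]; ring
    · filter_upwards [(continuous_snd.tendsto (Y y)).eventually (Ioo_mem_nhds hYI.1 hYI.2)]
        with x hx
      have h1 := hY y x (by rw [hS]; exact ⟨mem_univ _, hx.1.le, hx.2.le⟩)
      simp only [sqDist_comm y, hsd] at h1
      simp only [inner_zero_left]
      linarith
  have hWn : ‖W‖ ≤ 2 * K := by
    rw [hW, norm_smul, Real.norm_eq_abs, abs_of_pos (by positivity)]
    have h1 : ‖e (Y y).1 - e y.1‖ ≤ K / N :=
      (norm_fst_sub_le he (Y y) y).trans (by rw [dist_comm]; exact hyY)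
    calc 2 * N * ‖e (Y y).1 - e y.1‖ ≤ 2 * N * (K / N) := by gcongr
      _ = 2 * K := by field_simp
  have hYz₁ : (K + 1) * dist (Y y) z₁ < μ := by
    have h1 := dist_triangle (Y y) y z₁
    rw [dist_comm (Y y) y] at h1
    calc (K + 1) * dist (Y y) z₁ ≤ (K + 1) * (K / N + dist y z₁) := by gcongr; linarith
      _ < μ := by rw [mul_add]; linarith
  have hvY : |v (Y y) - v z₁| ≤ K * dist (Y y) z₁ := hvd _ (hYS y) _ hz₁S
  have hsub : b + G z₁.1 W (v z₁) ≤ δ := by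
    have h1 := hJ _ _ _ hYI hsup
    have h2 := hGμ ((Y y).1, W, v (Y y)) ⟨mem_univ _, mem_closedBall_zero_iff.2 hWn,
      abs_le.1 (hR _ (hYS y))⟩ (z₁.1, W, v z₁) ⟨mem_univ _, mem_closedBall_zero_iff.2 hWn,
      abs_le.1 (hR _ hz₁S)⟩ (by
      have h3 : dist (Y y).1 z₁.1 ≤ dist (Y y) z₁ := by rw [Prod.dist_eq]; exact le_max_left _ _
      have h4 : 0 ≤ K * dist (Y y) z₁ := by positivity
      have h5 := dist_nonneg (x := Y y) (y := z₁)
      rw [Prod.dist_eq, Prod.dist_eq, dist_self]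
      refine max_lt (by simp only; linarith) (max_lt hμ ?_)
      simp only
      rw [Real.dist_eq]
      linarith)
    rw [Real.dist_eq] at h2
    have := (abs_lt.1 h2).1
    simp only at this
    linarith
  have hfin := hsep _ _ hsub
  obtain ⟨D, hD⟩ : ∃ D, D = τ⁻¹ • (e (c τ) - e z₁.1) := ⟨_, rfl⟩
  have hD' : e y.1 - e z₁.1 = τ • D := by rw [hD, smul_inv_smul₀ hτ0.ne', hy]
  rw [← hD]
  -- Using the maximizer for `y` as a competitor at `z₁`, the increment `V y - V z₁` is at most that
  -- of one paraboloid with slope `(W, b)` at `y`, up to a term of order `N τ²`. This is the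
  -- semiconvexity of the sup-convolution.
  have h1 := hVge z₁ _ (hYS y)
  have h2 := hV y
  have h3 : e z₁.1 - e (Y y).1 = (e y.1 - e (Y y).1) - τ • D := by rw [← hD']; abel
  have h4 : e y.1 - e (Y y).1 = -((2 * N)⁻¹ • W) := by
    rw [hW, inv_smul_smul₀ (by positivity), neg_sub]
  have h5 : y.2 = z₁.2 + τ * σ := by rw [hy]
  rw [hsd, h3, @norm_sub_sq_real, h4, inner_neg_left, inner_smul_left, inner_smul_right,
    norm_smul, Real.norm_eq_abs, abs_of_pos hτ0] at h1
  rw [hsd, h4] at h2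
  simp only [conj_trivial] at h1
  have h6 : N * ((2 * N)⁻¹ * (τ * ⟪W, D⟫)) = τ * ⟪W, D⟫ / 2 := by field_simp
  have h7 : ⟪W, D⟫ ≤ ⟪W, d⟫ + 2 * K * ‖D - d‖ := by
    have h8 : ⟪W, D⟫ = ⟪W, d⟫ + ⟪W, D - d⟫ := by rw [inner_sub_right]; ring
    have h9 := real_inner_le_norm W (D - d)
    have h10 : ‖W‖ * ‖D - d‖ ≤ 2 * K * ‖D - d‖ := by gcongr
    linarith
  have h8 : τ * (⟪W, D⟫ + b * σ) ≤ τ * (k + 2 * K * ‖D - d‖) :=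
    mul_le_mul_of_nonneg_left (by linarith) hτ0.le
  have h9 : N * ((z₁.2 - (Y y).2) ^ 2 - (y.2 - (Y y).2) ^ 2) = b * (τ * σ) + N * (τ * σ) ^ 2 := by
    rw [hb, h5]; ring
  linarith

end HamiltonJacobi

/-! ### Operations on jets, and the space Lipschitz bound from coercivity -/

namespace HamiltonJacobi

variable {X E : Type*} [MetricSpace X] [NormedAddCommGroup E] [InnerProductSpace ℝ E]
  {e : X → E} {T : X → Submodule ℝ E} {G : X → E → ℝ → ℝ} {L : ℝ}
  {u v b : X × ℝ → ℝ} {z : X × ℝ} {w w' : E} {a a' : ℝ}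

section JetOperations

theorem SubJet.add_time (h : SubJet e u z w a) {β : ℝ → ℝ} {d : ℝ} (hβ : HasDerivAt β d z.2) :
    SubJet e (fun y => u y + β y.2) z w (a + d) := by
  intro ε hε
  have h2 : ∀ᶠ y : X × ℝ in 𝓝 z, ‖β y.2 - β z.2 - (y.2 - z.2) • d‖ ≤ ε / 2 * ‖y.2 - z.2‖ :=
    (continuous_snd.tendsto z).eventually ((hasDerivAt_iff_isLittleO.1 hβ).def (half_pos hε))
  filter_upwards [h (ε / 2) (half_pos hε), h2] with y h1 h2
  have h3 := (abs_le.1 h2).1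
  have h4 := abs_snd_sub_le y z
  rw [smul_eq_mul] at h3
  rw [Real.norm_eq_abs] at h3
  nlinarith

theorem SupJet.add_time (h : SupJet e u z w a) {β : ℝ → ℝ} {d : ℝ} (hβ : HasDerivAt β d z.2) :
    SupJet e (fun y => u y + β y.2) z w (a + d) := by
  have := SubJet.add_time h hβ.neg
  unfold SupJet
  convert this using 2 <;> simp <;> ring

theorem subJet_comp_add {h : ℝ} : SubJet e (fun y => u (y.1, y.2 + h)) z w a ↔
    SubJet e u (z.1, z.2 + h) w a := by
  have hc : ∀ h : ℝ, ∀ z : X × ℝ, Tendsto (fun y : X × ℝ => (y.1, y.2 + h)) (𝓝 z)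
      (𝓝 (z.1, z.2 + h)) := fun h z => Continuous.tendsto (by fun_prop) z
  constructor <;> intro hj ε hε
  · have h1 := hc (-h) (z.1, z.2 + h)
    simp only [add_neg_cancel_right] at h1
    filter_upwards [h1.eventually (hj ε hε)] with y hy
    simp only [neg_add_cancel_right] at hy
    convert hy using 2
    · ring
    · rw [Prod.dist_eq, Prod.dist_eq, Real.dist_eq, Real.dist_eq]
      simp only
      rw [show y.2 - (z.2 + h) = y.2 + -h - z.2 by ring]
  · filter_upwards [(hc h z).eventually (hj ε hε)] with y hy
    convert hy using 2
    · simp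
    · rw [Prod.dist_eq, Prod.dist_eq, Real.dist_eq, Real.dist_eq]
      simp

theorem supJet_comp_add {h : ℝ} : SupJet e (fun y => u (y.1, y.2 + h)) z w a ↔
    SupJet e u (z.1, z.2 + h) w a :=
  subJet_comp_add (u := fun y => -u y)

theorem SubJet.comp_sub {h : ℝ} (hj : SubJet e (fun y => u (y.1, h - y.2)) z w a) :
    SubJet e u (z.1, h - z.2) w (-a) := by
  intro ε hε
  have h1 : Tendsto (fun y : X × ℝ => (y.1, h - y.2)) (𝓝 (z.1, h - z.2)) (𝓝 z) := by
    have : Continuous fun y : X × ℝ => (y.1, h - y.2) := by fun_prop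
    simpa using this.tendsto (z.1, h - z.2)
  filter_upwards [h1.eventually (hj ε hε)] with y hy
  simp only [sub_sub_cancel] at hy
  convert hy using 2
  · ring
  · rw [Prod.dist_eq, Prod.dist_eq, Real.dist_eq, Real.dist_eq]
    simp only
    rw [abs_sub_comm, show h - z.2 - y.2 = h - y.2 - z.2 by ring]

theorem SupJet.comp_sub {h : ℝ} (hj : SupJet e (fun y => u (y.1, h - y.2)) z w a) :
    SupJet e u (z.1, h - z.2) w (-a) :=
  SubJet.comp_sub (u := fun y => -u y) hj

theorem SubJet.time_eq (hT : IsTangentField e T) (hu : SubJet e u z w a) {d : ℝ}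
    (hd : HasDerivAt (fun s => u (z.1, s)) d z.2) : a = d := by
  have key : ∀ σ : ℝ, a * σ ≤ d * σ := fun σ => by
    have h1 : HasDerivAt (fun τ : ℝ => u (z.1, z.2 + τ * σ)) (d * σ) 0 := by
      have h2 : HasDerivAt (fun τ : ℝ => z.2 + τ * σ) σ 0 := by
        simpa using ((hasDerivAt_id (0 : ℝ)).mul_const σ).const_add z.2
      refine HasDerivAt.comp (0 : ℝ) (h₂ := fun s => u (z.1, s)) ?_ h2
      simpa using hd
    refine hu.time_le hT h1.tendsto_slope_zero_right ?_
    filter_upwards [self_mem_nhdsWithin] with τ hτ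
    have hτ : 0 < τ := hτ
    simp only [zero_add, zero_mul, add_zero, smul_eq_mul]
    rw [mul_inv_cancel_left₀ hτ.ne']
    simp
  have h1 := key 1
  have h2 := key (-1)
  linarith

theorem SupJet.time_eq (hT : IsTangentField e T) (hu : SupJet e u z w a) {d : ℝ}
    (hd : HasDerivAt (fun s => u (z.1, s)) d z.2) : a = d :=
  neg_injective (SubJet.time_eq hT hu hd.neg)

theorem SupJet.inner_le (hT : IsTangentField e T) (hu : SupJet e u z w a) {K : ℝ}
    (hK : ∀ᶠ y in 𝓝 z.1, u z - K * dist y z.1 ≤ u (y, z.2)) {h : E} (hh : h ∈ T z.1) :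
    ⟪w, h⟫ ≤ K * ‖h‖ := by
  have := SubJet.inner_le hT hu (K := K) (hK.mono fun y hy => by linarith) (neg_mem hh)
  simpa using this

end JetOperations

theorem IsHamiltonian.congr_of_inner_eq_zero (hG : IsHamiltonian T G L) {x : X} {r : ℝ}
    (h : ∀ k ∈ T x, ⟪w - w', k⟫ = 0) : G x w r = G x w' r :=
  hG.tang x w w' r fun k hk => by
    have := h k hk
    rw [inner_sub_left] at this
    linarith

/-- Coercivity yields a space Lipschitz bound for subsolutions that are Lipschitz in time. -/
theorem exists_space_lipschitz [CompactSpace X] [FiniteDimensional ℝ E] (hT : IsTangentField e T)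
    (hG : IsHamiltonian T G L) (B R : ℝ) (hB : 0 ≤ B) (hR : 0 ≤ R) :
    ∃ K₁ : ℝ, 0 ≤ K₁ ∧ ∀ (v : X × ℝ → ℝ) (α β : ℝ), Continuous v →
      (∀ z, z.2 ∈ Ioo α β → |v z| ≤ R) →
      (∀ x, ∀ s ∈ Ioo α β, ∀ t ∈ Ioo α β, |v (x, s) - v (x, t)| ≤ B * |s - t|) →
      (∀ z w a, z.2 ∈ Ioo α β → SupJet e v z w a → a + G z.1 w (v z) ≤ 0) →
      ∀ x y, ∀ t ∈ Ioo α β, v (x, t) - v (y, t) ≤ K₁ * dist x y := by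
  have he := hT.isometry
  obtain ⟨K, hK, hco⟩ := hG.coer (R + B + 1) (by positivity)
  obtain ⟨ρ, hρ, hap⟩ := hT.approx (1 / 2) (by norm_num)
  -- The second term forces the maximizer below to lie within `ρ` of `y₀`, where secants are within
  -- relative error `1/2` of being tangent. There the tangential part of a radial covector of length
  -- `K₁` has norm at least `K₁ / 3`.
  obtain ⟨K₁, hK₁⟩ : ∃ K₁, K₁ = 3 * K + (2 * R + 1) / ρ := ⟨_, rfl⟩
  have hK₁0 : 0 < K₁ := by rw [hK₁]; positivity
  have hK₁K : 3 * K ≤ K₁ := by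
    rw [hK₁]; have : 0 ≤ (2 * R + 1) / ρ := by positivity
    linarith
  have hK₁ρ : 2 * R + 1 ≤ K₁ * ρ := by
    rw [hK₁, add_mul, div_mul_cancel₀ _ hρ.ne']
    have : 0 ≤ 3 * K * ρ := by positivity
    linarith
  refine ⟨K₁, hK₁0.le, fun v α β hv hvR hvB hJ x₀ y₀ t₀ ht₀ => ?_⟩
  by_contra! hcon
  obtain ⟨γ, hγ⟩ : ∃ γ, γ = v (x₀, t₀) - v (y₀, t₀) - K₁ * dist x₀ y₀ := ⟨_, rfl⟩
  have hγ0 : 0 < γ := by rw [hγ]; linarith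
  obtain ⟨η, hη, hηlt⟩ : ∃ η > 0, η < min (t₀ - α) (β - t₀) :=
    exists_between (lt_min (sub_pos.2 ht₀.1) (sub_pos.2 ht₀.2))
  have hηα := hηlt.trans_le (min_le_left _ _)
  have hηβ := hηlt.trans_le (min_le_right _ _)
  have hI : ∀ s ∈ Icc (t₀ - η) (t₀ + η), s ∈ Ioo α β := fun s hs =>
    ⟨by linarith [hs.1], by linarith [hs.2]⟩
  -- The first term keeps the maximizer inside the time window. The second makes the gain `B |s -
  -- t₀| - N (s - t₀)²` along the fibre over `y₀` smaller than `γ`, so the maximizer is not over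
  -- `y₀`.
  obtain ⟨N, hN⟩ : ∃ N, N = (2 * R + 1) / η ^ 2 + B ^ 2 / γ + 1 := ⟨_, rfl⟩
  have hN0 : 0 < N := by rw [hN]; positivity
  have hNη : 2 * R + 1 ≤ N * η ^ 2 := by
    rw [← div_le_iff₀ (by positivity), hN]
    have : 0 ≤ B ^ 2 / γ := by positivity
    linarith
  have hNγ : B ^ 2 < N * γ := by
    rw [← div_lt_iff₀ hγ0, hN]
    have : 0 ≤ (2 * R + 1) / η ^ 2 := by positivity
    linarith
  have hne : ((univ : Set X) ×ˢ Icc (t₀ - η) (t₀ + η)).Nonempty :=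
    ⟨(x₀, t₀), mem_univ _, by constructor <;> simp only <;> linarith⟩
  obtain ⟨z, hz, hmax⟩ := (isCompact_univ.prod isCompact_Icc).exists_isMaxOn hne
    (f := fun z : X × ℝ => v z - K₁ * dist z.1 y₀ - N * (z.2 - t₀) ^ 2)
    (Continuous.continuousOn (by fun_prop))
  have hmax' : ∀ y, y.2 ∈ Icc (t₀ - η) (t₀ + η) → v y - K₁ * dist y.1 y₀ - N * (y.2 - t₀) ^ 2 ≤
      v z - K₁ * dist z.1 y₀ - N * (z.2 - t₀) ^ 2 := fun y hy => hmax ⟨mem_univ _, hy⟩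
  have hzI := hI _ hz.2
  have hz₀ := hmax' (x₀, t₀) (by constructor <;> simp only <;> linarith)
  simp only [sub_self] at hz₀
  have hvz := abs_le.1 (hvR z hzI)
  have hvy₀ := abs_le.1 (hvR (y₀, t₀) ht₀)
  have hd0 : 0 ≤ K₁ * dist z.1 y₀ := by positivity
  have hq0 : 0 ≤ N * (z.2 - t₀) ^ 2 := by positivity
  have hzη : |z.2 - t₀| < η := by
    have h1 : |z.2 - t₀| ≤ η := abs_le.2 ⟨by linarith [hz.2.1], by linarith [hz.2.2]⟩
    refine lt_of_le_of_ne h1 fun h => ?_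
    rw [← sq_abs (z.2 - t₀), h] at hz₀
    linarith
  have hzx : z.1 ≠ y₀ := fun h => by
    have h1 := (le_abs_self _).trans (hvB y₀ _ hzI t₀ ht₀)
    have h5 : z = (y₀, z.2) := by rw [← h]
    have h6 : dist z.1 y₀ = 0 := by rw [h, dist_self]
    rw [← h5] at h1
    rw [h6, ← sq_abs (z.2 - t₀)] at hz₀
    have h2 : B * |z.2 - t₀| - N * |z.2 - t₀| ^ 2 < γ := by
      have h3 : 0 ≤ (2 * N * |z.2 - t₀| - B) ^ 2 := sq_nonneg _
      have h4 : N * (B * |z.2 - t₀| - N * |z.2 - t₀| ^ 2) < N * γ := by nlinarith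
      exact lt_of_mul_lt_mul_left h4 hN0.le
    linarith
  have hzρ : dist z.1 y₀ < ρ := by
    by_contra! h
    have : K₁ * ρ ≤ K₁ * dist z.1 y₀ := by gcongr
    linarith
  obtain ⟨r, hr⟩ : ∃ r, r = dist z.1 y₀ := ⟨_, rfl⟩
  have hr0 : 0 < r := by rw [hr]; exact dist_pos.2 hzx
  have hrn : ‖e z.1 - e y₀‖ = r := by rw [← dist_eq_norm, he.dist_eq, hr]
  obtain ⟨W, hW⟩ : ∃ W : E, W = (K₁ / r) • (e z.1 - e y₀) := ⟨_, rfl⟩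
  -- By the arithmetic-geometric mean inequality the cone `K₁ dist` lies below a paraboloid equal to
  -- it at distance `r`; the paraboloid is a differentiable test function.
  have hsup : SupJet e v z W (2 * N * (z.2 - t₀)) := by
    refine SupJet.of_touch he (P := fun x => -(⟪(0 : E), x⟫ - K₁ / (2 * r) * ‖x - e y₀‖ ^ 2))
      (β := fun s => -(0 * s - N * (s - t₀) ^ 2)) ?_ ?_ ?_
    · refine (hasFDerivAt_quadratic (0 : E) (e y₀) (e z.1) _).neg.congr_fderiv ?_
      rw [← map_neg, zero_sub, neg_neg, hW]
      congr 2
      field_simp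
    · refine (hasDerivAt_quadratic 0 t₀ z.2 N).neg.congr_deriv ?_
      ring
    · have hzη' := abs_lt.1 hzη
      have : ∀ᶠ y in 𝓝 z, y.2 ∈ Ioo (t₀ - η) (t₀ + η) :=
        (continuous_snd.tendsto z).eventually
          (Ioo_mem_nhds (by linarith) (by linarith))
      filter_upwards [this] with y hy
      have h1 := hmax' y ⟨hy.1.le, hy.2.le⟩
      have h2 : ‖e y.1 - e y₀‖ = dist y.1 y₀ := by rw [← dist_eq_norm, he.dist_eq]
      have h3 : K₁ * dist y.1 y₀ - K₁ * r ≤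
          K₁ / (2 * r) * ‖e y.1 - e y₀‖ ^ 2 - K₁ / (2 * r) * ‖e z.1 - e y₀‖ ^ 2 := by
        have h4 : 0 ≤ K₁ / (2 * r) * (dist y.1 y₀ - r) ^ 2 := by positivity
        have h5 : K₁ / (2 * r) * (dist y.1 y₀ - r) ^ 2 =
          K₁ / (2 * r) * dist y.1 y₀ ^ 2 - K₁ / (2 * r) * r ^ 2 - (K₁ * dist y.1 y₀ - K₁ * r) := by
          field_simp; ring
        rw [h2, hrn]
        linarith
      rw [← hr] at h1
      simp only [inner_zero_left]
      linarith
  have hGle := hJ z _ _ hzI hsup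
  have haB : -B ≤ 2 * N * (z.2 - t₀) := by
    have := SubJet.time_le hT hsup (σ := 1) (k := fun _ => B) tendsto_const_nhds (by
      have h1 : Tendsto (fun τ : ℝ => z.2 + τ * 1) (𝓝[>] 0) (𝓝 z.2) := by
        have : Continuous fun τ : ℝ => z.2 + τ * 1 := by fun_prop
        simpa using (this.tendsto 0).mono_left nhdsWithin_le_nhds
      filter_upwards [h1.eventually (Ioo_mem_nhds hzI.1 hzI.2), self_mem_nhdsWithin] with τ h2 h3
      have h3 : 0 < τ := h3
      have h4 := (neg_le_abs _).trans (hvB z.1 _ h2 z.2 hzI)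
      simp only [mul_one, add_sub_cancel_left, abs_of_pos h3] at h4 ⊢
      linarith)
    linarith
  obtain ⟨h, hh, hhn⟩ := hap z.1 y₀ hzρ
  obtain ⟨p, hp, hwp, -⟩ := exists_mem_inner_eq (T z.1) W
  rw [hG.tang z.1 W p _ hwp] at hGle
  have hpn : K ≤ ‖p‖ := by
    rw [← hr] at hhn
    obtain ⟨q, hq⟩ : ∃ q, q = e z.1 - e y₀ := ⟨_, rfl⟩
    have h1 : ‖q + h‖ ≤ 1 / 2 * r := by
      have : q + h = -(e y₀ - e z.1 - h) := by rw [hq]; abel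
      rwa [this, norm_neg]
    have h2 : ⟪W, -h⟫ = K₁ / r * (⟪q, q⟫ - ⟪q, q + h⟫) := by
      rw [hW, inner_smul_left, ← hq, inner_add_right, inner_neg_right]; simp
    have h3 : ⟪q, q + h⟫ ≤ r * (1 / 2 * r) := by
      refine (real_inner_le_norm _ _).trans ?_
      rw [hq, hrn, ← hq]
      gcongr
    have h4 : ⟪q, q⟫ = r ^ 2 := by rw [real_inner_self_eq_norm_sq, hq, hrn]
    have h5 : K₁ / r * (r ^ 2 / 2) ≤ ⟪W, -h⟫ := by
      rw [h2, h4]; gcongr; linarith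
    have h6 : ‖h‖ ≤ 3 / 2 * r := by
      have : h = (q + h) - q := by abel
      rw [this]
      refine (norm_sub_le _ _).trans ?_
      rw [hq, hrn, ← hq]; linarith
    have h7 : ⟪W, -h⟫ ≤ ‖p‖ * (3 / 2 * r) := by
      rw [hwp _ (neg_mem hh)]
      refine (real_inner_le_norm _ _).trans ?_
      rw [norm_neg]; gcongr
    have h8 : K₁ / r * (r ^ 2 / 2) = K₁ / 3 * (3 / 2 * r) := by field_simp
    have h9 : K₁ / 3 ≤ ‖p‖ := le_of_mul_le_mul_right (by linarith) (by positivity : 0 < 3 / 2 * r)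
    linarith
  have := hco z.1 p hp (v z) (by rw [abs_le]; constructor <;> linarith) hpn
  linarith

end HamiltonJacobi

/-! ### Barriers and the class for Perron's method -/

namespace HamiltonJacobi

variable {X E : Type*} [MetricSpace X] [NormedAddCommGroup E] [InnerProductSpace ℝ E]
  {e : X → E} {T : X → Submodule ℝ E} {G : X → E → ℝ → ℝ} {L : ℝ}
  {u v b : X × ℝ → ℝ} {z : X × ℝ} {w w' : E} {a a' : ℝ}

/-- The solution of `b' = C + Λ b`, `b 0 = 0` for positive times, extended by zero. -/
noncomputable def barrier (C Λ t : ℝ) : ℝ := C / Λ * (Real.exp (Λ * max t 0) - 1)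

section Barrier

variable {C Λ : ℝ}

theorem barrier_of_nonpos {t : ℝ} (ht : t ≤ 0) : barrier C Λ t = 0 := by
  simp [barrier, max_eq_right ht]

theorem continuous_barrier : Continuous (barrier C Λ) := by unfold barrier; fun_prop

theorem barrier_mono (hC : 0 ≤ C) (hΛ : 0 < Λ) : Monotone (barrier C Λ) := fun s t hst => by
  unfold barrier; gcongr

theorem barrier_nonneg (hC : 0 ≤ C) (hΛ : 0 < Λ) (t : ℝ) : 0 ≤ barrier C Λ t := by
  have := barrier_mono hC hΛ (min_le_left t 0)
  rwa [barrier_of_nonpos (min_le_right t 0)] at this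

theorem hasDerivAt_barrier (hΛ : 0 < Λ) {t : ℝ} (ht : 0 < t) :
    HasDerivAt (barrier C Λ) (C + Λ * barrier C Λ t) t := by
  have h1 : HasDerivAt (fun s => C / Λ * (Real.exp (Λ * s) - 1))
      (C / Λ * (Real.exp (Λ * t) * Λ)) t := by
    have h2 := (((hasDerivAt_id t).const_mul Λ).exp.sub_const 1).const_mul (C / Λ)
    simpa using h2
  have h3 : barrier C Λ =ᶠ[𝓝 t] fun s => C / Λ * (Real.exp (Λ * s) - 1) := by
    filter_upwards [lt_mem_nhds ht] with s hs
    rw [barrier, max_eq_left hs.le]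
  refine (h1.congr_of_eventuallyEq h3).congr_deriv ?_
  rw [barrier, max_eq_left ht.le]
  field_simp
  ring

theorem exp_sub_exp_le {x y c : ℝ} (hy : y ≤ c) (hxy : x ≤ y) :
    Real.exp y - Real.exp x ≤ Real.exp c * (y - x) := by
  have h1 : Real.exp x = Real.exp y * Real.exp (x - y) := by rw [← Real.exp_add]; ring_nf
  have h2 := Real.add_one_le_exp (x - y)
  have h3 : Real.exp y ≤ Real.exp c := Real.exp_le_exp.2 hy
  have h4 := Real.exp_pos y
  rw [h1]
  nlinarith

end Barrier

/-- The class of subsolutions used in Perron's method for the initial datum `f`. -/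
structure IsPerronSub (e : X → E) (G : X → E → ℝ → ℝ) (f : X → ℝ) (C Λ : ℝ) (v : X × ℝ → ℝ) :
    Prop where
  cont : Continuous v
  lower : ∀ z, f z.1 - barrier C Λ z.2 ≤ v z
  upper : ∀ z, v z ≤ f z.1 + barrier C Λ z.2
  mono : ∀ x s t, s ≤ t →
    v (x, s) + (C + 1) / Λ * Real.exp (Λ * s) ≤ v (x, t) + (C + 1) / Λ * Real.exp (Λ * t)
  sub : ∀ z w a, 0 < z.2 → SupJet e v z w a → a + G z.1 w (v z) ≤ 0

/-- The constants for which the barriers work. -/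
structure BarrierData (T : X → Submodule ℝ E) (G : X → E → ℝ → ℝ) (L : ℝ) (f : X → ℝ) (K₀ : ℝ≥0)
    (C Λ : ℝ) : Prop where
  lip : LipschitzWith K₀ f
  nonneg : 0 ≤ C
  pos : 0 < Λ
  le : L ≤ Λ
  bound : ∀ x w, (∀ h ∈ T x, ⟪w, h⟫ ≤ K₀ * ‖h‖) → |G x w (f x)| ≤ C

variable {f : X → ℝ} {K₀ : ℝ≥0} {C Λ : ℝ}

theorem IsPerronSub.eq_of_nonpos (hv : IsPerronSub e G f C Λ v) (hz : z.2 ≤ 0) :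
    v z = f z.1 := by
  have h1 := hv.lower z
  have h2 := hv.upper z
  rw [barrier_of_nonpos hz] at h1 h2
  linarith

/-- Since `Λ ≥ L`, the slope `C + Λ · barrier` absorbs the change of `G` caused by moving `f` by the
barrier. This makes `f - barrier` a subsolution and `f + barrier` a supersolution. -/
theorem BarrierData.bound_add (hB : BarrierData T G L f K₀ C Λ) (hG : IsHamiltonian T G L) {x : X}
    {w : E} (hw : ∀ h ∈ T x, ⟪w, h⟫ ≤ K₀ * ‖h‖) (t σ : ℝ) (hσ : |σ| = 1) :
    |G x w (f x + σ * barrier C Λ t)| ≤ C + Λ * barrier C Λ t := by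
  have h1 := hB.bound x w hw
  have h2 := hG.lip x w (f x + σ * barrier C Λ t) (f x)
  have h3 := barrier_nonneg hB.nonneg hB.pos t
  rw [add_sub_cancel_left, abs_mul, hσ, one_mul, abs_of_nonneg h3] at h2
  have h4 := abs_sub_abs_le_abs_sub (G x w (f x + σ * barrier C Λ t)) (G x w (f x))
  have h5 := mul_le_mul_of_nonneg_right hB.le h3
  linarith

theorem isPerronSub_lower (hT : IsTangentField e T) (hG : IsHamiltonian T G L)
    (hB : BarrierData T G L f K₀ C Λ) :
    IsPerronSub e G f C Λ fun z => f z.1 - barrier C Λ z.2 where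
  cont := (hB.lip.continuous.comp continuous_fst).sub (continuous_barrier.comp continuous_snd)
  lower z := le_rfl
  upper z := by linarith [barrier_nonneg hB.nonneg hB.pos z.2]
  mono x s t hst := by
    have hΛ := hB.pos
    have h1 : Real.exp (Λ * max t 0) - Real.exp (Λ * max s 0) ≤
        Real.exp (Λ * t) - Real.exp (Λ * s) := by
      have hst' : Λ * s ≤ Λ * t := by gcongr
      rcases le_total t 0 with ht | ht
      · rw [max_eq_right ht, max_eq_right (hst.trans ht), sub_self]
        exact sub_nonneg.2 (Real.exp_le_exp.2 hst')
      · rw [max_eq_left ht]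
        have h2 : Real.exp (Λ * s) ≤ Real.exp (Λ * max s 0) :=
          Real.exp_le_exp.2 (by gcongr; exact le_max_left _ _)
        linarith
    have h2 : Real.exp (Λ * s) ≤ Real.exp (Λ * t) := Real.exp_le_exp.2 (by gcongr)
    have h3 : 0 ≤ C / Λ := div_nonneg hB.nonneg hΛ.le
    have h4 : 0 < 1 / Λ := by positivity
    have h5 := mul_le_mul_of_nonneg_left h1 h3
    have h6 := mul_le_mul_of_nonneg_left h2 h4.le
    simp only [barrier, add_div]
    linarith
  sub z w a hz hj := by
    have h1 : a = -(C + Λ * barrier C Λ z.2) :=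
      hj.time_eq hT ((hasDerivAt_barrier hB.pos hz).const_sub (f z.1))
    have h2 : ∀ h ∈ T z.1, ⟪w, h⟫ ≤ K₀ * ‖h‖ := fun h hh =>
      hj.inner_le hT (Eventually.of_forall fun y => by
        have := (le_abs_self _).trans (hB.lip.dist_le_mul z.1 y)
        rw [dist_comm] at this
        linarith) hh
    have h3 := (le_abs_self _).trans (hB.bound_add hG h2 z.2 (-1) (by simp))
    rw [neg_one_mul, ← sub_eq_add_neg] at h3
    linarith

/-- Delaying a subsolution in time and lowering it gives a subsolution again. -/
theorem IsPerronSub.delay (hT : IsTangentField e T) (hG : IsHamiltonian T G L)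
    (hB : BarrierData T G L f K₀ C Λ) (hv : IsPerronSub e G f C Λ v) {h : ℝ} (hh : 0 ≤ h) :
    IsPerronSub e G f C Λ fun z => max (f z.1 - barrier C Λ z.2)
      (v (z.1, z.2 + -h) + -(C / Λ * (Real.exp (Λ * z.2) - Real.exp (Λ * (z.2 + -h))))) := by
  have hl := isPerronSub_lower hT hG hB
  have hΛ := hB.pos
  have hCΛ : 0 ≤ C / Λ := div_nonneg hB.nonneg hΛ.le
  have hexp : ∀ t, Real.exp (Λ * (t + -h)) ≤ Real.exp (Λ * t) := fun t =>
    Real.exp_le_exp.2 (by gcongr; linarith)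
  -- Up to time `h` the delayed function still carries the initial datum and no inequality is
  -- available for it; there it is hidden under the lower barrier.
  have hle : ∀ z : X × ℝ, z.2 ≤ h → v (z.1, z.2 + -h) +
      -(C / Λ * (Real.exp (Λ * z.2) - Real.exp (Λ * (z.2 + -h)))) ≤ f z.1 - barrier C Λ z.2 :=
    fun z hz => by
      rw [hv.eq_of_nonpos (z := (z.1, z.2 + -h)) (by simp only; linarith)]
      have h1 : Real.exp (Λ * max z.2 0) - 1 ≤ Real.exp (Λ * z.2) - Real.exp (Λ * (z.2 + -h)) := by
        rcases le_total z.2 0 with h0 | h0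
        · rw [max_eq_right h0, mul_zero, Real.exp_zero, sub_self]
          exact sub_nonneg.2 (hexp _)
        · rw [max_eq_left h0]
          have : Real.exp (Λ * (z.2 + -h)) ≤ 1 := Real.exp_le_one_iff.2
            (mul_nonpos_of_nonneg_of_nonpos hΛ.le (by linarith))
          linarith
      have h2 := mul_le_mul_of_nonneg_left h1 hCΛ
      unfold barrier
      linarith
  refine ⟨?_, fun z => le_max_left _ _, fun z => max_le (hl.upper z) ?_, fun x s t hst => ?_, ?_⟩
  · have := hv.cont
    exact hl.cont.max (by fun_prop)
  · have h1 := hv.upper (z.1, z.2 + -h)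
    have h2 := barrier_mono hB.nonneg hΛ (show z.2 + -h ≤ z.2 by linarith)
    have h3 := mul_nonneg hCΛ (sub_nonneg.2 (hexp z.2))
    simp only at h1
    linarith
  · rw [max_add, max_add]
    refine max_le_max (hl.mono x s t hst) ?_
    have h1 := hv.mono x (s + -h) (t + -h) (by linarith)
    have h2 : Real.exp (Λ * s) - Real.exp (Λ * (s + -h)) ≤
        Real.exp (Λ * t) - Real.exp (Λ * (t + -h)) := by
      have h3 : ∀ r, Real.exp (Λ * r) - Real.exp (Λ * (r + -h)) =
          Real.exp (Λ * r) * (1 - Real.exp (-(Λ * h))) := fun r => by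
        rw [mul_sub, ← Real.exp_add]; ring_nf
      rw [h3, h3]
      have h4 : Real.exp (-(Λ * h)) ≤ 1 := Real.exp_le_one_iff.2 (by
        have := mul_nonneg hΛ.le hh; linarith)
      have h5 : 0 ≤ 1 - Real.exp (-(Λ * h)) := by linarith
      gcongr
    have h3 := mul_le_mul_of_nonneg_left h2 (by positivity : 0 ≤ 1 / Λ)
    simp only [add_div, add_mul] at h1 ⊢
    linarith
  · intro z w a hz hj
    by_cases hc : v (z.1, z.2 + -h) +
      -(C / Λ * (Real.exp (Λ * z.2) - Real.exp (Λ * (z.2 + -h)))) ≤ f z.1 - barrier C Λ z.2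
    · simp only [max_eq_left hc]
      exact hl.sub z w a hz (hj.congr_of_le (Eventually.of_forall fun _ => le_max_left _ _)
        (max_eq_left hc))
    · have hzh : h < z.2 := by
        by_contra! hzh
        exact hc (hle z hzh)
      have hc' := max_eq_right (not_le.1 hc).le
      simp only [hc']
      have hj1 := hj.congr_of_le (v := fun z : X × ℝ => v (z.1, z.2 + -h) +
        -(C / Λ * (Real.exp (Λ * z.2) - Real.exp (Λ * (z.2 + -h)))))
        (Eventually.of_forall fun _ => le_max_right _ _) hc'
      -- The time derivative of the correction is `Λ` times the correction, at least as much as `G`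
      -- can gain when the value is lowered by it.
      have hd : HasDerivAt (fun t => C / Λ * (Real.exp (Λ * t) - Real.exp (Λ * (t + -h))))
          (C * (Real.exp (Λ * z.2) - Real.exp (Λ * (z.2 + -h)))) z.2 := by
        have h1 := ((((hasDerivAt_id z.2).const_mul Λ).exp).sub
          ((((hasDerivAt_id z.2).add_const (-h)).const_mul Λ).exp)).const_mul (C / Λ)
        refine h1.congr_deriv ?_
        simp only [id]
        field_simp
      have hj2 := hj1.add_time hd
      simp only [neg_add_cancel_right] at hj2
      have h1 := hv.sub _ _ _ (by simp only; linarith) (supJet_comp_add.1 hj2)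
      have h2 := hG.lip z.1 w (v (z.1, z.2 + -h) +
        -(C / Λ * (Real.exp (Λ * z.2) - Real.exp (Λ * (z.2 + -h))))) (v (z.1, z.2 + -h))
      have h3 := mul_nonneg hCΛ (sub_nonneg.2 (hexp z.2))
      rw [add_sub_cancel_left, abs_neg, abs_of_nonneg h3] at h2
      have h4 := mul_le_mul_of_nonneg_right hB.le h3
      have h5 : Λ * (C / Λ * (Real.exp (Λ * z.2) - Real.exp (Λ * (z.2 + -h)))) =
        C * (Real.exp (Λ * z.2) - Real.exp (Λ * (z.2 + -h))) := by field_simp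
      have h6 := (le_abs_self _).trans h2
      simp only at h1
      linarith

variable [CompactSpace X] [FiniteDimensional ℝ E]

/-- The functions in Perron's class are Lipschitz with a common constant, up to any time. -/
theorem exists_lipschitzOnWith_isPerronSub (hT : IsTangentField e T) (hG : IsHamiltonian T G L)
    (hB : BarrierData T G L f K₀ C Λ) (S : ℝ) :
    ∃ K : ℝ≥0, ∀ v, IsPerronSub e G f C Λ v → LipschitzOnWith K v (univ ×ˢ Iic S) := by
  have hΛ := hB.pos
  obtain ⟨F, hF⟩ := isCompact_univ.exists_bound_of_continuousOn hB.lip.continuous.continuousOn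
  obtain ⟨S', hS'⟩ : ∃ S', S' = max S 0 + 1 := ⟨_, rfl⟩
  have hS0 : 0 < S' := by rw [hS']; linarith [le_max_right S 0]
  have hSS : S < S' := by rw [hS']; linarith [le_max_left S 0]
  obtain ⟨R, hR⟩ : ∃ R, R = |F| + barrier C Λ S' := ⟨_, rfl⟩
  have hR0 : 0 ≤ R := by
    rw [hR]; have := barrier_nonneg hB.nonneg hΛ S'; positivity
  obtain ⟨C₁, hC₁, hGC⟩ := hG.exists_neg_le R
  obtain ⟨C₂, hC₂⟩ : ∃ C₂, C₂ = (C + 1) * Real.exp (Λ * S') := ⟨_, rfl⟩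
  have hC₂0 : 0 ≤ C₂ := by rw [hC₂]; have := hB.nonneg; positivity
  obtain ⟨K₁, hK₁0, hK₁⟩ := exists_space_lipschitz hT hG (C₁ + C₂) R (by positivity) hR0
  refine ⟨(K₁ + K₀ + (C₁ + C₂)).toNNReal, fun v hv => ?_⟩
  have hvR : ∀ z : X × ℝ, z.2 ≤ S' → |v z| ≤ R := fun z hz => by
    have h1 := hv.lower z
    have h2 := hv.upper z
    have h3 := barrier_mono hB.nonneg hΛ hz
    have h4 := abs_le.1 ((hF z.1 (mem_univ _)).trans (le_abs_self F))
    rw [hR, abs_le]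
    constructor <;> linarith
  -- Changing the signs of value and time turns superjets into subjets whose time components satisfy
  -- `a ≤ -G ≤ C₁`, so the growth lemma applies. The opposite bound `hlow` is the monotonicity built
  -- into the class; a Lipschitz bound in time then yields one in space.
  have hup0 : ∀ x s t, 0 < s → s ≤ t → t < S' → v (x, t) - v (x, s) ≤ C₁ * (t - s) :=
      fun x s t hs hst ht => by
    have hvc : Continuous fun y : X × ℝ => -v (y.1, 0 - y.2) := by
      have := hv.cont; fun_prop
    have h1 := growth_le_of_subJet hT.isometry hvc.lowerSemicontinuous (α := -S') (β := 0)
      (N := R + C₁ * S' + 1) hC₁ (fun z w a hz _ hj => by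
        have hj1 : SupJet e (fun y => v (y.1, 0 - y.2)) z (-w) (-a) := by
          simpa only [SupJet, neg_neg] using hj
        have h2 := hv.sub _ _ _ (by simp only; linarith [hz.2]) hj1.comp_sub
        have h3 := hGC z.1 (-w) (v (z.1, 0 - z.2)) (hvR _ (by simp only; linarith [hz.1]))
        simp only at h2
        linarith) (x := x) (t := -t) (t' := -s) (by linarith) (by linarith) (by linarith) (by
        have h4 := (abs_le.1 (hvR (x, 0 - -t) (by simp only; linarith))).1
        have h5 : C₁ * (-s - -t) ≤ C₁ * S' := by gcongr; linarith
        simp only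
        linarith)
    simp only [sub_neg_eq_add, zero_add] at h1
    linarith
  have hup : ∀ x s t, s ≤ t → t < S' → v (x, t) - v (x, s) ≤ C₁ * (t - s) := fun x s t hst ht => by
    rcases lt_or_ge 0 s with hs | hs
    · exact hup0 x s t hs hst ht
    have hvs : v (x, s) = f x := hv.eq_of_nonpos hs
    rcases le_or_gt t 0 with ht0 | ht0
    · rw [hvs, hv.eq_of_nonpos (z := (x, t)) ht0]
      have := mul_nonneg hC₁ (sub_nonneg.2 hst)
      simpa using this
    · have h1 : Tendsto (fun r => v (x, t) - v (x, r)) (𝓝[>] 0) (𝓝 (v (x, t) - v (x, 0))) := by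
        have : Continuous fun r => v (x, t) - v (x, r) := by have := hv.cont; fun_prop
        exact (this.tendsto 0).mono_left nhdsWithin_le_nhds
      have h2 : v (x, t) - v (x, 0) ≤ C₁ * (t - s) := by
        refine le_of_tendsto h1 ?_
        filter_upwards [Ioo_mem_nhdsGT ht0] with r hr
        refine (hup0 x r t hr.1 hr.2.le ht).trans ?_
        gcongr
        exact hs.trans hr.1.le
      rwa [hv.eq_of_nonpos (z := (x, 0)) le_rfl, ← hvs] at h2
  have hlow : ∀ x s t, s ≤ t → t < S' → v (x, s) - v (x, t) ≤ C₂ * (t - s) := fun x s t hst ht => by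
    have h1 := hv.mono x s t hst
    have h2 := exp_sub_exp_le (x := Λ * s) (y := Λ * t) (c := Λ * S') (by gcongr) (by gcongr)
    have h3 : 0 ≤ (C + 1) / Λ := by have := hB.nonneg; positivity
    have h4 := mul_le_mul_of_nonneg_left h2 h3
    have h5 : (C + 1) / Λ * (Real.exp (Λ * S') * (Λ * t - Λ * s)) = C₂ * (t - s) := by
      rw [hC₂]; field_simp
    linarith
  have htime : ∀ x, ∀ s < S', ∀ t < S', |v (x, s) - v (x, t)| ≤ (C₁ + C₂) * |s - t| :=
      fun x s hs t ht => by
    wlog hst : s ≤ t generalizing s t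
    · rw [abs_sub_comm, abs_sub_comm s]
      exact this t ht s hs (not_le.1 hst).le
    have h1 := hup x s t hst ht
    have h2 := hlow x s t hst ht
    have h3 := sub_nonneg.2 hst
    rw [abs_sub_comm s, abs_of_nonneg h3, abs_le]
    constructor <;> nlinarith
  have hspace : ∀ x y, ∀ t < S', v (x, t) - v (y, t) ≤ (K₁ + K₀) * dist x y := fun x y t ht => by
    rcases le_or_gt t 0 with ht0 | ht0
    · rw [hv.eq_of_nonpos (z := (x, t)) ht0, hv.eq_of_nonpos (z := (y, t)) ht0]
      have := (le_abs_self _).trans (hB.lip.dist_le_mul x y)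
      have h2 := mul_nonneg hK₁0 (dist_nonneg (x := x) (y := y))
      simp only
      linarith
    · have h1 := hK₁ v 0 S' hv.cont (fun z hz => hvR z hz.2.le)
        (fun x s hs t ht => htime x s hs.2 t ht.2) (fun z w a hz => hv.sub z w a hz.1) x y t ⟨ht0, ht⟩
      have h2 : 0 ≤ (K₀ : ℝ) * dist x y := by positivity
      linarith
  refine LipschitzOnWith.of_dist_le_mul fun y hy z hz => ?_
  have hy2 : y.2 < S' := (mem_Iic.1 hy.2).trans_lt hSS
  have hz2 : z.2 < S' := (mem_Iic.1 hz.2).trans_lt hSS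
  rw [Real.coe_toNNReal _ (by positivity), Real.dist_eq]
  have h1 := hspace y.1 z.1 y.2 hy2
  have h2 := hspace z.1 y.1 y.2 hy2
  have h3 := abs_le.1 (htime z.1 y.2 hy2 z.2 hz2)
  rw [dist_comm] at h2
  have h4 : dist y.1 z.1 ≤ dist y z := by rw [Prod.dist_eq]; exact le_max_left _ _
  have h5 := abs_snd_sub_le y z
  have h6 : (K₁ + K₀) * dist y.1 z.1 ≤ (K₁ + K₀) * dist y z := by gcongr
  have h7 : (C₁ + C₂) * |y.2 - z.2| ≤ (C₁ + C₂) * dist y z := by gcongr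
  rw [abs_le]
  constructor <;> linarith

end HamiltonJacobi

/-! ### The upper envelope is a subsolution -/

namespace HamiltonJacobi

variable {X E : Type*} [MetricSpace X] [NormedAddCommGroup E] [InnerProductSpace ℝ E]
  {e : X → E} {T : X → Submodule ℝ E} {G : X → E → ℝ → ℝ} {L : ℝ}
  {u v b : X × ℝ → ℝ} {z : X × ℝ} {w w' : E} {a a' : ℝ}

/-- The difference of the two jets is a subjet of the zero function; testing it in opposite tangent
directions makes it vanish. -/
theorem SubJet.eq_of_supJet (hT : IsTangentField e T) (h : SubJet e u z w a)
    (h' : SupJet e u z w' a') : a' = a ∧ ∀ k ∈ T z.1, ⟪w' - w, k⟫ = 0 := by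
  have hj : SubJet e (fun _ => (0 : ℝ)) z (w - w') (a - a') := by
    intro ε hε
    filter_upwards [h (ε / 2) (half_pos hε), supJet_iff.1 h' (ε / 2) (half_pos hε)] with y h1 h2
    rw [inner_sub_left]
    linarith
  have key : ∀ k ∈ T z.1, ∀ σ, ⟪w - w', k⟫ + (a - a') * σ ≤ 0 := fun k hk σ => by
    obtain ⟨c, hc⟩ := hT.curve z.1 k hk
    exact hj.le_of_curve hT.isometry hc (k := fun _ => 0) tendsto_const_nhds
      (Eventually.of_forall fun τ => by simp)
  have h1 := key 0 (zero_mem _) 1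
  have h2 := key 0 (zero_mem _) (-1)
  simp only [inner_zero_right] at h1 h2
  refine ⟨by linarith, fun k hk => ?_⟩
  have h3 := key k hk 0
  have h4 := key (-k) (neg_mem hk) 0
  rw [inner_neg_right] at h4
  rw [← neg_sub, inner_neg_left]
  linarith

variable {f : X → ℝ} {K₀ : ℝ≥0} {C Λ : ℝ}

/-- The upper envelope of Perron's class. -/
noncomputable def perronSup (e : X → E) (G : X → E → ℝ → ℝ) (f : X → ℝ) (C Λ : ℝ) (z : X × ℝ) : ℝ :=
  ⨆ v : {v // IsPerronSub e G f C Λ v}, v.1 z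

theorem IsPerronSub.le_perronSup (hv : IsPerronSub e G f C Λ v) (z : X × ℝ) :
    v z ≤ perronSup e G f C Λ z :=
  le_ciSup (f := fun v : {v // IsPerronSub e G f C Λ v} => v.1 z)
    ⟨_, by rintro _ ⟨v, rfl⟩; exact v.2.upper z⟩ ⟨v, hv⟩

variable [CompactSpace X] [FiniteDimensional ℝ E]

/-- Delayed copies of members belong to the class, so the envelope is monotone with `C` where its
members only have `C + 1`. This slack leaves room for the bump in `subJet_perronSup`. For the
subsolution property, a superjet of the envelope is perturbed to superjets of a member that is
almost maximal at `z`. -/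
theorem isPerronSub_perronSup (hT : IsTangentField e T) (hG : IsHamiltonian T G L)
    (hB : BarrierData T G L f K₀ C Λ) :
    IsPerronSub e G f C Λ (perronSup e G f C Λ) ∧
      (∀ S, ∃ K : ℝ≥0, LipschitzOnWith K (perronSup e G f C Λ) (univ ×ˢ Iic S)) ∧
      ∀ x s t, s ≤ t → perronSup e G f C Λ (x, s) + C / Λ * Real.exp (Λ * s) ≤
        perronSup e G f C Λ (x, t) + C / Λ * Real.exp (Λ * t) := by
  have hl := isPerronSub_lower hT hG hB
  have : Nonempty {v // IsPerronSub e G f C Λ v} := ⟨⟨_, hl⟩⟩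
  have hle : ∀ z c, (∀ v, IsPerronSub e G f C Λ v → v z ≤ c) → perronSup e G f C Λ z ≤ c :=
    fun z c h => ciSup_le fun v => h v.1 v.2
  have hlip : ∀ S, ∃ K : ℝ≥0, LipschitzOnWith K (perronSup e G f C Λ) (univ ×ˢ Iic S) := fun S => by
    obtain ⟨K, hK⟩ := exists_lipschitzOnWith_isPerronSub hT hG hB S
    refine ⟨K, LipschitzOnWith.of_le_add_mul _ fun y hy z hz => hle _ _ fun v hv => ?_⟩
    have h1 := (le_abs_self _).trans ((hK v hv).dist_le_mul y hy z hz)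
    have h2 := hv.le_perronSup z
    linarith
  have hcont : Continuous (perronSup e G f C Λ) := continuous_iff_continuousAt.2 fun z => by
    obtain ⟨K, hK⟩ := hlip (z.2 + 1)
    refine hK.continuousOn.continuousAt (prod_mem_nhds univ_mem (Iic_mem_nhds (by linarith)))
  have hmono : ∀ x s t, s ≤ t → perronSup e G f C Λ (x, s) + C / Λ * Real.exp (Λ * s) ≤
        perronSup e G f C Λ (x, t) + C / Λ * Real.exp (Λ * t) := fun x s t hst => by
    rw [← le_sub_iff_add_le]
    refine hle _ _ fun v hv => ?_
    have h1 := (hv.delay hT hG hB (sub_nonneg.2 hst)).le_perronSup (x, t)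
    have h2 := (le_max_right _ _).trans h1
    simp only at h2
    rw [show t + -(t - s) = s by ring] at h2
    linarith
  refine ⟨⟨hcont, hl.le_perronSup, fun z => hle _ _ fun v hv => hv.upper z, fun x s t hst => ?_, ?_⟩,
    hlip, hmono⟩
  · have h1 := hmono x s t hst
    have hΛ := hB.pos
    have h2 : Real.exp (Λ * s) ≤ Real.exp (Λ * t) := Real.exp_le_exp.2 (by gcongr)
    have h3 := mul_le_mul_of_nonneg_left h2 (by positivity : 0 ≤ 1 / Λ)
    rw [add_div, add_mul, add_mul]
    linarith
  · intro z p a hz hj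
    refine le_zero_of_approx hG.cont fun δ hδ => ?_
    obtain ⟨κ, hκ⟩ : ∃ κ, κ = δ / 5 := ⟨_, rfl⟩
    have hκ0 : 0 < κ := by rw [hκ]; positivity
    obtain ⟨ρ₀, hρ₀, hnear⟩ := SubJet.exists_near hT.isometry hj hκ0
    obtain ⟨ρ₁, hρ₁, hc1⟩ := Metric.continuousAt_iff.1 (hcont.continuousAt (x := z)) δ hδ
    have hD : 0 < κ / 4 + (‖-p‖ + |(-a)|) := by positivity
    obtain ⟨ρ, hρ, hρlt⟩ : ∃ ρ > 0, ρ < min (min ρ₀ z.2)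
        (min (min ρ₁ δ) (δ / (κ / 4 + (‖-p‖ + |(-a)|)))) := exists_between (by positivity)
    simp only [lt_min_iff] at hρlt
    obtain ⟨⟨hρ1, hρ2⟩, ⟨hρ3, hρ4⟩, hρ5⟩ := hρlt
    rw [lt_div_iff₀ hD] at hρ5
    obtain ⟨⟨v, hv⟩, hvz⟩ := exists_lt_of_lt_ciSup
      (show perronSup e G f C Λ z - κ * ρ / 4 < ⨆ v : {v // IsPerronSub e G f C Λ v}, v.1 z by
        change _ < perronSup e G f C Λ z
        have : 0 < κ * ρ := by positivity
        linarith)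
    simp only at hvz
    obtain ⟨y, w', a', hyd, hw', ha', hj', hvy⟩ := hnear ρ hρ hρ1.le (fun y => -v y)
      (hv.cont.neg.lowerSemicontinuous.lowerSemicontinuousOn _) (fun y _ => by
        have := hv.le_perronSup y
        have : 0 < κ * ρ := by positivity
        linarith) (by linarith)
    have hj'' : SupJet e v y (-w') (-a') := by simpa only [SupJet, neg_neg] using hj'
    have hy0 : 0 < y.2 := by
      have := (abs_lt.1 ((abs_snd_sub_le y z).trans_lt hyd)).1
      linarith
    have h4κ : 4 * κ < δ := by rw [hκ]; linarith
    refine ⟨y.1, -w', -a', v y, ?_, ?_, ?_, ?_, (hv.sub y _ _ hy0 hj'').trans hδ.le⟩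
    · have : dist y.1 z.1 ≤ dist y z := by rw [Prod.dist_eq]; exact le_max_left _ _
      linarith
    · rw [← norm_neg, neg_sub, sub_neg_eq_add, add_comm, ← sub_neg_eq_add]; linarith
    · rw [← abs_neg, neg_sub, sub_neg_eq_add, add_comm, ← sub_neg_eq_add]; linarith
    · have h1 := hv.le_perronSup y
      have h2 := (abs_lt.1 (hc1 (hyd.trans hρ3))).2
      rw [abs_lt]
      constructor <;> linarith

end HamiltonJacobi

/-! ### The upper envelope is a supersolution; solutions for Lipschitz data -/

namespace HamiltonJacobi

variable {X E : Type*} [MetricSpace X] [NormedAddCommGroup E] [InnerProductSpace ℝ E]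
  {e : X → E} {T : X → Submodule ℝ E} {G : X → E → ℝ → ℝ} {L : ℝ}
  {u v b : X × ℝ → ℝ} {z : X × ℝ} {w w' : E} {a a' : ℝ}
  {f : X → ℝ} {K₀ : ℝ≥0} {C Λ : ℝ} [CompactSpace X] [FiniteDimensional ℝ E]

/-- Perron's bump argument: if the inequality fails at `z`, raising the envelope by a small
paraboloid gives a larger member of the class. The bump stays under the upper barrier because
contact with the barrier at `z` would give the inequality, it respects the monotonicity because of
the slack between `C` and `C + 1`, and it is a strict subsolution by continuity of `G`. -/
theorem subJet_perronSup (hT : IsTangentField e T) (hG : IsHamiltonian T G L)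
    (hB : BarrierData T G L f K₀ C Λ) {p : E} (hz : 0 < z.2)
    (hj : SubJet e (perronSup e G f C Λ) z p a) : 0 ≤ a + G z.1 p (perronSup e G f C Λ z) := by
  by_contra! hcon
  have he := hT.isometry
  have hΛ := hB.pos
  obtain ⟨hP, -, hmono⟩ := isPerronSub_perronSup hT hG hB
  have hmax := fun v (hv : IsPerronSub e G f C Λ v) => hv.le_perronSup (z := z)
  generalize perronSup e G f C Λ = W at hP hmono hmax hj hcon
  -- the envelope is strictly below the upper barrier
  have hup : W z < f z.1 + barrier C Λ z.2 := by
    refine lt_of_le_of_ne (hP.upper z) fun h => ?_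
    have hj1 := hj.congr_of_le (v := fun y => f y.1 + barrier C Λ y.2)
      (Eventually.of_forall hP.upper) h
    have h1 : a = C + Λ * barrier C Λ z.2 :=
      hj1.time_eq hT ((hasDerivAt_barrier hΛ hz).const_add (f z.1))
    have h2 : ∀ h ∈ T z.1, ⟪p, h⟫ ≤ K₀ * ‖h‖ := fun h hh =>
      hj1.inner_le hT (Eventually.of_forall fun y => by
        have := (le_abs_self _).trans (hB.lip.dist_le_mul y z.1)
        linarith) hh
    have h3 := (neg_le_abs _).trans (hB.bound_add hG h2 z.2 1 (by simp))
    rw [one_mul, ← h] at h3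
    linarith
  -- a lower bound on the time derivative
  have hΛE : 0 < Real.exp (Λ * z.2) := Real.exp_pos _
  have ha : -(C * Real.exp (Λ * z.2)) ≤ a := by
    have hd : HasDerivAt (fun t => C / Λ * Real.exp (Λ * t)) (C * Real.exp (Λ * z.2)) z.2 := by
      have h1 := (((hasDerivAt_id z.2).const_mul Λ).exp).const_mul (C / Λ)
      refine h1.congr_deriv ?_
      simp only [id]
      field_simp
    have h1 := (hj.add_time hd).time_le hT (σ := -1) (k := fun _ => 0) tendsto_const_nhds (by
      filter_upwards [self_mem_nhdsWithin] with τ hτ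
      have hτ : 0 < τ := hτ
      have := hmono z.1 (z.2 + τ * -1) z.2 (by linarith)
      simpa using this)
    linarith
  -- the choice of the scales
  obtain ⟨γ, hγ⟩ : ∃ γ, γ = (f z.1 + barrier C Λ z.2 - W z) / 2 := ⟨_, rfl⟩
  have hγ0 : 0 < γ := by rw [hγ]; linarith
  have hΦ : Continuous fun q : X × E × ℝ × ℝ => q.2.2.1 + G q.1 q.2.1 q.2.2.2 :=
    Continuous.add (by fun_prop)
      (hG.cont.comp (f := fun q : X × E × ℝ × ℝ => (q.1, q.2.1, q.2.2.2)) (by fun_prop))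
  obtain ⟨μ, hμ, hΦμ⟩ := Metric.eventually_nhds_iff.1
    ((hΦ.tendsto (z.1, p, a, W z)).eventually (gt_mem_nhds hcon))
  have hU : Continuous fun y : X × ℝ => f y.1 + barrier C Λ y.2 :=
    (hB.lip.continuous.comp continuous_fst).add (continuous_barrier.comp continuous_snd)
  obtain ⟨μ₂, hμ₂, hUμ⟩ := Metric.eventually_nhds_iff.1
    ((hU.tendsto z).eventually (lt_mem_nhds (show W z + γ < f z.1 + barrier C Λ z.2 by
      rw [hγ]; linarith)))
  have hEc : Continuous fun s => (C + 1) * Real.exp (Λ * s) + a := by fun_prop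
  obtain ⟨μ₃, hμ₃, hEμ⟩ := Metric.eventually_nhds_iff.1
    ((hEc.tendsto z.2).eventually (lt_mem_nhds
      (show Real.exp (Λ * z.2) / 2 < (C + 1) * Real.exp (Λ * z.2) + a by linarith)))
  obtain ⟨κ, hκ0, hκlt⟩ : ∃ κ > 0, κ < min (μ / 8) (Real.exp (Λ * z.2) / 16) :=
    exists_between (by positivity)
  rw [lt_min_iff] at hκlt
  obtain ⟨ρ₀, hρ₀, hb⟩ := Metric.eventually_nhds_iff.1 (hj κ hκ0)
  have hD : 0 < ‖p‖ + |a| + 5 * κ := by positivity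
  obtain ⟨ρ, hρ, hρlt⟩ : ∃ ρ > 0, ρ < min (min (min ρ₀ z.2) (min μ₂ μ₃))
      (min μ (min μ γ / (‖p‖ + |a| + 5 * κ))) := exists_between (by positivity)
  simp only [lt_min_iff] at hρlt
  obtain ⟨⟨⟨hρ1, hρ2⟩, hρ3, hρ4⟩, hρ5, hρ6⟩ := hρlt
  rw [lt_div_iff₀ hD, lt_min_iff] at hρ6
  have hκρ : 0 < κ * ρ := by positivity
  obtain ⟨A, hA⟩ : ∃ A, A = 2 * κ / ρ := ⟨_, rfl⟩
  have hA0 : 0 ≤ A := by rw [hA]; positivity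
  have hAρ : A * ρ = 2 * κ := by rw [hA]; field_simp
  -- the bump
  obtain ⟨ψ, hψ⟩ : ∃ ψ : X × ℝ → ℝ, ∀ y, ψ y = W z + κ * ρ / 2 + ⟪p, e y.1 - e z.1⟫ +
    a * (y.2 - z.2) - A * sqDist y z := ⟨_, fun _ => rfl⟩
  have hψc : Continuous ψ := by
    rw [funext hψ]
    have := he.continuous
    unfold sqDist
    fun_prop
  have hsph : ∀ y, dist y z = ρ → ψ y < W y := fun y hy => by
    have h1 := hb (show dist y z < ρ₀ by linarith)
    have h2 := mul_le_mul_of_nonneg_left (dist_sq_le_sqDist y z) hA0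
    rw [hy] at h1 h2
    have h3 : A * ρ ^ 2 = 2 * (κ * ρ) := by rw [pow_two, ← mul_assoc, hAρ]; ring
    rw [hψ]
    linarith
  have hψb : ∀ y, dist y z ≤ ρ → |ψ y - W z| ≤ (‖p‖ + |a| + 5 * κ) * ρ := fun y hy => by
    have h1 := (norm_fst_sub_le he y z).trans hy
    have h2 := (abs_snd_sub_le y z).trans hy
    have h3 : |⟪p, e y.1 - e z.1⟫| ≤ ‖p‖ * ρ :=
      (abs_real_inner_le_norm _ _).trans (by gcongr)
    have h4 : |a * (y.2 - z.2)| ≤ |a| * ρ := by rw [abs_mul]; gcongr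
    have h5 : sqDist y z ≤ ρ ^ 2 + ρ ^ 2 := by
      unfold sqDist
      rw [← he.dist_eq, dist_eq_norm, ← sq_abs (y.2 - z.2)]
      gcongr
    have h6 : A * sqDist y z ≤ 4 * (κ * ρ) := by
      refine (mul_le_mul_of_nonneg_left h5 hA0).trans_eq ?_
      rw [← two_mul, pow_two, ← mul_assoc, ← mul_assoc, mul_comm A, mul_assoc 2, hAρ]; ring
    have h7 := mul_nonneg hA0 (sqDist_nonneg y z)
    rw [hψ]
    rw [abs_le] at h3 h4 ⊢
    constructor <;> linarith [h3.1, h3.2, h4.1, h4.2]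
  obtain ⟨v, hv⟩ : ∃ v : X × ℝ → ℝ, ∀ y, v y = if dist y z ≤ ρ then max (W y) (ψ y) else W y :=
    ⟨_, fun _ => rfl⟩
  have hvW : ∀ y, W y ≤ v y := fun y => by
    rw [hv]; split_ifs
    · exact le_max_left _ _
    · exact le_rfl
  have hvψ : ∀ y, dist y z ≤ ρ → ψ y ≤ v y := fun y hy => by
    rw [hv, if_pos hy]; exact le_max_right _ _
  have hvcase : ∀ y, v y = W y ∨ (v y = ψ y ∧ dist y z < ρ) := fun y => by
    by_cases hy : dist y z ≤ ρ
    · rcases max_choice (W y) (ψ y) with h | h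
      · left; rw [hv, if_pos hy, h]
      · rcases hy.eq_or_lt with hy' | hy'
        · left; rw [hv, if_pos hy, max_eq_left (hsph y hy').le]
        · right; exact ⟨by rw [hv, if_pos hy, h], hy'⟩
    · left; rw [hv, if_neg hy]
  -- monotonicity of the bump in time
  have hψmono : ∀ x s t, s ≤ t → dist (x, s) z ≤ ρ → dist (x, t) z ≤ ρ →
      ψ (x, s) + (C + 1) / Λ * Real.exp (Λ * s) ≤ ψ (x, t) + (C + 1) / Λ * Real.exp (Λ * t) := by
    intro x s t hst hs ht
    have hs2 := abs_le.1 ((abs_snd_sub_le (x, s) z).trans hs)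
    have ht2 := abs_le.1 ((abs_snd_sub_le (x, t) z).trans ht)
    simp only at hs2 ht2
    have h1 := hEμ (show dist s z.2 < μ₃ by
      rw [Real.dist_eq]; exact ((abs_snd_sub_le (x, s) z).trans hs).trans_lt hρ4)
    have h2 : Real.exp (Λ * s) * (Λ * (t - s)) ≤ Real.exp (Λ * t) - Real.exp (Λ * s) := by
      have h3 : Real.exp (Λ * t) = Real.exp (Λ * s) * Real.exp (Λ * (t - s)) := by
        rw [← Real.exp_add]; ring_nf
      have h4 := Real.add_one_le_exp (Λ * (t - s))
      have h5 := Real.exp_pos (Λ * s)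
      rw [h3]
      nlinarith
    have h3 : 0 ≤ (C + 1) / Λ := by have := hB.nonneg; positivity
    have h4 := mul_le_mul_of_nonneg_left h2 h3
    have h5 : (C + 1) / Λ * (Real.exp (Λ * s) * (Λ * (t - s))) =
        (C + 1) * Real.exp (Λ * s) * (t - s) := by field_simp
    have h6 : ψ (x, t) - ψ (x, s) = (t - s) * (a - A * ((t - z.2) + (s - z.2))) := by
      rw [hψ, hψ, sqDist, sqDist]; ring
    have h7 : A * ((t - z.2) + (s - z.2)) ≤ A * (2 * ρ) := by gcongr; linarith
    have h8 : 0 ≤ (t - s) * (a - A * ((t - z.2) + (s - z.2)) + (C + 1) * Real.exp (Λ * s)) :=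
      mul_nonneg (sub_nonneg.2 hst) (by linarith)
    linarith
  have hP' : IsPerronSub e G f C Λ v := by
    refine ⟨?_, fun y => (hP.lower y).trans (hvW y), fun y => ?_, fun x s t hst => ?_, ?_⟩
    · rw [funext hv]
      refine Continuous.if_le (hP.cont.max hψc) hP.cont (by fun_prop) continuous_const fun y hy => ?_
      exact max_eq_left (hsph y hy).le
    · rcases hvcase y with h | ⟨h, hy⟩
      · rw [h]; exact hP.upper y
      · have h1 := (le_abs_self _).trans (hψb y hy.le)
        have h2 := hUμ (hy.trans hρ3)
        rw [h]
        linarith [hρ6.2]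
    · rcases hvcase (x, s) with h | ⟨h, hs⟩
      · have h1 := hvW (x, t)
        have h2 := hP.mono x s t hst
        rw [h]; linarith
      · rw [h]
        by_cases ht : dist (x, t) z ≤ ρ
        · have h1 := hψmono x s t hst hs.le ht
          have h2 := hvψ _ ht
          linarith
        -- The product distance is a maximum, so moving forward in time leaves the ball through its
        -- top face. There the envelope is above the bump, and its own monotonicity takes over.
        · have hs' : max (dist x z.1) |s - z.2| < ρ := by rwa [Prod.dist_eq] at hs
          have ht' : ¬ max (dist x z.1) |t - z.2| ≤ ρ := by rwa [Prod.dist_eq] at ht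
          have hx := (le_max_left _ _).trans_lt hs'
          have hs'' := abs_lt.1 ((le_max_right _ _).trans_lt hs')
          have htρ : z.2 + ρ < t := by
            by_contra! hle
            exact ht' (max_le hx.le (abs_le.2 ⟨by linarith, by linarith⟩))
          have hm : dist (x, z.2 + ρ) z = ρ := by
            rw [Prod.dist_eq, Real.dist_eq]
            simp only [add_sub_cancel_left, abs_of_pos hρ]
            exact max_eq_right hx.le
          have h1 := hψmono x s (z.2 + ρ) (by linarith) hs.le hm.le
          have h2 := hsph _ hm
          have h3 := hP.mono x (z.2 + ρ) t htρ.le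
          have h4 := hvW (x, t)
          linarith
    · intro y w' a' hy0 hj'
      rcases hvcase y with h | ⟨h, hy⟩
      · rw [h]
        exact hP.sub y _ _ hy0 (hj'.congr_of_le (Eventually.of_forall hvW) h)
      · have hsup : SupJet e ψ y w' a' := hj'.congr_of_le (by
          filter_upwards [Metric.isOpen_ball.mem_nhds (Metric.mem_ball.2 hy)] with x hx
          exact hvψ x (Metric.mem_ball.1 hx).le) h
        have hsub : SubJet e ψ y (p - (2 * A) • (e y.1 - e z.1)) (a - 2 * A * (y.2 - z.2)) := by
          refine SubJet.of_touch he (hasFDerivAt_quadratic p (e z.1) (e y.1) A)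
            (hasDerivAt_quadratic a z.2 y.2 A) (Eventually.of_forall fun x => le_of_eq ?_)
          rw [hψ, hψ]
          simp only [sqDist, ← he.dist_eq, dist_eq_norm, inner_sub_right]
          ring
        obtain ⟨h1, h2⟩ := hsub.eq_of_supJet hT hsup
        rw [h, h1, hG.congr_of_inner_eq_zero h2]
        have hd1 := norm_fst_sub_le he y z
        have hd2 := abs_snd_sub_le y z
        have hAd : 2 * A * dist y z ≤ 4 * κ := by
          have : A * dist y z ≤ A * ρ := by gcongr
          linarith
        refine (hΦμ (y := (y.1, p - (2 * A) • (e y.1 - e z.1), a - 2 * A * (y.2 - z.2), ψ y)) ?_).le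
        simp only [Prod.dist_eq, max_lt_iff]
        refine ⟨?_, ?_, ?_, ?_⟩
        · have : dist y.1 z.1 ≤ dist y z := by rw [Prod.dist_eq]; exact le_max_left _ _
          linarith
        · rw [dist_eq_norm, sub_sub_cancel_left, norm_neg, norm_smul, Real.norm_eq_abs,
            abs_of_nonneg (by positivity)]
          have : 2 * A * ‖e y.1 - e z.1‖ ≤ 2 * A * dist y z := by gcongr
          linarith
        · rw [Real.dist_eq, sub_sub_cancel_left, abs_neg, abs_mul,
            abs_of_nonneg (by positivity : 0 ≤ 2 * A)]
          have : 2 * A * |y.2 - z.2| ≤ 2 * A * dist y z := by gcongr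
          linarith
        · rw [Real.dist_eq]
          have := hψb y hy.le
          linarith [hρ6.1]
  have h1 := hmax v hP'
  have h2 := hvψ z (by rw [dist_self]; exact hρ.le)
  rw [hψ, sub_self, inner_zero_right, sub_self, sqDist_self] at h2
  linarith

/-- The Cauchy problem with Lipschitz initial datum has a locally Lipschitz solution. -/
theorem exists_lipschitz_solution (hT : IsTangentField e T) (hG : IsHamiltonian T G L)
    (hf : LipschitzWith K₀ f) : ∃ u : X × ℝ → ℝ,
      (∀ x, ∀ t ≤ 0, u (x, t) = f x) ∧
      (∀ S, ∃ K : ℝ≥0, LipschitzOnWith K u (univ ×ˢ Iic S)) ∧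
      (∀ z w a, 0 < z.2 → SupJet e u z w a → a + G z.1 w (u z) ≤ 0) ∧
      (∀ z w a, 0 < z.2 → SubJet e u z w a → a + G z.1 w (u z) = 0) := by
  obtain ⟨F, hF⟩ := isCompact_univ.exists_bound_of_continuousOn hf.continuous.continuousOn
  obtain ⟨C, hC, hCb⟩ := hG.exists_abs_le K₀ F
  have hB : BarrierData T G L f K₀ C (L + 1) := ⟨hf, hC, by linarith [hG.nonneg], by linarith,
    fun x w hw => hCb x w (f x) hw (hF x (mem_univ x))⟩
  obtain ⟨hP, hlip, -⟩ := isPerronSub_perronSup hT hG hB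
  refine ⟨perronSup e G f C (L + 1), fun x t ht => hP.eq_of_nonpos (z := (x, t)) ht, hlip, hP.sub,
    fun z w a hz hj => le_antisymm ?_ (subJet_perronSup hT hG hB hz hj)⟩
  obtain ⟨K, hK⟩ := hlip (z.2 + z.2)
  exact subJet_le_of_supJet_le hT hG hz (hK.mono (prod_mono le_rfl Icc_subset_Iic_self))
    (fun y w a hy => hP.sub y w a (by linarith [hy.1])) hj

end HamiltonJacobi

/-! ### Truncations and the comparison of semicontinuous solutions -/

namespace HamiltonJacobi

/-- The real-valued truncation `min u N` of an extended real function on `X × [0, ∞)`, extended to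
negative times by its initial value. -/
noncomputable def trunc {X : Type*} (N : ℝ) (u : X × ℝ≥0 → EReal) (z : X × ℝ) : ℝ :=
  (min (u (z.1, z.2.toNNReal)) N).toReal

section Trunc

variable {X : Type*} {u : X × ℝ≥0 → EReal} {N : ℝ}

theorem coe_trunc (hu : ∀ z, u z ≠ ⊥) (N : ℝ) (z : X × ℝ) :
    (trunc N u z : EReal) = min (u (z.1, z.2.toNNReal)) N := by
  refine EReal.coe_toReal ?_ ?_
  · exact ((min_le_right _ _).trans_lt (EReal.coe_lt_top N)).ne
  · rcases min_choice (u (z.1, z.2.toNNReal)) N with h | h <;> rw [h]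
    · exact hu _
    · exact EReal.coe_ne_bot N

theorem coe_trunc_le (hu : ∀ z, u z ≠ ⊥) (N : ℝ) (z : X × ℝ) :
    (trunc N u z : EReal) ≤ u (z.1, z.2.toNNReal) := by
  rw [coe_trunc hu]; exact min_le_left _ _

theorem trunc_le (hu : ∀ z, u z ≠ ⊥) (N : ℝ) (z : X × ℝ) : trunc N u z ≤ N := by
  rw [← EReal.coe_le_coe_iff, coe_trunc hu]; exact min_le_right _ _

theorem coe_trunc_of_lt (hu : ∀ z, u z ≠ ⊥) {z : X × ℝ} (h : trunc N u z < N) :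
    (trunc N u z : EReal) = u (z.1, z.2.toNNReal) := by
  rw [← EReal.coe_lt_coe_iff, coe_trunc hu, min_lt_iff] at h
  rw [coe_trunc hu, min_eq_left (h.resolve_right (lt_irrefl _)).le]

theorem lt_trunc (hu : ∀ z, u z ≠ ⊥) {z : X × ℝ} {c : ℝ} (h1 : c < N)
    (h2 : (c : EReal) < u (z.1, z.2.toNNReal)) : c < trunc N u z := by
  rw [← EReal.coe_lt_coe_iff, coe_trunc hu]
  exact lt_min h2 (EReal.coe_lt_coe_iff.2 h1)

theorem le_trunc (hu : ∀ z, u z ≠ ⊥) {z : X × ℝ} {c : ℝ} (h1 : c ≤ N)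
    (h2 : (c : EReal) ≤ u (z.1, z.2.toNNReal)) : c ≤ trunc N u z := by
  rw [← EReal.coe_le_coe_iff, coe_trunc hu]
  exact le_min h2 (EReal.coe_le_coe_iff.2 h1)

theorem trunc_eq_of_le (hu : ∀ z, u z ≠ ⊥) {z : X × ℝ} {c : ℝ} (h1 : c ≤ N)
    (h2 : u (z.1, z.2.toNNReal) = c) : trunc N u z = c := by
  refine le_antisymm ?_ (le_trunc hu h1 h2.ge)
  rw [← EReal.coe_le_coe_iff, ← h2]
  exact coe_trunc_le hu N z

theorem lowerSemicontinuous_trunc [TopologicalSpace X] (hu : IsLSC u) (N : ℝ) :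
    LowerSemicontinuous (trunc N u) := fun z c hc => by
  have hc : c < trunc N u z := hc
  have h1 : (c : EReal) < u (z.1, z.2.toNNReal) :=
    (EReal.coe_lt_coe_iff.2 hc).trans_le (coe_trunc_le hu.ne_bot N z)
  have h2 : Tendsto (fun y : X × ℝ => (y.1, y.2.toNNReal)) (𝓝 z) (𝓝 (z.1, z.2.toNNReal)) :=
    (continuous_fst.prodMk (continuous_real_toNNReal.comp continuous_snd)).tendsto z
  filter_upwards [h2.eventually (hu.lsc _ _ h1)] with y hy
  exact lt_trunc hu.ne_bot (hc.trans_le (trunc_le hu.ne_bot N z)) hy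

end Trunc

variable {X E : Type*} [MetricSpace X] [NormedAddCommGroup E] [InnerProductSpace ℝ E]
  {e : X → E} {T : X → Submodule ℝ E} {G : X → E → ℝ → ℝ} {L : ℝ}
  {u v : X × ℝ≥0 → EReal} {φ : X → EReal}

/-- Subsolutions in terms of the subjets of the truncations. -/
def IsJetSubsol (e : X → E) (G : X → E → ℝ → ℝ) (u : X × ℝ≥0 → EReal) : Prop :=
  ∀ N z w a, 0 < z.2 → trunc N u z < N → SubJet e (trunc N u) z w a →
    a + G z.1 w (trunc N u z) ≤ 0

/-- Supersolutions in terms of the subjets of the truncations. -/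
def IsJetSupersol (e : X → E) (G : X → E → ℝ → ℝ) (u : X × ℝ≥0 → EReal) : Prop :=
  ∀ N z w a, 0 < z.2 → trunc N u z < N → SubJet e (trunc N u) z w a →
    0 ≤ a + G z.1 w (trunc N u z)

variable [CompactSpace X]

/-- On a compact space the cone `k · diam · dist` dominates `k · dist²`, so the paraboloid lying
below a truncation of `φ` can be replaced by a Lipschitz function. -/
theorem exists_lipschitz_lt (hφ : IsLSC φ) {x₀ : X} {c : ℝ} (hc : (c : EReal) < φ x₀) :
    ∃ (K : ℝ≥0) (f : X → ℝ), LipschitzWith K f ∧ f x₀ = c ∧ (∀ x, f x ≤ c) ∧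
      ∀ x, (f x : EReal) < φ x := by
  have hl := lowerSemicontinuous_trunc (u := fun z : X × ℝ≥0 => φ z.1)
    ⟨hφ.lsc.comp continuous_fst, fun z => hφ.ne_bot _⟩ (c + 1)
  have hb : ∀ z : X × ℝ≥0, φ z.1 ≠ ⊥ := fun z => hφ.ne_bot _
  obtain ⟨k, hk, hlt⟩ := exists_lt_add_sq_dist (f := fun x => trunc (c + 1) (fun z => φ z.1) (x, 0))
    (hl.comp (by fun_prop)) (x := x₀) (c := c) (lt_trunc hb (by linarith) hc)
  have hD : ∀ x, dist x x₀ ≤ Metric.diam (univ : Set X) := fun x =>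
    Metric.dist_le_diam_of_mem isCompact_univ.isBounded (mem_univ _) (mem_univ _)
  have hD0 : 0 ≤ Metric.diam (univ : Set X) := Metric.diam_nonneg
  refine ⟨(k * Metric.diam (univ : Set X)).toNNReal,
    fun x => c - k * Metric.diam (univ : Set X) * dist x x₀, ?_, by simp, fun x => ?_, fun x => ?_⟩
  · refine LipschitzWith.of_dist_le_mul fun x y => ?_
    rw [Real.coe_toNNReal _ (by positivity), Real.dist_eq, sub_sub_sub_cancel_left, ← mul_sub,
      abs_mul, abs_of_nonneg (by positivity)]
    gcongr
    rw [abs_sub_comm]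
    exact abs_dist_sub_le _ _ _
  · have : 0 ≤ k * Metric.diam (univ : Set X) * dist x x₀ := by positivity
    linarith
  · refine lt_of_lt_of_le ?_ (coe_trunc_le hb (c + 1) (x, 0))
    rw [EReal.coe_lt_coe_iff]
    have h1 := hlt x
    have h2 : k * dist x x₀ ^ 2 ≤ k * Metric.diam (univ : Set X) * dist x x₀ := by
      rw [pow_two, ← mul_assoc]; gcongr; exact hD x
    linarith

/-- Comparison of lower semicontinuous sub- and supersolutions with the same initial values. -/
theorem le_of_isJetSubsol_of_isJetSupersol [FiniteDimensional ℝ E] (hT : IsTangentField e T)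
    (hG : IsHamiltonian T G L) (hv : IsLSC v) (hu : IsLSC u) (hv' : IsJetSubsol e G v)
    (hu' : IsJetSupersol e G u) (hvφ : ∀ x, v (x, 0) = φ x) (huφ : ∀ x, u (x, 0) = φ x)
    (hlim : ∀ x, liminf (fun t : ℝ≥0 => v (x, t)) (𝓝[>] 0) = φ x) (x₀ : X) (t₀ : ℝ≥0) :
    v (x₀, t₀) ≤ u (x₀, t₀) := by
  by_contra! hcon
  have ht₀ : 0 < (t₀ : ℝ) := by
    rw [NNReal.coe_pos]
    refine pos_iff_ne_zero.2 fun h => ?_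
    rw [h, hvφ, huφ] at hcon
    exact lt_irrefl _ hcon
  obtain ⟨c, hc1, hc2⟩ := EReal.lt_iff_exists_real_btwn.1 hcon
  obtain ⟨c', hc'1, hc'2⟩ := EReal.lt_iff_exists_real_btwn.1 hc1
  rw [EReal.coe_lt_coe_iff] at hc'2
  obtain ⟨K₀, f, hf, hfx, hfc, hflt⟩ := exists_lipschitz_lt (φ := fun x => v (x, t₀))
    ⟨hv.lsc.comp (by fun_prop), fun x => hv.ne_bot _⟩ hc2
  -- The equality `hwsub` at subjets of `w` is equality at superjets of `-w`. One inequality serves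
  -- the backward comparison and the other the forward one.
  obtain ⟨w, hw0, hwlip, -, hwsub⟩ := exists_lipschitz_solution hT hG.reflect hf.neg
  obtain ⟨K, hK⟩ := hwlip (t₀ + 1)
  have hcomp : IsCompact ((univ : Set X) ×ˢ Icc 0 ((t₀ : ℝ) + 1)) :=
    isCompact_univ.prod isCompact_Icc
  obtain ⟨R, hR⟩ := hcomp.exists_bound_of_continuousOn
    (hK.continuousOn.mono (prod_mono le_rfl Icc_subset_Iic_self))
  obtain ⟨N, hN⟩ : ∃ N, N = |R| + |c| + 1 := ⟨_, rfl⟩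
  have hcN : c < N := by rw [hN]; linarith [le_abs_self c, abs_nonneg R]
  have hwN : ∀ z : X × ℝ, z.2 ∈ Icc 0 ((t₀ : ℝ) + 1) → -w z ≤ N := fun z hz => by
    have := (neg_le_abs _).trans (hR z ⟨mem_univ _, hz⟩)
    rw [hN]; linarith [le_abs_self R, abs_nonneg c]
  have hvl := lowerSemicontinuous_trunc hv N
  have hul := lowerSemicontinuous_trunc hu N
  -- the datum stays below `v` for times close to `t₀`
  have htube : ∀ᶠ s in 𝓝 (t₀ : ℝ), ∀ x ∈ (univ : Set X), f x ≤ trunc N v (x, s) := by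
    refine isCompact_univ.eventually_forall_of_forall_eventually fun x _ => ?_
    have h1 : f x < trunc N v (x, (t₀ : ℝ)) :=
      lt_trunc hv.ne_bot ((hfc x).trans_lt hcN) (by simpa using hflt x)
    obtain ⟨r, hr1, hr2⟩ := exists_between h1
    have h2 := hvl _ _ hr2
    have h3 : ∀ᶠ y : X × ℝ in 𝓝 (x, (t₀ : ℝ)), f y.1 < r :=
      ((hf.continuous.comp continuous_fst).tendsto _).eventually (gt_mem_nhds hr1)
    have h4 : ∀ᶠ y : X × ℝ in 𝓝 (x, (t₀ : ℝ)), f y.1 ≤ trunc N v (y.1, y.2) := by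
      filter_upwards [h2, h3] with y h5 h6
      exact (h6.trans h5).le
    exact (continuous_swap.tendsto ((t₀ : ℝ), x)).eventually h4
  -- `comparison` reaches only times before its end point, yet has to be evaluated at `t₀`. Hence
  -- `τ` lies beyond `t₀`, so close that `f` is still below `v` at time `τ` and the Lipschitz loss
  -- is less than `c - c'`.
  obtain ⟨τ, ⟨hτ0, hτ1⟩, hτf, hτK⟩ : ∃ τ ∈ Ioo (t₀ : ℝ) (t₀ + 1),
      (∀ x ∈ (univ : Set X), f x ≤ trunc N v (x, τ)) ∧ K * (τ - t₀) < c - c' := by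
    have h1 : Tendsto (fun τ : ℝ => K * (τ - t₀)) (𝓝[>] (t₀ : ℝ)) (𝓝 (K * (t₀ - t₀))) :=
      (Continuous.tendsto (by fun_prop) _).mono_left nhdsWithin_le_nhds
    rw [sub_self, mul_zero] at h1
    have h0 : ∀ᶠ τ in 𝓝[>] (t₀ : ℝ), τ ∈ Ioo (t₀ : ℝ) (t₀ + 1) := Ioo_mem_nhdsGT (by linarith)
    obtain ⟨τ, h2, h3, h4⟩ := (h0.and ((htube.filter_mono nhdsWithin_le_nhds).and
        (h1.eventually (gt_mem_nhds (sub_pos.2 hc'2))))).exists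
    exact ⟨τ, h2, h3, h4⟩
  have hτpos : 0 < τ := ht₀.trans hτ0
  -- comparison backward in time
  have hback : ∀ x, ∀ t ∈ Ico 0 τ, -w (x, t) ≤ trunc N v (x, τ - t) := fun x t ht => by
    refine comparison (G := fun x w r => -G x w r) (b := fun z => -w z)
      (u := fun z => trunc N v (z.1, τ - z.2)) (N := N) (K := K) hT.isometry hG.cont.neg hG.nonneg
      (fun x w r r' => ?_) (hvl.comp (by fun_prop)) ?_ (fun z hz => hwN z ⟨hz.1, hz.2.trans hτ1.le⟩)
      (fun z p a hz hzN hj => ?_) (fun z p a hz hj => ?_) (fun x => ?_) x ht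
    · rw [neg_sub_neg, abs_sub_comm]; exact hG.lip x w r r'
    · exact (hK.mono (prod_mono le_rfl (Icc_subset_Iic_self.trans (Iic_subset_Iic.2 hτ1.le)))).neg
    · have := hv' N (z.1, τ - z.2) p (-a) (by simp only; linarith [hz.2]) hzN hj.comp_sub
      simp only at this
      linarith
    · have := hwsub z _ _ hz.1 (supJet_neg.1 hj)
      simp only [neg_neg] at this
      linarith
    · simp only [sub_zero]
      rw [hw0 x 0 le_rfl, Pi.neg_apply, neg_neg]
      exact hτf x (mem_univ x)
  have hwc : ∀ x, ContinuousOn (fun t => w (x, t)) (Iic ((t₀ : ℝ) + 1)) := fun x =>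
    hK.continuousOn.comp (by fun_prop) fun t ht => ⟨mem_univ _, ht⟩
  -- The liminf condition is indispensable here: lower semicontinuity at time `0` gives only the
  -- opposite inequality between `φ` and the values of `v` at positive times.
  have hinit : ∀ x, ((-w (x, τ) : ℝ) : EReal) ≤ φ x := fun x => by
    have h1 : Tendsto (fun t : ℝ≥0 => -w (x, τ - t)) (𝓝[>] 0) (𝓝 (-w (x, τ))) := by
      have h2 : ContinuousAt (fun t => w (x, t)) τ :=
        (hwc x).continuousAt (Iic_mem_nhds hτ1)
      have h3 : Tendsto (fun t : ℝ≥0 => τ - t) (𝓝[>] 0) (𝓝 τ) := by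
        have : Continuous fun t : ℝ≥0 => τ - t := by fun_prop
        simpa using (this.tendsto 0).mono_left nhdsWithin_le_nhds
      exact (h2.tendsto.comp h3).neg
    rw [← hlim x, ← ((continuous_coe_real_ereal.tendsto _).comp h1).liminf_eq]
    refine liminf_le_liminf ?_
    have h4 : ∀ᶠ t : ℝ≥0 in 𝓝[>] 0, t ∈ Ioo 0 τ.toNNReal :=
      Ioo_mem_nhdsGT (Real.toNNReal_pos.2 hτpos)
    filter_upwards [h4] with t ht
    have h5 : (t : ℝ) < τ := (Real.lt_toNNReal_iff_coe_lt).1 ht.2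
    have h6 : 0 < (t : ℝ) := ht.1
    have h7 := hback x (τ - t) ⟨by linarith, by linarith⟩
    rw [sub_sub_cancel] at h7
    refine (EReal.coe_le_coe_iff.2 h7).trans ((coe_trunc_le hv.ne_bot N (x, (t : ℝ))).trans_eq ?_)
    simp
  -- comparison forward in time
  have hforw : ∀ x, ∀ t ∈ Ico 0 τ, -w (x, τ - t) ≤ trunc N u (x, t) := fun x t ht => by
    refine comparison (G := G) (b := fun z => -w (z.1, τ - z.2)) (u := trunc N u) (N := N) (K := K)
      hT.isometry hG.cont hG.nonneg hG.lip hul ?_ (fun z hz => hwN _ ?_)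
      (fun z p a hz hzN hj => hu' N z p a hz.1 hzN hj) (fun z p a hz hj => ?_) (fun x => ?_) x ht
    · refine LipschitzOnWith.of_dist_le_mul fun y hy z hz => ?_
      have h1 := hK.dist_le_mul (y.1, τ - y.2) ⟨mem_univ _, by simp only [mem_Iic]; linarith [hy.2.1]⟩
        (z.1, τ - z.2) ⟨mem_univ _, by simp only [mem_Iic]; linarith [hz.2.1]⟩
      have h2 : dist (y.1, τ - y.2) (z.1, τ - z.2) = dist y z := by
        rw [Prod.dist_eq, Prod.dist_eq]
        simp only [dist_sub_left]
      rw [h2] at h1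
      rwa [dist_neg_neg]
    · exact ⟨by simp only; linarith [hz.2], by simp only; linarith [hz.1]⟩
    · have := hwsub (z.1, τ - z.2) _ _ (by simp only; linarith [hz.2])
        (SubJet.comp_sub (supJet_neg.1 hj))
      simp only [neg_neg] at this
      exact this.le
    · simp only [sub_zero]
      refine le_trunc hu.ne_bot (hwN _ ⟨hτpos.le, hτ1.le⟩) ?_
      simpa [huφ] using hinit x
  have h1 := hforw x₀ t₀ ⟨ht₀.le, hτ0⟩
  have h2 : (trunc N u (x₀, (t₀ : ℝ)) : EReal) < c' := by
    refine (coe_trunc_le hu.ne_bot N _).trans_lt ?_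
    simpa using hc'1
  rw [EReal.coe_lt_coe_iff] at h2
  have h3 := hK.dist_le_mul (x₀, τ - t₀) ⟨mem_univ _, by simp only [mem_Iic]; linarith⟩ (x₀, 0)
    ⟨mem_univ _, by simp only [mem_Iic]; linarith⟩
  rw [hw0 x₀ 0 le_rfl, Pi.neg_apply, hfx, Prod.dist_eq, Real.dist_eq, Real.dist_eq] at h3
  simp only [dist_self, sub_zero] at h3
  rw [max_eq_right (abs_nonneg _), abs_of_pos (sub_pos.2 hτ0)] at h3
  have h4 := (le_abs_self _).trans h3
  linarith

end HamiltonJacobi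

/-! ### Directed suprema, control of liminf in time, and existence -/

namespace HamiltonJacobi

variable {X E : Type*} [MetricSpace X] [NormedAddCommGroup E] [InnerProductSpace ℝ E]
  {e : X → E} {T : X → Submodule ℝ E} {G : X → E → ℝ → ℝ} {L : ℝ}
  {u : X × ℝ≥0 → EReal} {φ : X → EReal} {ι : Type*} {U : ι → X × ℝ → ℝ}

theorem toNNReal_pair {z : X × ℝ} (hz : 0 ≤ z.2) : (z.1, ((z.2.toNNReal : ℝ≥0) : ℝ)) = z := by
  rw [Real.coe_toNNReal _ hz]

theorem subJet_trunc_add {s : ℝ≥0} {N : ℝ} {z : X × ℝ} {w : E} {a : ℝ} (hz : 0 < z.2)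
    (hj : SubJet e (trunc N fun y : X × ℝ≥0 => u (y.1, s + y.2)) z w a) :
    trunc N (fun y : X × ℝ≥0 => u (y.1, s + y.2)) z = trunc N u (z.1, z.2 + s) ∧
      SubJet e (trunc N u) (z.1, z.2 + s) w a := by
  have h1 : ∀ y : X × ℝ, 0 < y.2 →
      trunc N (fun y : X × ℝ≥0 => u (y.1, s + y.2)) y = trunc N u (y.1, y.2 + s) := fun y hy => by
    simp only [trunc]
    rw [Real.toNNReal_add hy.le s.coe_nonneg, Real.toNNReal_coe, add_comm]
  refine ⟨h1 z hz, subJet_comp_add.1 (hj.congr_of_le ?_ (h1 z hz))⟩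
  filter_upwards [(continuous_snd.tendsto z).eventually (lt_mem_nhds hz)] with y hy
  exact (h1 y hy).le

theorem IsJetSubsol.comp_add (hu : IsJetSubsol e G u) (s : ℝ≥0) :
    IsJetSubsol e G fun y => u (y.1, s + y.2) := fun N z w a hz hN hj => by
  obtain ⟨h1, h2⟩ := subJet_trunc_add hz hj
  rw [h1] at hN ⊢
  exact hu N _ w a (by simp only; positivity) hN h2

theorem IsJetSupersol.comp_add (hu : IsJetSupersol e G u) (s : ℝ≥0) :
    IsJetSupersol e G fun y => u (y.1, s + y.2) := fun N z w a hz hN hj => by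
  obtain ⟨h1, h2⟩ := subJet_trunc_add hz hj
  rw [h1] at hN ⊢
  exact hu N _ w a (by simp only; positivity) hN h2

variable [CompactSpace X]

/-- Subjets of a directed supremum are limits of subjets of the members of the family. -/
theorem exists_subJet_near_of_iSup [Nonempty ι] (he : Isometry e) (hU : ∀ i, Continuous (U i))
    (hdir : Directed (· ≤ ·) U) (hu : ∀ z, u z = ⨆ i, (U i (z.1, (z.2 : ℝ)) : EReal))
    {N : ℝ} {z : X × ℝ} {w : E} {a : ℝ} (hz : 0 < z.2) (hN : trunc N u z < N)
    (hj : SubJet e (trunc N u) z w a) {δ : ℝ} (hδ : 0 < δ) :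
    ∃ i y w' a', 0 < y.2 ∧ SubJet e (U i) y w' a' ∧ dist y.1 z.1 < δ ∧ ‖w' - w‖ < δ ∧
      |a' - a| < δ ∧ |U i y - trunc N u z| < δ := by
  have hle : ∀ i (y : X × ℝ), 0 ≤ y.2 → (U i y : EReal) ≤ u (y.1, y.2.toNNReal) := fun i y hy => by
    rw [hu]
    simp only
    rw [toNNReal_pair hy]
    exact le_iSup (fun i => (U i y : EReal)) i
  have hlt : ∀ (c : ℝ) (y : X × ℝ), 0 ≤ y.2 → (c : EReal) < u (y.1, y.2.toNNReal) →
      ∃ i, c < U i y := fun c y hy h => by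
    rw [hu, lt_iSup_iff] at h
    simp only at h
    rw [toNNReal_pair hy] at h
    exact h.imp fun i hi => EReal.coe_lt_coe_iff.1 hi
  have hbot : ∀ y, u y ≠ ⊥ := fun y => by
    obtain ⟨i⟩ := ‹Nonempty ι›
    rw [hu]
    exact ((EReal.bot_lt_coe _).trans_le (le_iSup (fun i => (U i (y.1, (y.2 : ℝ)) : EReal)) i)).ne'
  obtain ⟨g, hg⟩ : ∃ g, g = trunc N u z := ⟨_, rfl⟩
  have hgu : (g : EReal) = u (z.1, z.2.toNNReal) := hg ▸ coe_trunc_of_lt hbot hN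
  obtain ⟨i₀, hi₀⟩ := hlt (g - δ / 2) z hz.le
    (hgu ▸ EReal.coe_lt_coe_iff.2 (by linarith))
  obtain ⟨ρ₁, hρ₁, hb⟩ := Metric.eventually_nhds_iff.1
    (((hU i₀).tendsto z).eventually (lt_mem_nhds (show g - δ < U i₀ z by linarith)))
  have hκ : 0 < δ / 8 := by positivity
  obtain ⟨ρ₀, hρ₀, hn⟩ := hj.exists_near_of_sphere he hκ
  obtain ⟨B, hB⟩ : ∃ B, B = δ / 8 / 4 + (‖w‖ + |a|) + 1 := ⟨_, rfl⟩
  have hB0 : 0 < B := by rw [hB]; positivity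
  obtain ⟨ρ, hρ⟩ : ∃ ρ, ρ = min (min ρ₀ ρ₁) (min (min (z.2 / 2) δ) (δ / (2 * B))) := ⟨_, rfl⟩
  have hρpos : 0 < ρ := by rw [hρ]; positivity
  have hρ1 : ρ ≤ ρ₀ := hρ ▸ (min_le_left _ _).trans (min_le_left _ _)
  have hρ2 : ρ ≤ ρ₁ := hρ ▸ (min_le_left _ _).trans (min_le_right _ _)
  have hρ3 : ρ ≤ z.2 / 2 := hρ ▸ (min_le_right _ _).trans ((min_le_left _ _).trans (min_le_left _ _))
  have hρ4 : ρ ≤ δ := hρ ▸ (min_le_right _ _).trans ((min_le_left _ _).trans (min_le_right _ _))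
  have hρ5 : B * ρ < δ := by
    have : ρ ≤ δ / (2 * B) := hρ ▸ (min_le_right _ _).trans (min_le_right _ _)
    rw [le_div_iff₀ (by positivity)] at this
    nlinarith
  obtain ⟨h1, h2⟩ := hn ρ hρpos hρ1
  have hpos : ∀ y : X × ℝ, dist y z ≤ ρ → 0 < y.2 := fun y hy => by
    have := (abs_le.1 ((abs_snd_sub_le y z).trans hy)).1
    linarith
  rw [← hg] at h1 h2
  have hK : IsCompact (Metric.closedBall z ρ) := by
    rw [← closedBall_prod_same]
    exact Metric.isClosed_closedBall.isCompact.prod (isCompact_closedBall _ _)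
  -- Dini's argument: the sets where `U i` exceeds the slightly lowered affine bound are open,
  -- directed and cover the ball, so one index serves for the whole ball.
  obtain ⟨i₁, hi₁⟩ := hK.elim_directed_cover
    (fun i => {y | g + ⟪w, e y.1 - e z.1⟫ + a * (y.2 - z.2) - 5 / 4 * (δ / 8 * ρ) < U i y})
    (fun i => isOpen_lt (by have := he.continuous; fun_prop) (hU i))
    (fun y hy => by
      rw [Metric.mem_closedBall] at hy
      have h3 := h1 y hy
      have h4 : g + ⟪w, e y.1 - e z.1⟫ + a * (y.2 - z.2) - 5 / 4 * (δ / 8 * ρ) < trunc N u y := by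
        have : 0 < δ / 8 * ρ := by positivity
        linarith
      obtain ⟨i, hi⟩ := hlt _ y (hpos y hy).le
        ((EReal.coe_lt_coe_iff.2 h4).trans_le (coe_trunc_le hbot N y))
      exact mem_iUnion.2 ⟨i, hi⟩)
    (fun i j => (hdir i j).imp fun k hk =>
      ⟨fun y hy => lt_of_lt_of_le hy (hk.1 y), fun y hy => lt_of_lt_of_le hy (hk.2 y)⟩)
  obtain ⟨i, h₀i, h₁i⟩ := hdir i₀ i₁
  obtain ⟨y, w', a', hy, hw', ha', hj', hv⟩ := h2 (U i) ((hU i).lowerSemicontinuous.lowerSemicontinuousOn _)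
    (fun y hy => (hi₁ (Metric.mem_closedBall.2 hy.le)).le.trans (h₁i y)) (by
      have h3 := hle i z hz.le
      rw [← hgu, EReal.coe_le_coe_iff] at h3
      have : 0 < δ / 8 * ρ := by positivity
      linarith)
  refine ⟨i, y, w', a', hpos y hy.le, hj', ?_, by linarith, by linarith, ?_⟩
  · refine lt_of_le_of_lt ?_ (hy.trans_le hρ4)
    rw [Prod.dist_eq]; exact le_max_left _ _
  · have h3 := (hb (hy.trans_le hρ2)).trans_le (h₀i y)
    rw [← hg, abs_lt]
    constructor
    · linarith
    · rw [hB] at hρ5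
      nlinarith

theorem isJetSubsol_of_iSup [Nonempty ι] (he : Isometry e) (hG : IsHamiltonian T G L)
    (hU : ∀ i, Continuous (U i)) (hdir : Directed (· ≤ ·) U)
    (hu : ∀ z, u z = ⨆ i, (U i (z.1, (z.2 : ℝ)) : EReal))
    (hj : ∀ i z w a, 0 < z.2 → SubJet e (U i) z w a → a + G z.1 w (U i z) ≤ 0) :
    IsJetSubsol e G u := fun N z w a hz hN hza =>
  le_zero_of_approx hG.cont fun δ hδ => by
    obtain ⟨i, y, w', a', hy, hj', h1, h2, h3, h4⟩ :=
      exists_subJet_near_of_iSup he hU hdir hu hz hN hza hδ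
    exact ⟨y.1, w', a', U i y, h1, h2, h3, h4, (hj i y w' a' hy hj').trans hδ.le⟩

theorem isJetSupersol_of_iSup [Nonempty ι] (he : Isometry e) (hG : IsHamiltonian T G L)
    (hU : ∀ i, Continuous (U i)) (hdir : Directed (· ≤ ·) U)
    (hu : ∀ z, u z = ⨆ i, (U i (z.1, (z.2 : ℝ)) : EReal))
    (hj : ∀ i z w a, 0 < z.2 → SubJet e (U i) z w a → 0 ≤ a + G z.1 w (U i z)) :
    IsJetSupersol e G u := fun N z w a hz hN hza => by
  have := le_zero_of_approx (G := fun x w r => -G x w r) (a := -a) (w := w) (x := z.1)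
    (r := trunc N u z) hG.cont.neg fun δ hδ => by
      obtain ⟨i, y, w', a', hy, hj', h1, h2, h3, h4⟩ :=
        exists_subJet_near_of_iSup he hU hdir hu hz hN hza hδ
      refine ⟨y.1, w', -a', U i y, h1, h2, ?_, h4, ?_⟩
      · rwa [neg_sub_neg, abs_sub_comm]
      · have := hj i y w' a' hy hj'
        linarith
  linarith

theorem le_liminf_of_isLSC (hu : IsLSC u) (x : X) (s : ℝ≥0) :
    u (x, s) ≤ liminf (fun t : ℝ≥0 => u (x, s + t)) (𝓝[>] 0) := by
  refine (lowerSemicontinuous_iff_le_liminf.1 hu.lsc (x, s)).trans ?_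
  have h1 : Tendsto (fun t : ℝ≥0 => (x, s + t)) (𝓝[>] 0) (𝓝 (x, s)) := by
    have : Continuous fun t : ℝ≥0 => (x, s + t) := by fun_prop
    simpa using (this.tendsto 0).mono_left nhdsWithin_le_nhds
  exact liminf_le_liminf_of_le h1

theorem liminf_le_of_eventually_le {f : ℝ≥0 → EReal} {r C : ℝ}
    (h : ∀ᶠ t in 𝓝[>] 0, f t ≤ ((r + C * t : ℝ) : EReal)) : liminf f (𝓝[>] 0) ≤ r := by
  have h1 : Tendsto (fun t : ℝ≥0 => ((r + C * t : ℝ) : EReal)) (𝓝[>] 0) (𝓝 (r : EReal)) := by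
    have : Continuous fun t : ℝ≥0 => r + C * t := by fun_prop
    have := (this.tendsto 0).mono_left (nhdsWithin_le_nhds (s := Ioi 0))
    simp only [NNReal.coe_zero, mul_zero, add_zero] at this
    exact (continuous_coe_real_ereal.tendsto _).comp this
  exact (liminf_le_liminf h).trans_eq h1.liminf_eq

/-- Upper control in time: subsolutions are right lower semicontinuous at positive times. -/
theorem liminf_eq_of_isJetSubsol [FiniteDimensional ℝ E] (hT : IsTangentField e T)
    (hG : IsHamiltonian T G L) (hu : IsLSC u) (hj : IsJetSubsol e G u) (x : X) {s : ℝ≥0}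
    (hs : 0 < s) : liminf (fun t : ℝ≥0 => u (x, s + t)) (𝓝[>] 0) = u (x, s) := by
  refine le_antisymm ?_ (le_liminf_of_isLSC hu x s)
  by_cases htop : u (x, s) = ⊤
  · rw [htop]; exact le_top
  obtain ⟨r, hr⟩ : ∃ r : ℝ, u (x, s) = r := ⟨_, (EReal.coe_toReal htop (hu.ne_bot _)).symm⟩
  have hl := lowerSemicontinuous_trunc hu (r + 1)
  have hKc : IsCompact ((univ : Set X) ×ˢ Icc 0 ((s : ℝ) + 1)) := isCompact_univ.prod isCompact_Icc
  obtain ⟨y₀, -, hm⟩ := LowerSemicontinuousOn.exists_isMinOn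
    (s := (univ : Set X) ×ˢ Icc 0 ((s : ℝ) + 1))
    ⟨(x, (s : ℝ)), mem_univ _, NNReal.coe_nonneg s, by simp⟩ hKc (hl.lowerSemicontinuousOn _)
  -- `C` bounds `-G` for all values between the minimum of the truncation and its level `r + 1`;
  -- times `t < 1 / (C + 1)` keep `r + C t` below that level.
  obtain ⟨C, hC, hCb⟩ := hG.exists_neg_le (max |trunc (r + 1) u y₀| |r + 1|)
  rw [hr]
  refine liminf_le_of_eventually_le (C := C) ?_
  have h0 : ∀ᶠ t : ℝ≥0 in 𝓝[>] 0, t ∈ Ioo (0 : ℝ≥0) (1 / (C + 1)).toNNReal :=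
    Ioo_mem_nhdsGT (Real.toNNReal_pos.2 (by positivity))
  filter_upwards [h0] with t ht
  have ht1 : (t : ℝ) < 1 / (C + 1) := Real.lt_toNNReal_iff_coe_lt.1 ht.2
  have ht2 : (0 : ℝ) < t := ht.1
  have ht3 : (C + 1) * t < 1 := by rwa [lt_div_iff₀' (by positivity)] at ht1
  have hts : trunc (r + 1) u (x, (s : ℝ)) = r :=
    trunc_eq_of_le hu.ne_bot (by linarith) (by simpa using hr)
  have hCt : 0 ≤ C * t := by positivity
  have h1 := growth_le_of_subJet hT.isometry hl (α := 0) (β := s + 1) (N := r + 1) (x := x)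
    (t := s) (t' := s + t) hC (fun z w a hz hzN hza => by
      have h2 := hj (r + 1) z w a hz.1 hzN hza
      have h3 := hCb z.1 w (trunc (r + 1) u z) (by
        have h4 : trunc (r + 1) u y₀ ≤ trunc (r + 1) u z := hm ⟨mem_univ _, hz.1.le, hz.2.le⟩
        exact abs_le_max_abs_abs h4 hzN.le)
      linarith) (by exact_mod_cast hs) (by linarith) (by nlinarith) (by
        rw [hts]; linarith)
  rw [hts, add_sub_cancel_left] at h1
  have h2 := coe_trunc_of_lt hu.ne_bot (N := r + 1) (z := (x, (s : ℝ) + t)) (by linarith)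
  have h3 : ((s : ℝ) + t).toNNReal = s + t := by
    rw [← NNReal.coe_add, Real.toNNReal_coe]
  simp only [h3] at h2
  rw [← h2]
  exact EReal.coe_le_coe_iff.2 h1

/-- The solution is the supremum of the Lipschitz solutions with data below `φ`. It has the right
initial values because `φ` is the supremum of these data, and the family is directed because a
maximum of two data is admissible and comparison is monotone. -/
theorem exists_isJetSol [FiniteDimensional ℝ E] [Nonempty X] (hT : IsTangentField e T)
    (hG : IsHamiltonian T G L) (hφ : IsLSC φ) : ∃ u : X × ℝ≥0 → EReal, IsLSC u ∧
      IsJetSubsol e G u ∧ IsJetSupersol e G u ∧ (∀ x, u (x, 0) = φ x) ∧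
      ∀ x, liminf (fun t : ℝ≥0 => u (x, t)) (𝓝[>] 0) = φ x := by
  obtain ⟨x₀⟩ := ‹Nonempty X›
  let I := {f : X → ℝ // (∃ K : ℝ≥0, LipschitzWith K f) ∧ ∀ x, (f x : EReal) ≤ φ x}
  have hI : Nonempty I := by
    obtain ⟨c, -, hc⟩ := EReal.lt_iff_exists_real_btwn.1 (bot_lt_iff_ne_bot.2 (hφ.ne_bot x₀))
    obtain ⟨K, f, hf, -, -, hlt⟩ := exists_lipschitz_lt hφ hc
    exact ⟨⟨f, ⟨K, hf⟩, fun x => (hlt x).le⟩⟩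
  choose U hU0 hUlip hUsup hUsub using fun i : I =>
    exists_lipschitz_solution hT hG i.2.1.choose_spec
  have hUc : ∀ i, Continuous (U i) := fun i => continuous_iff_continuousAt.2 fun z => by
    obtain ⟨K, hK⟩ := hUlip i (z.2 + 1)
    refine hK.continuousOn.continuousAt (prod_mem_nhds univ_mem (Iic_mem_nhds (by linarith)))
  have hmono : ∀ i j : I, (∀ x, i.1 x ≤ j.1 x) → U i ≤ U j := fun i j hij z => by
    rcases le_or_gt z.2 0 with hz | hz
    · rw [← Prod.mk.eta (p := z), hU0 i _ _ hz, hU0 j _ _ hz]; exact hij _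
    have hcomp : IsCompact ((univ : Set X) ×ˢ Icc 0 (z.2 + 1)) := isCompact_univ.prod isCompact_Icc
    obtain ⟨N, hN⟩ := hcomp.exists_bound_of_continuousOn (hUc i).continuousOn
    obtain ⟨K, hK⟩ := hUlip i (z.2 + 1)
    exact comparison (G := G) (T₀ := z.2 + 1) (N := N) hT.isometry hG.cont hG.nonneg hG.lip
      (hUc j).lowerSemicontinuous (hK.mono (prod_mono le_rfl Icc_subset_Iic_self))
      (fun y hy => (le_abs_self _).trans (hN y ⟨mem_univ _, hy⟩))
      (fun y w a hy _ h => (hUsub j y w a hy.1 h).ge) (fun y w a hy h => hUsup i y w a hy.1 h)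
      (fun x => by rw [hU0 i x 0 le_rfl, hU0 j x 0 le_rfl]; exact hij x) z.1 ⟨hz.le, by linarith⟩
  have hdir : Directed (· ≤ ·) U := fun i j => by
    obtain ⟨⟨Ki, hi⟩, hi'⟩ := i.2
    obtain ⟨⟨Kj, hj⟩, hj'⟩ := j.2
    refine ⟨⟨fun x => max (i.1 x) (j.1 x), ⟨_, hi.max hj⟩, fun x => ?_⟩,
      hmono _ _ fun x => le_max_left _ _, hmono _ _ fun x => le_max_right _ _⟩
    rcases max_choice (i.1 x) (j.1 x) with h | h <;> simp only [h]
    exacts [hi' x, hj' x]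
  obtain ⟨u, hu⟩ : ∃ u : X × ℝ≥0 → EReal, ∀ z, u z = ⨆ i, (U i (z.1, (z.2 : ℝ)) : EReal) :=
    ⟨_, fun _ => rfl⟩
  have hle : ∀ i z, (U i (z.1, ((z.2 : ℝ≥0) : ℝ)) : EReal) ≤ u z := fun i z => by
    rw [hu]; exact le_iSup (fun i => (U i (z.1, (z.2 : ℝ)) : EReal)) i
  have hlsc : IsLSC u := by
    refine ⟨?_, fun z => ?_⟩
    · rw [funext hu]
      refine lowerSemicontinuous_iSup fun i => Continuous.lowerSemicontinuous ?_
      exact continuous_coe_real_ereal.comp ((hUc i).comp (by fun_prop))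
    · obtain ⟨i⟩ := hI
      exact ((EReal.bot_lt_coe _).trans_le (hle i z)).ne'
  have hinit : ∀ x, u (x, 0) = φ x := fun x => by
    refine le_antisymm ?_ (le_of_forall_lt fun c hc => ?_)
    · rw [hu]
      refine iSup_le fun i => ?_
      simp only [NNReal.coe_zero]
      rw [hU0 i x 0 le_rfl]
      exact i.2.2 x
    · obtain ⟨c', hc1, hc2⟩ := EReal.lt_iff_exists_real_btwn.1 hc
      obtain ⟨K, f, hf, hfx, -, hlt⟩ := exists_lipschitz_lt hφ hc2
      refine hc1.trans_le ?_
      have := hle ⟨f, ⟨K, hf⟩, fun x => (hlt x).le⟩ (x, 0)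
      simp only [NNReal.coe_zero] at this
      rw [hU0 _ x 0 le_rfl] at this
      simpa only [hfx] using this
  refine ⟨u, hlsc, isJetSubsol_of_iSup hT.isometry hG hUc hdir hu
    fun i z w a hz h => (hUsub i z w a hz h).le, isJetSupersol_of_iSup hT.isometry hG hUc hdir hu
    fun i z w a hz h => (hUsub i z w a hz h).ge, hinit, fun x => le_antisymm ?_ ?_⟩
  · by_cases htop : φ x = ⊤
    · rw [htop]; exact le_top
    obtain ⟨r, hr⟩ : ∃ r : ℝ, φ x = r := ⟨_, (EReal.coe_toReal htop (hφ.ne_bot _)).symm⟩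
    obtain ⟨i₀⟩ := hI
    have hcomp : IsCompact ((univ : Set X) ×ˢ Icc (0 : ℝ) 1) := isCompact_univ.prod isCompact_Icc
    obtain ⟨m, hm⟩ := hcomp.exists_bound_of_continuousOn (hUc i₀).continuousOn
    obtain ⟨C, hC, hCb⟩ := hG.exists_neg_le (max |-m| |r + 1|)
    rw [hr]
    refine liminf_le_of_eventually_le (C := C) ?_
    have h0 : ∀ᶠ t : ℝ≥0 in 𝓝[>] 0, t ∈ Ioo (0 : ℝ≥0) (1 / (C + 1)).toNNReal :=
      Ioo_mem_nhdsGT (Real.toNNReal_pos.2 (by positivity))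
    filter_upwards [h0] with t ht
    have ht1 : (t : ℝ) < 1 / (C + 1) := Real.lt_toNNReal_iff_coe_lt.1 ht.2
    have ht2 : (0 : ℝ) < t := ht.1
    have ht3 : (C + 1) * t < 1 := by rwa [lt_div_iff₀' (by positivity)] at ht1
    have hCt : 0 ≤ C * t := by positivity
    rw [hu]
    refine iSup_le fun i => ?_
    -- Passing to a member above the fixed `U i₀` gives a uniform lower bound, so that one growth
    -- constant `C` serves the whole family.
    obtain ⟨j, hij, h0j⟩ := hdir i i₀
    refine EReal.coe_le_coe_iff.2 ((hij _).trans ?_)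
    have hj0 : U j (x, 0) ≤ r := by
      rw [hU0 j x 0 le_rfl, ← EReal.coe_le_coe_iff, ← hr]
      exact j.2.2 x
    have hlim : Tendsto (fun t₀ : ℝ => U j (x, t₀) + C * (t - t₀)) (𝓝[>] 0)
        (𝓝 (U j (x, 0) + C * (t - 0))) := by
      have : Continuous fun t₀ : ℝ => U j (x, t₀) + C * (t - t₀) := by
        have := hUc j
        fun_prop
      exact (this.tendsto 0).mono_left nhdsWithin_le_nhds
    rw [sub_zero] at hlim
    have h5 : ∀ᶠ t₀ : ℝ in 𝓝[>] 0, t₀ ∈ Ioo (0 : ℝ) t := Ioo_mem_nhdsGT ht2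
    have h6 := ge_of_tendsto hlim (b := U j (x, t)) (by
      filter_upwards [h5, hlim.eventually (gt_mem_nhds (show _ < r + 1 by linarith))] with t₀ h7 h8
      refine growth_le_of_subJet hT.isometry (hUc j).lowerSemicontinuous (α := 0) (β := 1)
        (N := r + 1) hC (fun z w a hz hzN hza => ?_) h7.1 h7.2.le (by nlinarith) h8
      have h9 := hUsub j z w a hz.1 hza
      have h10 := hCb z.1 w (U j z) (by
        refine abs_le_max_abs_abs (((abs_le.1 (hm z ⟨mem_univ _, hz.1.le, hz.2.le⟩)).1).trans
          (h0j z)) hzN.le)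
      linarith)
    simp only
    linarith
  · have := le_liminf_of_isLSC hlsc x 0
    rw [hinit] at this
    simpa using this

end HamiltonJacobi

/-! ### Pulling the Hamiltonian back along an embedding -/

namespace HamiltonJacobi

section Embedding

variable {n : ℕ} {M : Type*} [TopologicalSpace M] [ChartedSpace (EuclideanSpace ℝ (Fin n)) M]
  {F : Type*} [NormedAddCommGroup F] [InnerProductSpace ℝ F]

/-- The differential of a map from a manifold to a vector space. -/
noncomputable def vecDiff (n : ℕ) {M : Type*} [TopologicalSpace M]
    [ChartedSpace (EuclideanSpace ℝ (Fin n)) M] {F : Type*} [NormedAddCommGroup F]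
    [InnerProductSpace ℝ F] (e : M → F) (x : M) : TangentSpace (𝓡 n) x →L[ℝ] F :=
  mfderiv (𝓡 n) 𝓘(ℝ, F) e x

/-- The pullback to `T*_x M` of the linear form represented by `w`. -/
noncomputable def pullCov (n : ℕ) {M : Type*} [TopologicalSpace M]
    [ChartedSpace (EuclideanSpace ℝ (Fin n)) M] {F : Type*} [NormedAddCommGroup F]
    [InnerProductSpace ℝ F] (e : M → F) (x : M) (w : F) : CotSpace n x :=
  (innerSL ℝ w).comp (vecDiff n e x)

/-- The tangent space of an embedded manifold, as a subspace of the ambient space. -/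
noncomputable def tanImage (n : ℕ) {M : Type*} [TopologicalSpace M]
    [ChartedSpace (EuclideanSpace ℝ (Fin n)) M] {F : Type*} [NormedAddCommGroup F]
    [InnerProductSpace ℝ F] (e : M → F) (x : M) : Submodule ℝ F :=
  LinearMap.range (vecDiff n e x : TangentSpace (𝓡 n) x →ₗ[ℝ] F)

/-- The Hamiltonian on covectors of the ambient space of an embedded manifold. -/
noncomputable def pullHam (H : ∀ x : M, CotSpace n x → ℝ → ℝ) (e : M → F) (x : M) (w : F) (r : ℝ) :
    ℝ :=
  H x (pullCov n e x w) r

variable {e : M → F} {H : ∀ x : M, CotSpace n x → ℝ → ℝ}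

theorem pullCov_apply (e : M → F) (x : M) (w : F) (v : TangentSpace (𝓡 n) x) :
    pullCov n e x w v = ⟪w, vecDiff n e x v⟫ := rfl

theorem mem_tanImage {x : M} {h : F} :
    h ∈ tanImage n e x ↔ ∃ v : TangentSpace (𝓡 n) x, vecDiff n e x v = h :=
  LinearMap.mem_range

variable [IsManifold (𝓡 n) ∞ M]

theorem hasMFDerivAt_vecDiff (he : ContMDiff (𝓡 n) 𝓘(ℝ, F) ∞ e) (x : M) :
    HasMFDerivAt (𝓡 n) 𝓘(ℝ, F) e x (vecDiff n e x) :=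
  ((he x).mdifferentiableAt (by simp)).hasMFDerivAt

/-- The trivialization at `x₀` turns the differentials into maps on a fixed space, where continuity
makes sense; on the vector space target the coordinate change is the identity. -/
theorem continuousAt_vecDiff_symmL [IsManifold (𝓡 n) 1 M] (he : ContMDiff (𝓡 n) 𝓘(ℝ, F) ∞ e)
    (x₀ : M) :
    ContinuousAt (fun x => (vecDiff n e x).comp ((trivializationAt (EuclideanSpace ℝ (Fin n))
      (TangentSpace (𝓡 n)) x₀).symmL ℝ x)) x₀ := by
  have h := ((he x₀).mfderiv_const (m := 0) (by simp)).continuousAt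
  have h2 : (inTangentCoordinates (𝓡 n) 𝓘(ℝ, F) id e (mfderiv (𝓡 n) 𝓘(ℝ, F) e) x₀) =
      fun x => (vecDiff n e x).comp ((trivializationAt (EuclideanSpace ℝ (Fin n))
      (TangentSpace (𝓡 n)) x₀).symmL ℝ x) := by
    ext x v
    unfold inTangentCoordinates ContinuousLinearMap.inCoordinates
    rw [TangentBundle.continuousLinearMapAt_model_space]
    rfl
  rwa [h2] at h

theorem continuous_pullCov (he : ContMDiff (𝓡 n) 𝓘(ℝ, F) ∞ e) :
    Continuous fun z : M × F => (⟨z.1, pullCov n e z.1 z.2⟩ : CotBundle n M) := by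
  have : IsManifold (𝓡 n) 1 M := .of_le (n := ∞) (by simp)
  refine continuous_iff_continuousAt.2 fun z₀ => ?_
  rw [continuousAt_hom_bundle]
  refine ⟨continuousAt_fst, ?_⟩
  have h2 : (fun z : M × F => ContinuousLinearMap.inCoordinates (EuclideanSpace ℝ (Fin n))
      (fun x : M => TangentSpace (𝓡 n) x) ℝ (Bundle.Trivial M ℝ) z₀.1 z.1 z₀.1 z.1
      (pullCov n e z.1 z.2)) =
      fun z => (innerSL ℝ z.2).comp ((vecDiff n e z.1).comp ((trivializationAt
        (EuclideanSpace ℝ (Fin n)) (TangentSpace (𝓡 n)) z₀.1).symmL ℝ z.1)) := by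
    ext z v
    unfold ContinuousLinearMap.inCoordinates
    have h : (trivializationAt ℝ (Bundle.Trivial M ℝ) z₀.1).continuousLinearMapAt ℝ z.1 =
        ContinuousLinearMap.id ℝ ℝ := Bundle.Trivial.continuousLinearMapAt_trivialization ℝ M ℝ z.1
    rw [h]
    rfl
  simp only
  rw [h2]
  have h3 : ContinuousAt (fun z : M × F => (vecDiff n e z.1).comp ((trivializationAt
        (EuclideanSpace ℝ (Fin n)) (TangentSpace (𝓡 n)) z₀.1).symmL ℝ z.1)) z₀ :=
    (continuousAt_vecDiff_symmL he z₀.1).comp continuousAt_fst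
  have h4 : ContinuousAt (fun z : M × F => innerSL ℝ z.2) z₀ :=
    ((innerSL ℝ).continuous.comp continuous_snd).continuousAt
  exact h4.clm_comp h3

theorem continuous_pullHam (he : ContMDiff (𝓡 n) 𝓘(ℝ, F) ∞ e)
    (hH : Continuous fun z : CotBundle n M × ℝ => H z.1.proj z.1.snd z.2) :
    Continuous fun z : M × F × ℝ => pullHam H e z.1 z.2.1 z.2.2 :=
  hH.comp (((continuous_pullCov he).comp (continuous_fst.prodMk continuous_snd.fst)).prodMk
    continuous_snd.snd)

/-- The differential of an embedding controls the Riemannian norm on a neighborhood. -/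
theorem eventually_norm_le_vecDiff [RiemannianBundle (fun x : M => TangentSpace (𝓡 n) x)]
    [IsContMDiffRiemannianBundle (𝓡 n) ∞ (EuclideanSpace ℝ (Fin n))
      (fun x : M => TangentSpace (𝓡 n) x)] (he : ContMDiff (𝓡 n) 𝓘(ℝ, F) ∞ e)
    (hinj : ∀ x, Function.Injective (vecDiff n e x)) (x₀ : M) :
    ∃ C > 0, ∀ᶠ x in 𝓝 x₀, ∀ v : TangentSpace (𝓡 n) x, ‖v‖ ≤ C * ‖vecDiff n e x v‖ := by
  have : IsManifold (𝓡 n) 1 M := .of_le (n := ∞) (by simp)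
  have : IsContinuousRiemannianBundle (EuclideanSpace ℝ (Fin n))
      (fun x : M => TangentSpace (𝓡 n) x) := by
    obtain ⟨g, hg, h⟩ := IsContMDiffRiemannianBundle.exists_contMDiff (IB := 𝓡 n) (n := ∞)
      (F := EuclideanSpace ℝ (Fin n)) (E := fun x : M => TangentSpace (𝓡 n) x)
    exact ⟨g, hg.continuous, h⟩
  obtain ⟨C, hC, hCb⟩ := eventually_norm_symmL_trivializationAt_lt (EuclideanSpace ℝ (Fin n))
    (fun x : M => TangentSpace (𝓡 n) x) x₀
  have hbase : ∀ᶠ x in 𝓝 x₀, x ∈ (trivializationAt (EuclideanSpace ℝ (Fin n))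
      (TangentSpace (𝓡 n)) x₀).baseSet :=
    (trivializationAt (EuclideanSpace ℝ (Fin n)) (TangentSpace (𝓡 n)) x₀).open_baseSet.mem_nhds (mem_baseSet_trivializationAt _ _ x₀)
  obtain ⟨A, hA⟩ : ∃ A : M → EuclideanSpace ℝ (Fin n) →L[ℝ] F, A = fun x => (vecDiff n e x).comp
    ((trivializationAt (EuclideanSpace ℝ (Fin n)) (TangentSpace (𝓡 n)) x₀).symmL ℝ x) := ⟨_, rfl⟩
  have hAc : ContinuousAt A x₀ := hA ▸ continuousAt_vecDiff_symmL he x₀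
  obtain ⟨K, hK, hanti⟩ := LinearMap.exists_antilipschitzWith
    (A x₀ : EuclideanSpace ℝ (Fin n) →ₗ[ℝ] F) (LinearMap.ker_eq_bot.2 (by
      rw [hA]
      exact (hinj x₀).comp (Function.LeftInverse.injective fun v =>
        (trivializationAt (EuclideanSpace ℝ (Fin n)) (TangentSpace (𝓡 n)) x₀
          ).continuousLinearMapAt_symmL (R := ℝ) (mem_baseSet_trivializationAt _ _ x₀) v)))
  have hK' : (0 : ℝ) < K := hK
  refine ⟨C * (2 * K), by positivity, ?_⟩
  -- The lower bound `1 / K` for `A x₀` loses at most half when `A x` is within `1 / (2K)` of it;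
  -- `C` is the local bound of the trivialization.
  have hη : (0 : ℝ) < 1 / (2 * K) := by positivity
  filter_upwards [hCb, hbase, Metric.tendsto_nhds.1 hAc _ hη] with x h1 h2 h3 v
  obtain ⟨ξ, rfl⟩ : ∃ ξ, (trivializationAt (EuclideanSpace ℝ (Fin n)) (TangentSpace (𝓡 n)) x₀
      ).symmL ℝ x ξ = v :=
    ⟨_, (trivializationAt (EuclideanSpace ℝ (Fin n)) (TangentSpace (𝓡 n)) x₀
      ).symmL_continuousLinearMapAt h2 v⟩
  have h4 : ‖ξ‖ ≤ 2 * K * ‖A x ξ‖ := by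
    have h5 : ‖ξ‖ ≤ K * ‖A x₀ ξ‖ := by
      have := hanti.le_mul_dist ξ 0
      simpa using this
    have h6 : ‖A x ξ - A x₀ ξ‖ ≤ 1 / (2 * K) * ‖ξ‖ := by
      rw [dist_eq_norm] at h3
      exact ((A x - A x₀).le_opNorm ξ).trans (by gcongr)
    have h7 : ‖A x₀ ξ‖ ≤ ‖A x ξ‖ + 1 / (2 * K) * ‖ξ‖ := by
      have := norm_sub_norm_le (A x₀ ξ) (A x ξ)
      rw [norm_sub_rev] at this
      linarith
    have h8 : K * ‖A x₀ ξ‖ ≤ K * ‖A x ξ‖ + ‖ξ‖ / 2 := by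
      have := mul_le_mul_of_nonneg_left h7 hK'.le
      have h9 : (K : ℝ) * (‖A x ξ‖ + 1 / (2 * K) * ‖ξ‖) = K * ‖A x ξ‖ + ‖ξ‖ / 2 := by
        field_simp
      linarith
    linarith
  have h5 : ‖(trivializationAt (EuclideanSpace ℝ (Fin n)) (fun x : M => TangentSpace (𝓡 n) x)
      x₀).symmL ℝ x ξ‖ ≤ C * ‖ξ‖ :=
    (ContinuousLinearMap.le_opNorm _ ξ).trans (by gcongr)
  refine h5.trans ?_
  rw [mul_assoc]
  refine mul_le_mul_of_nonneg_left (h4.trans_eq ?_) hC.le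
  rw [hA]
  rfl

theorem exists_norm_le_vecDiff [CompactSpace M]
    [RiemannianBundle (fun x : M => TangentSpace (𝓡 n) x)]
    [IsContMDiffRiemannianBundle (𝓡 n) ∞ (EuclideanSpace ℝ (Fin n))
      (fun x : M => TangentSpace (𝓡 n) x)] (he : ContMDiff (𝓡 n) 𝓘(ℝ, F) ∞ e)
    (hinj : ∀ x, Function.Injective (vecDiff n e x)) :
    ∃ C > 0, ∀ (x : M) (v : TangentSpace (𝓡 n) x), ‖v‖ ≤ C * ‖vecDiff n e x v‖ := by
  have := isCompact_univ.induction_on (X := M) (p := fun s => ∃ C > 0, ∀ x ∈ s,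
    ∀ v : TangentSpace (𝓡 n) x, ‖v‖ ≤ C * ‖vecDiff n e x v‖) ⟨1, one_pos, by simp⟩
    (fun s t hst ⟨C, hC, h⟩ => ⟨C, hC, fun x hx => h x (hst hx)⟩)
    (fun s t ⟨C, hC, h⟩ ⟨C', hC', h'⟩ => ⟨C + C', add_pos hC hC', fun x hx v => ?_⟩)
    (fun x₀ _ => ?_)
  · obtain ⟨C, hC, h⟩ := this
    exact ⟨C, hC, fun x => h x (mem_univ x)⟩
  · have h0 := norm_nonneg (vecDiff n e x v)
    rcases hx with hx | hx
    · have := h x hx v; nlinarith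
    · have := h' x hx v; nlinarith
  · obtain ⟨C, hC, h⟩ := eventually_norm_le_vecDiff he hinj x₀
    exact ⟨_, nhdsWithin_le_nhds h, C, hC, fun x hx => hx⟩

end Embedding

section Metric

variable {n : ℕ} {M : Type*} [MetricSpace M] [ChartedSpace (EuclideanSpace ℝ (Fin n)) M]
  {F : Type*} [NormedAddCommGroup F] [InnerProductSpace ℝ F] [IsManifold (𝓡 n) ∞ M]
  {e : M → F} {H : ∀ x : M, CotSpace n x → ℝ → ℝ}

/-- For coercivity, the covector represented by a tangent vector `de(v)` takes the value `‖de(v)‖²`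
at `v`. As `‖v‖ ≤ C ‖de(v)‖` by compactness, its Riemannian dual norm is at least `‖de(v)‖ / C`. -/
theorem isHamiltonian_pullHam [CompactSpace M]
    [RiemannianBundle (fun x : M => TangentSpace (𝓡 n) x)]
    [IsContMDiffRiemannianBundle (𝓡 n) ∞ (EuclideanSpace ℝ (Fin n))
      (fun x : M => TangentSpace (𝓡 n) x)] (he : ContMDiff (𝓡 n) 𝓘(ℝ, F) ∞ e)
    (hinj : ∀ x, Function.Injective (vecDiff n e x))
    (hH1 : Continuous fun z : CotBundle n M × ℝ => H z.1.proj z.1.snd z.2)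
    (hH2 : ∀ R : ℝ, 0 < R → ∃ K : ℝ, 0 < K ∧
      ∀ (x : M) (p : CotSpace n x) (u : ℝ), |u| ≤ R → K ≤ ‖p‖ → R < H x p u)
    (hH3 : ∀ (x : M) (u : ℝ), ConvexOn ℝ univ fun p : CotSpace n x => H x p u)
    {L : ℝ≥0} (hH4 : ∀ (x : M) (p : CotSpace n x), LipschitzWith L (H x p)) :
    IsHamiltonian (tanImage n e) (pullHam H e) L where
  cont := continuous_pullHam he hH1
  convex x r := by
    refine ⟨convex_univ, fun w _ w' _ s t hs ht hst => ?_⟩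
    have h := (hH3 x r).2 (mem_univ (pullCov n e x w)) (mem_univ (pullCov n e x w')) hs ht hst
    have h2 : pullCov n e x (s • w + t • w') = s • pullCov n e x w + t • pullCov n e x w' := by
      ext v
      rw [pullCov_apply, inner_add_left, inner_smul_left, inner_smul_left]
      rfl
    simp only at h ⊢
    rw [← h2] at h
    exact h
  nonneg := L.coe_nonneg
  lip x w r r' := by
    have := (hH4 x (pullCov n e x w)).dist_le_mul r r'
    simp only [Real.dist_eq] at this
    exact this
  tang x w w' r h := by
    have h2 : pullCov n e x w = pullCov n e x w' := by
      ext v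
      exact h _ (mem_tanImage.2 ⟨v, rfl⟩)
    simp only [pullHam, h2]
  coer R hR := by
    obtain ⟨K, hK, hKb⟩ := hH2 R hR
    obtain ⟨C, hC, hCb⟩ := exists_norm_le_vecDiff he hinj
    refine ⟨C * K, by positivity, fun x p hp r hr hn => hKb x _ r hr ?_⟩
    obtain ⟨v, rfl⟩ := mem_tanImage.1 hp
    have h1 : ‖pullCov n e x (vecDiff n e x v) v‖ ≤
      ‖pullCov n e x (vecDiff n e x v)‖ * ‖v‖ := ContinuousLinearMap.le_opNorm _ _
    rw [pullCov_apply, real_inner_self_eq_norm_sq] at h1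
    have h2 := hCb x v
    have h3 : 0 < ‖vecDiff n e x v‖ := lt_of_lt_of_le (by positivity) hn
    have h4 := (le_abs_self _).trans h1
    have h5 : ‖vecDiff n e x v‖ ^ 2 ≤ ‖pullCov n e x (vecDiff n e x v)‖ *
        (C * ‖vecDiff n e x v‖) := h4.trans (by gcongr)
    have h6 : ‖vecDiff n e x v‖ ≤ C * ‖pullCov n e x (vecDiff n e x v)‖ := by
      refine le_of_mul_le_mul_right ?_ h3
      linarith
    exact le_of_mul_le_mul_left (hn.trans h6) hC

end Metric

end HamiltonJacobi

/-! ### Charts, tangent spaces of the embedded manifold, and differentiable test functions -/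

namespace HamiltonJacobi

section Chart

variable {n : ℕ} {M : Type*} [MetricSpace M] [ChartedSpace (EuclideanSpace ℝ (Fin n)) M]
  {F : Type*} [NormedAddCommGroup F] [InnerProductSpace ℝ F] [IsManifold (𝓡 n) ∞ M]
  {e : M → F}

theorem contMDiffAt_extChartAt_symm (x : M) {q : EuclideanSpace ℝ (Fin n)}
    (hq : q ∈ (extChartAt (𝓡 n) x).target) :
    ContMDiffAt (𝓡 n) (𝓡 n) ∞ (extChartAt (𝓡 n) x).symm q :=
  (contMDiffOn_extChartAt_symm x).contMDiffAt ((isOpen_extChartAt_target x).mem_nhds hq)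

theorem contDiffAt_comp_extChartAt_symm (hes : ContMDiff (𝓡 n) 𝓘(ℝ, F) ∞ e) (x : M) :
    ContDiffAt ℝ ∞ (e ∘ (extChartAt (𝓡 n) x).symm) (extChartAt (𝓡 n) x x) :=
  (hes.contMDiffAt.comp _ (contMDiffAt_extChartAt_symm x (mem_extChartAt_target x))).contDiffAt

/-- The differential at `x`, read in the model space through the preferred chart at `x`. -/
noncomputable def modelDiff (n : ℕ) {M : Type*} [TopologicalSpace M]
    [ChartedSpace (EuclideanSpace ℝ (Fin n)) M] {F : Type*} [NormedAddCommGroup F]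
    [InnerProductSpace ℝ F] (e : M → F) (x : M) : EuclideanSpace ℝ (Fin n) →L[ℝ] F :=
  vecDiff n e x

theorem hasFDerivAt_modelDiff {f : M → F} {x : M} (h : MDifferentiableAt (𝓡 n) 𝓘(ℝ, F) f x) :
    HasFDerivAt (f ∘ (extChartAt (𝓡 n) x).symm) (modelDiff n f x) (extChartAt (𝓡 n) x x) := by
  have h2 := h.hasMFDerivAt.2
  rw [ModelWithCorners.range_eq_univ] at h2
  have h3 : HasFDerivWithinAt (f ∘ (extChartAt (𝓡 n) x).symm) (modelDiff n f x) univ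
    (extChartAt (𝓡 n) x x) := h2
  exact hasFDerivWithinAt_univ.1 h3

theorem hasFDerivAt_modelDiff_of_contMDiff (hes : ContMDiff (𝓡 n) 𝓘(ℝ, F) ∞ e) (x : M) :
    HasFDerivAt (e ∘ (extChartAt (𝓡 n) x).symm) (modelDiff n e x) (extChartAt (𝓡 n) x x) :=
  hasFDerivAt_modelDiff ((hes x).mdifferentiableAt (by simp))

theorem fderiv_comp_extChartAt_symm_mem (hes : ContMDiff (𝓡 n) 𝓘(ℝ, F) ∞ e) (x : M)
    {q : EuclideanSpace ℝ (Fin n)} (hq : q ∈ (extChartAt (𝓡 n) x).target)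
    (ξ : EuclideanSpace ℝ (Fin n)) :
    fderiv ℝ (e ∘ (extChartAt (𝓡 n) x).symm) q ξ ∈
      tanImage n e ((extChartAt (𝓡 n) x).symm q) := by
  have h1 := ((contMDiffAt_extChartAt_symm x hq).mdifferentiableAt (by simp)).hasMFDerivAt
  have h2 := (hasMFDerivAt_vecDiff hes ((extChartAt (𝓡 n) x).symm q)).comp q h1
  refine mem_tanImage.2 ⟨mfderiv (𝓡 n) (𝓡 n) (extChartAt (𝓡 n) x).symm q ξ, ?_⟩
  rw [← mfderiv_eq_fderiv, h2.mfderiv]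
  rfl

theorem tendsto_extChartAt_pair (x₀ : M) :
    Tendsto (fun p : M × M => (extChartAt (𝓡 n) x₀ p.1, extChartAt (𝓡 n) x₀ p.2)) (𝓝 (x₀, x₀))
      (𝓝 (extChartAt (𝓡 n) x₀ x₀, extChartAt (𝓡 n) x₀ x₀)) :=
  (((continuousAt_extChartAt x₀).tendsto.comp continuousAt_fst.tendsto)).prodMk_nhds
    ((continuousAt_extChartAt x₀).tendsto.comp continuousAt_snd.tendsto)

theorem eventually_mem_source_pair (x₀ : M) :
    ∀ᶠ p : M × M in 𝓝 (x₀, x₀),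
      p.1 ∈ (extChartAt (𝓡 n) x₀).source ∧ p.2 ∈ (extChartAt (𝓡 n) x₀).source := by
  have h := extChartAt_source_mem_nhds (I := 𝓡 n) x₀
  exact ((continuous_fst.tendsto (x₀, x₀)).eventually_mem h).and
    ((continuous_snd.tendsto (x₀, x₀)).eventually_mem h)

/-- This is strict differentiability in the chart at `x₀`: both points may move, which is needed for
the uniform estimates near the diagonal. -/
theorem eventually_norm_sub_vecDiff_le (hes : ContMDiff (𝓡 n) 𝓘(ℝ, F) ∞ e) (x₀ : M) {η : ℝ}
    (hη : 0 < η) : ∀ᶠ p : M × M in 𝓝 (x₀, x₀),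
      ‖e p.1 - e p.2 - modelDiff n e x₀ (extChartAt (𝓡 n) x₀ p.1 - extChartAt (𝓡 n) x₀ p.2)‖ ≤
        η * ‖extChartAt (𝓡 n) x₀ p.1 - extChartAt (𝓡 n) x₀ p.2‖ := by
  have h1 := (contDiffAt_comp_extChartAt_symm hes x₀).hasStrictFDerivAt (by simp)
  rw [(hasFDerivAt_modelDiff_of_contMDiff hes x₀).fderiv] at h1
  filter_upwards [(tendsto_extChartAt_pair x₀).eventually (h1.isLittleO.def hη),
    eventually_mem_source_pair (n := n) x₀] with p h2 h3
  simp only [Function.comp_apply, (extChartAt (𝓡 n) x₀).left_inv h3.1,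
    (extChartAt (𝓡 n) x₀).left_inv h3.2] at h2
  exact h2

theorem exists_norm_extChartAt_sub_le (he : Isometry e) (hes : ContMDiff (𝓡 n) 𝓘(ℝ, F) ∞ e)
    (x₀ : M) (hinj : Function.Injective (vecDiff n e x₀)) : ∃ K > 0, ∀ᶠ p : M × M in 𝓝 (x₀, x₀),
      ‖extChartAt (𝓡 n) x₀ p.1 - extChartAt (𝓡 n) x₀ p.2‖ ≤ K * dist p.1 p.2 := by
  obtain ⟨D, hD⟩ : ∃ D, D = modelDiff n e x₀ := ⟨_, rfl⟩
  obtain ⟨K, hK, hanti⟩ := LinearMap.exists_antilipschitzWith (D : EuclideanSpace ℝ (Fin n) →ₗ[ℝ] F)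
    (LinearMap.ker_eq_bot.2 (hD ▸ hinj))
  have hK' : (0 : ℝ) < K := hK
  refine ⟨2 * K, by positivity, ?_⟩
  filter_upwards [eventually_norm_sub_vecDiff_le hes x₀ (η := 1 / (2 * K)) (by positivity)]
    with p hp
  obtain ⟨ξ, hξ⟩ : ∃ ξ, ξ = extChartAt (𝓡 n) x₀ p.1 - extChartAt (𝓡 n) x₀ p.2 := ⟨_, rfl⟩
  have hp : ‖e p.1 - e p.2 - D ξ‖ ≤ 1 / (2 * K) * ‖ξ‖ := by rw [hξ, hD]; exact hp
  rw [← hξ, ← he.dist_eq, dist_eq_norm]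
  have h5 : ‖ξ‖ ≤ K * ‖D ξ‖ := by
    have := hanti.le_mul_dist ξ 0
    simpa using this
  have h7 : ‖D ξ‖ ≤ ‖e p.1 - e p.2‖ + 1 / (2 * K) * ‖ξ‖ := by
    have := norm_sub_norm_le (D ξ) (e p.1 - e p.2)
    rw [norm_sub_rev (D ξ)] at this
    linarith
  have h8 := mul_le_mul_of_nonneg_left h7 hK'.le
  have h9 : (K : ℝ) * (‖e p.1 - e p.2‖ + 1 / (2 * K) * ‖ξ‖) =
      K * ‖e p.1 - e p.2‖ + ‖ξ‖ / 2 := by field_simp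
  linarith

/-- Curves are straight lines in a chart. For the uniform secant estimate, the uniformity of a
compact space is the supremum of the neighbourhood filters of the diagonal points, so it suffices to
work near each `(x₀, x₀)`. -/
theorem isTangentField_tanImage [CompactSpace M] (he : Isometry e)
    (hes : ContMDiff (𝓡 n) 𝓘(ℝ, F) ∞ e) (hinj : ∀ x, Function.Injective (vecDiff n e x)) :
    IsTangentField e (tanImage n e) where
  isometry := he
  curve x h hh := by
    obtain ⟨v, rfl⟩ := mem_tanImage.1 hh
    obtain ⟨ξ, hξ⟩ : ∃ ξ : EuclideanSpace ℝ (Fin n), ξ = v := ⟨_, rfl⟩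
    refine ⟨fun τ => (extChartAt (𝓡 n) x).symm (extChartAt (𝓡 n) x x + τ • ξ), ?_⟩
    have h1 := ((hasFDerivAt_modelDiff_of_contMDiff hes x).hasLineDerivAt
      ξ).tendsto_slope_zero_right
    have h2 : modelDiff n e x ξ = vecDiff n e x v := by rw [hξ]; rfl
    rw [h2] at h1
    simpa only [Function.comp_apply, extChartAt_to_inv] using h1
  approx κ hκ := by
    have hmem : {p : M × M | ∃ h ∈ tanImage n e p.1, ‖e p.2 - e p.1 - h‖ ≤ κ * dist p.1 p.2} ∈
        uniformity M := by
      rw [compactSpace_uniformity, mem_iSup]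
      intro x₀
      obtain ⟨K, hK, hKb⟩ := exists_norm_extChartAt_sub_le he hes x₀ (hinj x₀)
      -- There are two errors, from linearizing at `x₀` and from moving the base point to `p.1`;
      -- each is at most half of `κ * dist p.1 p.2`.
      have hη : 0 < κ / (2 * K) := by positivity
      have hc : ContinuousAt (fderiv ℝ (e ∘ (extChartAt (𝓡 n) x₀).symm)) (extChartAt (𝓡 n) x₀ x₀) :=
        ((contDiffAt_comp_extChartAt_symm hes x₀).fderiv_right (m := 0) (by simp)).continuousAt
      have hc2 := (hc.tendsto.comp (continuousAt_extChartAt x₀).tendsto).comp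
        (continuous_fst.tendsto ((x₀, x₀) : M × M))
      rw [(hasFDerivAt_modelDiff_of_contMDiff hes x₀).fderiv] at hc2
      have h4 : ∀ᶠ p : M × M in 𝓝 (x₀, x₀), ‖e p.2 - e p.1 - modelDiff n e x₀
          (extChartAt (𝓡 n) x₀ p.2 - extChartAt (𝓡 n) x₀ p.1)‖ ≤
          κ / (2 * K) * ‖extChartAt (𝓡 n) x₀ p.2 - extChartAt (𝓡 n) x₀ p.1‖ :=
        (continuous_swap.tendsto ((x₀, x₀) : M × M)).eventually
          (eventually_norm_sub_vecDiff_le hes x₀ hη)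
      filter_upwards [hKb, h4, eventually_mem_source_pair (n := n) x₀, Metric.tendsto_nhds.1 hc2 _ hη]
        with p h1 h2 h3 h5
      obtain ⟨ξ, hξ⟩ : ∃ ξ, ξ = extChartAt (𝓡 n) x₀ p.2 - extChartAt (𝓡 n) x₀ p.1 := ⟨_, rfl⟩
      rw [norm_sub_rev, ← hξ] at h1
      rw [← hξ] at h2
      have h6 := fderiv_comp_extChartAt_symm_mem hes x₀ ((extChartAt (𝓡 n) x₀).map_source h3.1) ξ
      rw [(extChartAt (𝓡 n) x₀).left_inv h3.1] at h6
      refine ⟨_, h6, ?_⟩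
      obtain ⟨D, hD⟩ : ∃ D, D = modelDiff n e x₀ := ⟨_, rfl⟩
      obtain ⟨D', hD'⟩ : ∃ D', D' = fderiv ℝ (e ∘ (extChartAt (𝓡 n) x₀).symm)
        (extChartAt (𝓡 n) x₀ p.1) := ⟨_, rfl⟩
      have h2 : ‖e p.2 - e p.1 - D ξ‖ ≤ κ / (2 * K) * ‖ξ‖ := by rw [hD]; exact h2
      have h5 : ‖D' - D‖ < κ / (2 * K) := by rw [hD, hD', ← dist_eq_norm]; exact h5
      rw [← hD']
      have h7 : ‖(D' - D) ξ‖ ≤ κ / (2 * K) * ‖ξ‖ := ((D' - D).le_opNorm ξ).trans (by gcongr)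
      have h8 : e p.2 - e p.1 - D' ξ = (e p.2 - e p.1 - D ξ) - (D' - D) ξ := by
        rw [_root_.sub_apply]; abel
      rw [h8]
      refine (norm_sub_le _ _).trans ?_
      have h9 : κ / (2 * K) * ‖ξ‖ ≤ κ / (2 * K) * (K * dist p.1 p.2) := by gcongr
      have h10 : κ / (2 * K) * (K * dist p.1 p.2) = κ * dist p.1 p.2 / 2 := by field_simp
      linarith
    obtain ⟨ρ, hρ, h⟩ := Metric.mem_uniformity_dist.1 hmem
    exact ⟨ρ, hρ, fun x y hxy => h hxy⟩

/-- A left inverse of the differential extends the covector to the ambient space, where it is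
represented by a vector. -/
theorem exists_pullCov_eq [FiniteDimensional ℝ F] {x : M}
    (hinj : Function.Injective (vecDiff n e x)) (p : CotSpace n x) : ∃ w, pullCov n e x w = p := by
  obtain ⟨g, hg⟩ := LinearMap.exists_leftInverse_of_injective
    (vecDiff n e x : TangentSpace (𝓡 n) x →ₗ[ℝ] F) (LinearMap.ker_eq_bot.2 hinj)
  let l : F →ₗ[ℝ] ℝ := (p : TangentSpace (𝓡 n) x →ₗ[ℝ] ℝ).comp g
  refine ⟨(InnerProductSpace.toDual ℝ F).symm (LinearMap.toContinuousLinearMap l), ?_⟩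
  ext v
  rw [pullCov_apply, InnerProductSpace.toDual_symm_apply]
  have := LinearMap.congr_fun hg v
  exact congrArg p this

/-- A differentiable function touching `v` from below provides a subjet. -/
theorem SubJet.of_mdifferentiableAt [FiniteDimensional ℝ F] (he : Isometry e)
    (hes : ContMDiff (𝓡 n) 𝓘(ℝ, F) ∞ e) (hinj : ∀ x, Function.Injective (vecDiff n e x))
    {v ψ : M × ℝ → ℝ} {z : M × ℝ}
    (hψ : MDifferentiableAt ((𝓡 n).prod 𝓘(ℝ, ℝ)) 𝓘(ℝ, ℝ) ψ z)
    (h : ∀ᶠ y in 𝓝 z, v z + (ψ y - ψ z) ≤ v y) :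
    ∃ w, pullCov n e z.1 w = spaceDiff ψ z.1 z.2 ∧ SubJet e v z w (timeDeriv ψ z.1 z.2) := by
  obtain ⟨w, hw⟩ := exists_pullCov_eq (hinj z.1) (spaceDiff ψ z.1 z.2)
  refine ⟨w, hw, ?_⟩
  obtain ⟨x, t⟩ := z
  simp only at hw ⊢
  obtain ⟨Φ, hΦ⟩ : ∃ Φ : EuclideanSpace ℝ (Fin n) × ℝ → ℝ,
    Φ = fun q => ψ ((extChartAt (𝓡 n) x).symm q.1, q.2) := ⟨_, rfl⟩
  obtain ⟨D, hD⟩ : ∃ D, HasFDerivAt Φ D (extChartAt (𝓡 n) x x, t) := by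
    have h2 := hψ.differentiableWithinAt_writtenInExtChartAt
    rw [ModelWithCorners.range_eq_univ, differentiableWithinAt_univ] at h2
    rw [hΦ]
    exact ⟨_, h2.hasFDerivAt⟩
  have hspace : ∀ ξ : EuclideanSpace ℝ (Fin n), D (ξ, 0) = ⟪w, modelDiff n e x ξ⟫ := fun ξ => by
    have h3 : MDifferentiableAt (𝓡 n) 𝓘(ℝ, ℝ) (fun y => ψ (y, t)) x :=
      MDifferentiableAt.comp (I' := (𝓡 n).prod 𝓘(ℝ, ℝ)) x hψ
        (mdifferentiableAt_id.prodMk mdifferentiableAt_const)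
    have h4 := hasFDerivAt_modelDiff h3
    have h5 := hD.comp (extChartAt (𝓡 n) x x) (hasFDerivAt_prodMk_left (𝕜 := ℝ) _ t)
    have h6 : Φ ∘ (fun q => (q, t)) = (fun y => ψ (y, t)) ∘ (extChartAt (𝓡 n) x).symm := by
      rw [hΦ]; rfl
    rw [h6] at h5
    have h7 := congrArg (fun A : EuclideanSpace ℝ (Fin n) →L[ℝ] ℝ => A ξ) (h5.unique h4)
    have h8 : spaceDiff ψ x t ξ = ⟪w, modelDiff n e x ξ⟫ := by rw [← hw]; rfl
    rw [← h8]
    exact h7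
  have htime : D (0, 1) = timeDeriv ψ x t := by
    have h5 := hD.comp t (hasFDerivAt_prodMk_right (𝕜 := ℝ) (extChartAt (𝓡 n) x x) t)
    have h6 : Φ ∘ (fun s => (extChartAt (𝓡 n) x x, s)) = fun s => ψ (x, s) := by
      rw [hΦ]
      ext s
      simp
    rw [h6] at h5
    have := h5.hasDerivAt.deriv
    unfold timeDeriv
    rw [this]
    simp
  obtain ⟨K, hK, hKb⟩ := exists_norm_extChartAt_sub_le he hes x (hinj x)
  have hdiag : Tendsto (fun y : M × ℝ => (y.1, x)) (𝓝 (x, t)) (𝓝 (x, x)) :=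
    continuousAt_fst.tendsto.prodMk_nhds tendsto_const_nhds
  intro ε hε
  -- The first term is the linearization error of `ψ` in coordinates; the second comes from
  -- replacing coordinate increments by ambient ones in the pairing with `w`.
  obtain ⟨η, hη, hηε⟩ : ∃ η > 0, η * (K + 1) + ‖w‖ * (η * K) ≤ ε := by
    refine ⟨ε / (K + 1 + ‖w‖ * K), by positivity, le_of_eq ?_⟩
    field_simp
  have hΦd : Tendsto (fun y : M × ℝ => (extChartAt (𝓡 n) x y.1, y.2)) (𝓝 (x, t))
      (𝓝 (extChartAt (𝓡 n) x x, t)) :=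
    ((continuousAt_extChartAt x).tendsto.comp continuousAt_fst.tendsto).prodMk_nhds
      continuousAt_snd.tendsto
  filter_upwards [h, hdiag.eventually hKb, hdiag.eventually (eventually_norm_sub_vecDiff_le hes x hη),
    hΦd.eventually (hD.isLittleO.def hη),
    (continuous_fst.tendsto (x, t)).eventually_mem (extChartAt_source_mem_nhds (I := 𝓡 n) x)] with y h1 h2 h3 h4 h5
  have h6 : Φ (extChartAt (𝓡 n) x y.1, y.2) = ψ y := by
    rw [hΦ]
    simp only
    rw [(extChartAt (𝓡 n) x).left_inv h5]
  have h7 : Φ (extChartAt (𝓡 n) x x, t) = ψ (x, t) := by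
    rw [hΦ]
    simp
  rw [h6, h7] at h4
  obtain ⟨ξ, hξ⟩ : ∃ ξ, ξ = extChartAt (𝓡 n) x y.1 - extChartAt (𝓡 n) x x := ⟨_, rfl⟩
  have h8 : D ((extChartAt (𝓡 n) x y.1, y.2) - (extChartAt (𝓡 n) x x, t)) =
      ⟪w, modelDiff n e x ξ⟫ + timeDeriv ψ x t * (y.2 - t) := by
    rw [← hspace, ← htime, mul_comm, ← smul_eq_mul, ← map_smul, ← map_add, hξ]
    simp
  obtain ⟨d, hd⟩ : ∃ d, d = dist y (x, t) := ⟨_, rfl⟩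
  have hd0 : 0 ≤ d := hd ▸ dist_nonneg
  have hd1 : dist y.1 x ≤ d := by rw [hd, Prod.dist_eq]; exact le_max_left _ _
  have hd2 : |y.2 - t| ≤ d := by rw [hd, ← Real.dist_eq, Prod.dist_eq]; exact le_max_right _ _
  rw [← hξ] at h2 h3
  have h9 : ‖ξ‖ ≤ K * d := h2.trans (by gcongr)
  have h10 : ‖((extChartAt (𝓡 n) x y.1, y.2) - (extChartAt (𝓡 n) x x, t) :
      EuclideanSpace ℝ (Fin n) × ℝ)‖ ≤ (K + 1) * d := by
    rw [Prod.norm_def]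
    refine max_le ?_ ?_
    · simp only [Prod.fst_sub]
      rw [← hξ]
      linarith
    · simp only [Prod.snd_sub, Real.norm_eq_abs]
      nlinarith
  rw [h8] at h4
  have h11 := (abs_le.1 h4).1
  have h12 : ⟪w, e y.1 - e x - modelDiff n e x ξ⟫ ≤ ‖w‖ * (η * (K * d)) :=
    (real_inner_le_norm _ _).trans (by gcongr; exact h3.trans (by gcongr))
  rw [inner_sub_right] at h12
  have h13 : η * ‖((extChartAt (𝓡 n) x y.1, y.2) - (extChartAt (𝓡 n) x x, t) :
      EuclideanSpace ℝ (Fin n) × ℝ)‖ ≤ η * ((K + 1) * d) := by gcongr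
  have h14 : η * ((K + 1) * d) + ‖w‖ * (η * (K * d)) ≤ ε * d := by
    have := mul_le_mul_of_nonneg_right hηε hd0
    linarith
  rw [← hd]
  linarith

end Chart

end HamiltonJacobi

/-! ### Equivalence of test functions and subjets -/

namespace HamiltonJacobi

section Transfer

variable {n : ℕ} {M : Type*} [MetricSpace M] [ChartedSpace (EuclideanSpace ℝ (Fin n)) M]
  {F : Type*} [NormedAddCommGroup F] [InnerProductSpace ℝ F] [IsManifold (𝓡 n) ∞ M]
  {e : M → F} {H : ∀ x : M, CotSpace n x → ℝ → ℝ} {u : M × ℝ≥0 → EReal}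

/-- Truncating one unit above the value at the contact point leaves the contact intact, because the
test function rises by less than one nearby. -/
theorem TouchesBelow.exists_subJet [FiniteDimensional ℝ F] (he : Isometry e)
    (hes : ContMDiff (𝓡 n) 𝓘(ℝ, F) ∞ e) (hinj : ∀ x, Function.Injective (vecDiff n e x))
    (hu : IsLSC u) {ψ : M × ℝ → ℝ} {x : M} {t : ℝ≥0} (h : TouchesBelow n u ψ x t) :
    ∃ N w, pullCov n e x w = spaceDiff ψ x t ∧ trunc N u (x, (t : ℝ)) < N ∧
      trunc N u (x, (t : ℝ)) = (u (x, t)).toReal ∧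
      SubJet e (trunc N u) (x, (t : ℝ)) w (timeDeriv ψ x t) := by
  obtain ⟨r, hr⟩ : ∃ r : ℝ, u (x, t) = r := ⟨_, (EReal.coe_toReal h.finite (hu.ne_bot _)).symm⟩
  have ht : (0 : ℝ) < t := h.pos
  have hψ : ContMDiffAt ((𝓡 n).prod 𝓘(ℝ, ℝ)) 𝓘(ℝ, ℝ) 1 ψ (x, (t : ℝ)) :=
    h.contMDiffOn.contMDiffAt (prod_mem_nhds univ_mem (Ioi_mem_nhds ht))
  have htr : trunc (r + 1) u (x, (t : ℝ)) = r :=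
    trunc_eq_of_le hu.ne_bot (by linarith) (by simpa using hr)
  obtain ⟨w, hw, hj⟩ := SubJet.of_mdifferentiableAt he hes hinj (v := trunc (r + 1) u)
    (hψ.mdifferentiableAt one_ne_zero) (by
      have h1 : ∀ᶠ y in 𝓝 (x, (t : ℝ)), ψ y < ψ (x, (t : ℝ)) + 1 :=
        hψ.continuousAt.eventually (gt_mem_nhds (by linarith))
      have h2 : ∀ᶠ y : M × ℝ in 𝓝 (x, (t : ℝ)), 0 < y.2 :=
        (continuous_snd.tendsto (x, (t : ℝ))).eventually (lt_mem_nhds ht)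
      filter_upwards [h1, h2] with y h1 h2
      rw [htr]
      refine le_trunc hu.ne_bot (by linarith) ?_
      have h3 := h.isMin y.1 y.2.toNNReal (Real.toNNReal_pos.2 h2)
      rw [hr, toNNReal_pair h2.le, ← EReal.coe_sub] at h3
      have h4 := (EReal.le_sub_iff_add_le (Or.inl (EReal.coe_ne_bot _))
        (Or.inl (EReal.coe_ne_top _))).1 h3
      refine le_trans (le_of_eq ?_) h4
      rw [← EReal.coe_add, EReal.coe_eq_coe_iff]
      ring)
  exact ⟨r + 1, w, hw, by linarith, by rw [htr, hr, EReal.toReal_coe], hj⟩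

theorem IsJetSubsol.isBJSubsol [FiniteDimensional ℝ F] (he : Isometry e)
    (hes : ContMDiff (𝓡 n) 𝓘(ℝ, F) ∞ e) (hinj : ∀ x, Function.Injective (vecDiff n e x))
    (hu : IsLSC u) (hj : IsJetSubsol e (pullHam H e) u) : IsBJSubsol H u := fun ψ x t h => by
  obtain ⟨N, w, hw, hN, htr, hs⟩ := TouchesBelow.exists_subJet he hes hinj hu h
  have := hj N _ w _ (NNReal.coe_pos.2 h.pos) hN hs
  rwa [htr, pullHam, hw] at this

theorem IsJetSupersol.isBJSupersol [FiniteDimensional ℝ F] (he : Isometry e)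
    (hes : ContMDiff (𝓡 n) 𝓘(ℝ, F) ∞ e) (hinj : ∀ x, Function.Injective (vecDiff n e x))
    (hu : IsLSC u) (hj : IsJetSupersol e (pullHam H e) u) : IsBJSupersol H u := fun ψ x t h => by
  obtain ⟨N, w, hw, hN, htr, hs⟩ := TouchesBelow.exists_subJet he hes hinj hu h
  have := hj N _ w _ (NNReal.coe_pos.2 h.pos) hN hs
  rwa [htr, pullHam, hw] at this

/-- A strict lower bound on a ball can be extended to a global one by subtracting a smooth function
that vanishes near the center. -/
theorem exists_contMDiff_le [CompactSpace M] {m : M × ℝ → ℝ} (hm : LowerSemicontinuous m)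
    (y : M × ℝ) {r : ℝ} (hr : 0 < r) : ∃ g : M × ℝ → ℝ,
      ContMDiff ((𝓡 n).prod 𝓘(ℝ, ℝ)) 𝓘(ℝ, ℝ) 1 g ∧ (∀ p, g p ≤ 0) ∧
      (∀ p, dist p y < r / 2 → g p = 0) ∧ ∀ p, r ≤ dist p y → g p ≤ m p := by
  obtain ⟨g, hg⟩ := exists_contMDiffMap_forall_mem_convex_of_local_const ((𝓡 n).prod 𝓘(ℝ, ℝ))
    (M := M × ℝ) (F := ℝ) (n := 1)
    (t := fun p => {c | c ≤ 0 ∧ (dist p y < r / 2 → c = 0) ∧ (r ≤ dist p y → c ≤ m p)})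
    (fun p => by
      intro c hc c' hc' s s' hs hs' hss
      obtain ⟨h1, h2, h3⟩ := hc
      obtain ⟨h1', h2', h3'⟩ := hc'
      simp only [smul_eq_mul]
      refine ⟨?_, fun h => ?_, fun h => ?_⟩
      · nlinarith
      · rw [h2 h, h2' h]; ring
      · have h4 := h3 h
        have h5 := h3' h
        calc s * c + s' * c' ≤ s * m p + s' * m p := by gcongr
          _ = m p := by rw [← add_mul, hss, one_mul])
    (fun p => by
      have hd : Continuous fun p : M × ℝ => dist p y := by fun_prop
      rcases lt_or_ge (dist p y) r with h | h
      · refine ⟨0, ?_⟩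
        filter_upwards [(hd.tendsto p).eventually (gt_mem_nhds h)] with q hq
        exact ⟨le_rfl, fun _ => rfl, fun h' => absurd h' (not_le.2 hq)⟩
      · refine ⟨min 0 (m p - 1), ?_⟩
        filter_upwards [(hd.tendsto p).eventually (lt_mem_nhds (show r / 2 < dist p y by linarith)),
          hm p (m p - 1) (by linarith)] with q hq hq'
        exact ⟨min_le_left _ _, fun h' => absurd h' hq.not_gt,
          fun _ => (min_le_right _ _).trans hq'.le⟩)
  exact ⟨g, g.contMDiff, fun p => (hg p).1, fun p => (hg p).2.1, fun p => (hg p).2.2⟩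

/-- A subjet need not come from a global `C¹` test function, but nearby ones do. Subtracting a steep
paraboloid moves the contact to a point `y` with a minimum over a ball, and a smooth correction
supported away from `y` makes this minimum global. -/
theorem SubJet.exists_touchesBelow [CompactSpace M] [FiniteDimensional ℝ F] (he : Isometry e)
    (hes : ContMDiff (𝓡 n) 𝓘(ℝ, F) ∞ e) (hu : IsLSC u) {N : ℝ} {z : M × ℝ} {w : F} {a : ℝ}
    (hz : 0 < z.2) (hN : trunc N u z < N) (hj : SubJet e (trunc N u) z w a) {δ : ℝ} (hδ : 0 < δ) :
    ∃ (ψ : M × ℝ → ℝ) (x : M) (t : ℝ≥0) (w' : F), TouchesBelow n u ψ x t ∧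
      spaceDiff ψ x t = pullCov n e x w' ∧ dist x z.1 < δ ∧ ‖w' - w‖ < δ ∧
      |timeDeriv ψ x t - a| < δ ∧ |(u (x, t)).toReal - trunc N u z| < δ := by
  obtain ⟨v, hv⟩ : ∃ v, v = trunc N u := ⟨_, rfl⟩
  have hvl : LowerSemicontinuous v := hv ▸ lowerSemicontinuous_trunc hu N
  rw [← hv] at hN hj
  obtain ⟨ρ₀, hρ₀, hb₀⟩ := Metric.eventually_nhds_iff.1 (hj (δ / 8) (by positivity))
  obtain ⟨ρ₁, hρ₁, hb₁⟩ := Metric.eventually_nhds_iff.1 (hvl z (v z - δ) (by linarith))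
  obtain ⟨B, hB⟩ : ∃ B, B = ‖w‖ + |a| + 1 := ⟨_, rfl⟩
  have hB0 : 0 < B := by rw [hB]; positivity
  -- `σ ≤ N - v z` keeps the value at the new contact point below the truncation level, where `u` is
  -- finite and equals its truncation.
  obtain ⟨σ, hσ⟩ : ∃ σ, σ = min δ (N - v z) := ⟨_, rfl⟩
  have hσ0 : 0 < σ := hσ ▸ lt_min hδ (sub_pos.2 hN)
  obtain ⟨ρ, hρ⟩ : ∃ ρ, ρ = min (min (ρ₀ / 2) ρ₁) (min (min (z.2 / 2) δ) (σ / (2 * B))) := ⟨_, rfl⟩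
  have hρpos : 0 < ρ := by rw [hρ]; positivity
  have hρ1 : ρ ≤ ρ₀ / 2 := hρ ▸ (min_le_left _ _).trans (min_le_left _ _)
  have hρ2 : ρ ≤ ρ₁ := hρ ▸ (min_le_left _ _).trans (min_le_right _ _)
  have hρ3 : ρ ≤ z.2 / 2 := hρ ▸ (min_le_right _ _).trans ((min_le_left _ _).trans (min_le_left _ _))
  have hρ4 : ρ ≤ δ := hρ ▸ (min_le_right _ _).trans ((min_le_left _ _).trans (min_le_right _ _))
  have hρ5 : B * ρ < σ := by
    have : ρ ≤ σ / (2 * B) := hρ ▸ (min_le_right _ _).trans (min_le_right _ _)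
    rw [le_div_iff₀ (by positivity)] at this
    nlinarith
  obtain ⟨A, hA⟩ : ∃ A, A = 2 * (δ / 8) / ρ := ⟨_, rfl⟩
  have hA0 : 0 ≤ A := by rw [hA]; positivity
  have hAρ : A * ρ = δ / 4 := by rw [hA]; field_simp; ring
  obtain ⟨y, hy, -, hle, hmin⟩ := exists_subJet_of_sphere he (v := v) (w := w) (a := a)
    (A := A) (c := v z) hρpos (hvl.lowerSemicontinuousOn _) (fun y hy => by
      have h2 := hb₀ (show dist y z < ρ₀ by linarith)
      rw [pow_two, ← mul_assoc, hAρ]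
      rw [hy] at h2
      have : 0 < δ * ρ := by positivity
      linarith) hA0 le_rfl
  have hd1 : ‖e y.1 - e z.1‖ ≤ dist y z := by
    rw [← dist_eq_norm, he.dist_eq, Prod.dist_eq]; exact le_max_left _ _
  have hd2 : |y.2 - z.2| ≤ dist y z := by
    rw [← Real.dist_eq, Prod.dist_eq]; exact le_max_right _ _
  have hy2 : 0 < y.2 := by
    have := (abs_le.1 hd2).1
    linarith
  have hvy : v y < v z + σ := by
    have h1 := real_inner_le_norm w (e y.1 - e z.1)
    have h2 := le_abs_self (a * (y.2 - z.2))
    rw [abs_mul] at h2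
    have h3 := mul_nonneg hA0 (sqDist_nonneg y z)
    have h4 : ‖w‖ * ‖e y.1 - e z.1‖ ≤ ‖w‖ * ρ := by gcongr; linarith
    have h5 : |a| * |y.2 - z.2| ≤ |a| * ρ := by gcongr; linarith
    rw [hB] at hρ5
    linarith
  have hvN : v y < N := hvy.trans_le (by linarith [min_le_right δ (N - v z)])
  have huy : u (y.1, y.2.toNNReal) = v y := by
    rw [hv] at hvN ⊢
    exact (coe_trunc_of_lt hu.ne_bot hvN).symm
  -- the quadratic part of the test function
  obtain ⟨P, hP⟩ : ∃ P : F → ℝ, P = fun q => ⟪w, q⟫ - A * ‖q - e z.1‖ ^ 2 := ⟨_, rfl⟩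
  obtain ⟨β, hβ⟩ : ∃ β : ℝ → ℝ, β = fun s => a * s - A * (s - z.2) ^ 2 := ⟨_, rfl⟩
  have hPβ : ∀ p : M × ℝ, ⟪w, e p.1⟫ + a * p.2 - A * sqDist p z = P (e p.1) + β p.2 := fun p => by
    rw [hP, hβ, sqDist, ← he.dist_eq, dist_eq_norm]
    ring
  simp only [hPβ] at hmin
  have hPs : ContDiff ℝ 1 P := by
    rw [hP]
    exact (contDiff_const.inner ℝ contDiff_id).sub
      (contDiff_const.mul ((contDiff_id.sub contDiff_const).norm_sq ℝ))
  have hβs : ContDiff ℝ 1 β := by rw [hβ]; fun_prop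
  have hQs : ContMDiff ((𝓡 n).prod 𝓘(ℝ, ℝ)) 𝓘(ℝ, ℝ) 1 fun p : M × ℝ => P (e p.1) + β p.2 :=
    (hPs.contMDiff.comp ((hes.of_le (by simp)).comp contMDiff_fst)).add
      (hβs.contMDiff.comp contMDiff_snd)
  have hr : 0 < ρ - dist y z := sub_pos.2 hy
  -- `g` vanishes near `y`, hence does not change the derivatives there; outside the ball around `y`
  -- it pushes the test function below the truncation, with the values at `y` as normalization.
  obtain ⟨g, hgs, hg0, hgz, hgm⟩ := exists_contMDiff_le (n := n)
    (m := fun p => v p + (-(P (e p.1) + β p.2) - (v y - (P (e y.1) + β y.2))))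
    (hvl.add (Continuous.lowerSemicontinuous (by have := hQs.continuous; fun_prop))) y hr
  have hgy : ∀ᶠ p in 𝓝 y, g p = 0 := by
    filter_upwards [Metric.ball_mem_nhds y (half_pos hr)] with p hp
    exact hgz p hp
  have ht : ((y.2.toNNReal : ℝ≥0) : ℝ) = y.2 := Real.coe_toNNReal _ hy2.le
  have hspace : HasMFDerivAt (𝓡 n) 𝓘(ℝ, ℝ) (fun x => P (e x) + β y.2 + g (x, y.2)) y.1
      (pullCov n e y.1 (w - (2 * A) • (e y.1 - e z.1))) := by
    have h1 : HasFDerivAt (fun q => P q + β y.2)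
        (innerSL ℝ (w - (2 * A) • (e y.1 - e z.1))) (e y.1) := by
      rw [hP]
      exact (hasFDerivAt_quadratic w (e z.1) (e y.1) A).add_const _
    have h2 := h1.hasMFDerivAt.comp y.1 (hasMFDerivAt_vecDiff hes y.1)
    refine HasMFDerivAt.congr_of_eventuallyEq h2 ?_
    have h3 : Tendsto (fun x : M => (x, y.2)) (𝓝 y.1) (𝓝 y) :=
      (Continuous.prodMk_left y.2).tendsto y.1
    filter_upwards [h3.eventually hgy] with x hx
    simp [hx]
  have htime : HasDerivAt (fun s => P (e y.1) + β s + g (y.1, s))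
      (a - 2 * A * (y.2 - z.2)) y.2 := by
    have h1 : HasDerivAt (fun s => P (e y.1) + β s) (a - 2 * A * (y.2 - z.2)) y.2 := by
      rw [hβ]
      exact (hasDerivAt_quadratic a z.2 y.2 A).const_add _
    refine h1.congr_of_eventuallyEq ?_
    have h3 : Tendsto (fun s : ℝ => (y.1, s)) (𝓝 y.2) (𝓝 y) :=
      (Continuous.prodMk_right y.1).tendsto y.2
    filter_upwards [h3.eventually hgy] with x hx
    simp [hx]
  refine ⟨fun p => P (e p.1) + β p.2 + g p, y.1, y.2.toNNReal,
    w - (2 * A) • (e y.1 - e z.1), ⟨Real.toNNReal_pos.2 hy2, ?_, ?_, fun x s hs => ?_⟩,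
    ?_, ?_, ?_, ?_, ?_⟩
  · exact (hQs.add hgs).contMDiffOn
  · rw [huy]; exact EReal.coe_ne_top _
  · obtain ⟨p, hp⟩ : ∃ p : M × ℝ, p = (x, (s : ℝ)) := ⟨_, rfl⟩
    have hup : (v p : EReal) ≤ u (x, s) := by
      have := coe_trunc_le hu.ne_bot N p
      rw [← hv, hp, Real.toNNReal_coe] at this
      rwa [hp]
    have hkey : v y - (P (e y.1) + β y.2 + g y) ≤ v p - (P (e p.1) + β p.2 + g p) := by
      rw [hgy.self_of_nhds]
      rcases lt_or_ge (dist p y) (ρ - dist y z) with h | h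
      · have h1 := hmin p (by linarith [dist_triangle p y z])
        have h2 := hg0 p
        linarith
      · have h1 := hgm p h
        linarith
    rw [huy, ht]
    simp only
    have h3 : (fun p : M × ℝ => P (e p.1) + β p.2 + g p) (x, (s : ℝ)) =
        P (e p.1) + β p.2 + g p := by rw [hp]
    simp only at h3
    rw [h3]
    refine le_trans ?_ (EReal.sub_le_sub hup le_rfl)
    rw [← EReal.coe_sub, ← EReal.coe_sub, EReal.coe_le_coe_iff]
    exact hkey
  · rw [spaceDiff, ht]
    exact hspace.mfderiv
  · rw [← he.dist_eq, dist_eq_norm]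
    linarith
  · rw [sub_sub_cancel_left, norm_neg, norm_smul, Real.norm_eq_abs, abs_of_nonneg (by positivity)]
    nlinarith
  · rw [timeDeriv, ht, htime.deriv, sub_sub_cancel_left, abs_neg, abs_mul,
      abs_of_nonneg (by positivity : 0 ≤ 2 * A)]
    nlinarith
  · rw [huy, EReal.toReal_coe, ← hv, abs_lt]
    have := hb₁ (hy.trans_le hρ2)
    have := min_le_left δ (N - v z)
    constructor <;> linarith

theorem IsBJSubsol.isJetSubsol [CompactSpace M] [FiniteDimensional ℝ F] (he : Isometry e)
    (hes : ContMDiff (𝓡 n) 𝓘(ℝ, F) ∞ e)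
    (hG : Continuous fun z : M × F × ℝ => pullHam H e z.1 z.2.1 z.2.2) (hu : IsLSC u)
    (hs : IsBJSubsol H u) : IsJetSubsol e (pullHam H e) u := fun N z w a hz hN hj =>
  le_zero_of_approx hG fun δ hδ => by
    obtain ⟨ψ, x, t, w', ht, hw, h1, h2, h3, h4⟩ := hj.exists_touchesBelow he hes hu hz hN hδ
    have h5 := hs ψ x t ht
    rw [hw] at h5
    exact ⟨x, w', _, _, h1, h2, h3, h4, h5.trans hδ.le⟩

theorem IsBJSupersol.isJetSupersol [CompactSpace M] [FiniteDimensional ℝ F] (he : Isometry e)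
    (hes : ContMDiff (𝓡 n) 𝓘(ℝ, F) ∞ e)
    (hG : Continuous fun z : M × F × ℝ => pullHam H e z.1 z.2.1 z.2.2) (hu : IsLSC u)
    (hs : IsBJSupersol H u) : IsJetSupersol e (pullHam H e) u := fun N z w a hz hN hj => by
  have := le_zero_of_approx (G := fun x w r => -pullHam H e x w r) (a := -a) (w := w) (x := z.1)
    (r := trunc N u z) hG.neg fun δ hδ => by
      obtain ⟨ψ, x, t, w', ht, hw, h1, h2, h3, h4⟩ := hj.exists_touchesBelow he hes hu hz hN hδ
      have h5 := hs ψ x t ht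
      rw [hw] at h5
      refine ⟨x, w', -timeDeriv ψ x t, (u (x, t)).toReal, h1, h2, ?_, h4, ?_⟩
      · rwa [neg_sub_neg, abs_sub_comm]
      · have h6 : 0 ≤ timeDeriv ψ x t + pullHam H e x w' (u (x, t)).toReal := h5
        linarith
  linarith

end Transfer

end HamiltonJacobi

/-! ### The Cauchy problem on the manifold and the semigroup -/

namespace HamiltonJacobi

section CauchyProblem

variable {n : ℕ} {M : Type*} [MetricSpace M] [CompactSpace M]
  [ChartedSpace (EuclideanSpace ℝ (Fin n)) M] [IsManifold (𝓡 n) ∞ M]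
  {F : Type*} [NormedAddCommGroup F] [InnerProductSpace ℝ F] [FiniteDimensional ℝ F]
  {e : M → F} {H : ∀ x : M, CotSpace n x → ℝ → ℝ} {L : ℝ} {φ : M → EReal} {u v : M × ℝ≥0 → EReal}

theorem IsBJCauchySol.le (he : Isometry e) (hes : ContMDiff (𝓡 n) 𝓘(ℝ, F) ∞ e)
    (hinj : ∀ x, Function.Injective (vecDiff n e x))
    (hG : IsHamiltonian (tanImage n e) (pullHam H e) L) (hv : IsBJCauchySol H φ v)
    (hu : IsBJCauchySol H φ u) : v ≤ u := fun z =>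
  le_of_isJetSubsol_of_isJetSupersol (isTangentField_tanImage he hes hinj) hG hv.isLSC hu.isLSC
    (IsBJSubsol.isJetSubsol he hes hG.cont hv.isLSC hv.sub)
    (IsBJSupersol.isJetSupersol he hes hG.cont hu.isLSC hu.super) hv.init hu.init hv.init_liminf
    z.1 z.2

theorem existsUnique_isBJCauchySol [Nonempty M] (he : Isometry e)
    (hes : ContMDiff (𝓡 n) 𝓘(ℝ, F) ∞ e) (hinj : ∀ x, Function.Injective (vecDiff n e x))
    (hG : IsHamiltonian (tanImage n e) (pullHam H e) L) (hφ : IsLSC φ) :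
    ∃! u, IsBJCauchySol H φ u := by
  obtain ⟨u, hu, hsub, hsup, h0, hlim⟩ :=
    exists_isJetSol (isTangentField_tanImage he hes hinj) hG hφ
  have hsol : IsBJCauchySol H φ u := ⟨hu, hsub.isBJSubsol he hes hinj hu,
    hsup.isBJSupersol he hes hinj hu, h0, hlim⟩
  exact ⟨u, hsol, fun v hv => le_antisymm (IsBJCauchySol.le he hes hinj hG hv hsol)
    (IsBJCauchySol.le he hes hinj hG hsol hv)⟩

/-- The equation is invariant under time shifts. Only the liminf condition needs an argument: it is
part of the definition when `s = 0`, and follows from the growth bound for subsolutions when `s >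
0`. -/
theorem IsBJCauchySol.shift (he : Isometry e) (hes : ContMDiff (𝓡 n) 𝓘(ℝ, F) ∞ e)
    (hinj : ∀ x, Function.Injective (vecDiff n e x))
    (hG : IsHamiltonian (tanImage n e) (pullHam H e) L) (hu : IsBJCauchySol H φ u) (s : ℝ≥0) :
    IsBJCauchySol H (fun x => u (x, s)) fun z => u (z.1, s + z.2) := by
  have hsub := IsBJSubsol.isJetSubsol he hes hG.cont hu.isLSC hu.sub
  have hsup := IsBJSupersol.isJetSupersol he hes hG.cont hu.isLSC hu.super
  have hlsc : IsLSC fun z : M × ℝ≥0 => u (z.1, s + z.2) :=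
    ⟨hu.isLSC.lsc.comp (by fun_prop), fun z => hu.isLSC.ne_bot _⟩
  refine ⟨hlsc, (hsub.comp_add s).isBJSubsol he hes hinj hlsc,
    (hsup.comp_add s).isBJSupersol he hes hinj hlsc, fun x => by simp, fun x => ?_⟩
  rcases eq_or_ne s 0 with rfl | hs
  · simpa only [zero_add, hu.init] using hu.init_liminf x
  · exact liminf_eq_of_isJetSubsol (isTangentField_tanImage he hes hinj) hG hu.isLSC hsub x
      (pos_iff_ne_zero.2 hs)

end CauchyProblem

/-- A compact manifold carries a compatible metric for which some smooth map with injective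
differentials into a Euclidean space is isometric. -/
theorem exists_metricSpace_isometry {n : ℕ} {M : Type*} [t : TopologicalSpace M] [T2Space M]
    [CompactSpace M] [ChartedSpace (EuclideanSpace ℝ (Fin n)) M] [IsManifold (𝓡 n) ∞ M] :
    ∃ (N : ℕ) (e : M → EuclideanSpace ℝ (Fin N)) (m : MetricSpace M),
      m.toUniformSpace.toTopologicalSpace = t ∧
      ContMDiff (𝓡 n) 𝓘(ℝ, EuclideanSpace ℝ (Fin N)) ∞ e ∧
      (∀ x, Function.Injective (vecDiff n e x)) ∧ Isometry e := by
  obtain ⟨N, e, he, hemb, hinj⟩ := exists_embedding_euclidean_of_compact (I := 𝓡 n) (M := M)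
  exact ⟨N, e, hemb.isEmbedding.comapMetricSpace, rfl, he, hinj, fun x y => rfl⟩

theorem existsUnique_and_shift {n : ℕ} {M : Type*} [TopologicalSpace M] [T2Space M] [CompactSpace M]
    [Nonempty M] [ChartedSpace (EuclideanSpace ℝ (Fin n)) M] [IsManifold (𝓡 n) ∞ M]
    [RiemannianBundle (fun x : M => TangentSpace (𝓡 n) x)]
    [IsContMDiffRiemannianBundle (𝓡 n) ∞ (EuclideanSpace ℝ (Fin n))
      (fun x : M => TangentSpace (𝓡 n) x)]
    {H : ∀ x : M, CotSpace n x → ℝ → ℝ}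
    (hH1 : Continuous fun z : CotBundle n M × ℝ => H z.1.proj z.1.snd z.2)
    (hH2 : ∀ R : ℝ, 0 < R → ∃ K : ℝ, 0 < K ∧
      ∀ (x : M) (p : CotSpace n x) (u : ℝ), |u| ≤ R → K ≤ ‖p‖ → R < H x p u)
    (hH3 : ∀ (x : M) (u : ℝ), ConvexOn ℝ univ fun p : CotSpace n x => H x p u)
    {L : ℝ≥0} (hH4 : ∀ (x : M) (p : CotSpace n x), LipschitzWith L (H x p)) :
    (∀ φ : M → EReal, IsLSC φ → ∃! u : M × ℝ≥0 → EReal, IsBJCauchySol H φ u) ∧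
    ∀ (φ : M → EReal) (u : M × ℝ≥0 → EReal) (s : ℝ≥0), IsBJCauchySol H φ u →
      IsBJCauchySol H (fun x => u (x, s)) fun z => u (z.1, s + z.2) := by
  -- The chordal metric replaces the given topology by definition. The Riemannian metric enters only
  -- through the norm in the coercivity condition.
  obtain ⟨N, e, m, rfl, hes, hinj, he⟩ := exists_metricSpace_isometry (n := n) (M := M)
  have hG := isHamiltonian_pullHam hes hinj hH1 hH2 hH3 hH4
  exact ⟨fun φ hφ => existsUnique_isBJCauchySol he hes hinj hG hφ,
    fun φ u s hu => IsBJCauchySol.shift he hes hinj hG hu s⟩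

end HamiltonJacobi

theorem theorem3p1 {n : ℕ} {M : Type*} [TopologicalSpace M] [T2Space M] [CompactSpace M]
    [ConnectedSpace M] [ChartedSpace (EuclideanSpace ℝ (Fin n)) M] [IsManifold (𝓡 n) ∞ M]
    [RiemannianBundle (fun x : M => TangentSpace (𝓡 n) x)]
    [IsContMDiffRiemannianBundle (𝓡 n) ∞ (EuclideanSpace ℝ (Fin n))
      (fun x : M => TangentSpace (𝓡 n) x)]
    (H : ∀ x : M, CotSpace n x → ℝ → ℝ)
    (hH1 : Continuous fun z : CotBundle n M × ℝ => H z.1.proj z.1.snd z.2)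
    (hH2 : ∀ R : ℝ, 0 < R → ∃ K : ℝ, 0 < K ∧
      ∀ (x : M) (p : CotSpace n x) (u : ℝ), |u| ≤ R → K ≤ ‖p‖ → R < H x p u)
    (hH3 : ∀ (x : M) (u : ℝ), ConvexOn ℝ univ fun p : CotSpace n x => H x p u)
    (hH4 : ∃ L : ℝ≥0, ∀ (x : M) (p : CotSpace n x), LipschitzWith L (H x p)) :
    (∀ φ : M → EReal, IsLSC φ → ∃! u : M × ℝ≥0 → EReal, IsBJCauchySol H φ u) ∧
    ∃ S : ℝ≥0 → LSCFun M → LSCFun M,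
      (∀ φ : LSCFun M, IsBJCauchySol H φ.1 fun z => (S z.2 φ).1 z.1) ∧
      S 0 = id ∧ ∀ s t : ℝ≥0, S t ∘ S s = S (t + s) := by
  obtain ⟨L, hL⟩ := hH4
  obtain ⟨hex, hshift⟩ := HamiltonJacobi.existsUnique_and_shift hH1 hH2 hH3 hL
  choose U hU hUuniq using fun φ : LSCFun M => hex φ.1 φ.2
  have hlsc : ∀ (φ : LSCFun M) (t : ℝ≥0), IsLSC fun x => U φ (x, t) := fun φ t =>
    ⟨(hU φ).isLSC.lsc.comp (by fun_prop), fun x => (hU φ).isLSC.ne_bot _⟩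
  refine ⟨hex, fun t φ => ⟨fun x => U φ (x, t), hlsc φ t⟩, fun φ => hU φ, ?_, fun s t => ?_⟩
  · funext φ
    exact Subtype.ext (funext (hU φ).init)
  · funext φ
    refine Subtype.ext (funext fun x => ?_)
    -- The shifted solution starts from the value at time `s`, so uniqueness identifies it with the
    -- solution having that datum.
    have h := hUuniq ⟨fun x => U φ (x, s), hlsc φ s⟩ _ (hshift φ.1 (U φ) s (hU φ))
    have h2 := congrFun h (x, t)
    simp only at h2
    rw [add_comm s t] at h2
    exact h2.symm
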